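/- Let $m,n\ge 0$ be integers. A \emph{generalized Brascamp--Lieb datum} $(\mathbf B,\mathbf c,\mathcal Q,\mathbf G)$ consists of linear surjections $B_j:\mathbb R^n\to\mathbb R^{n_j}$, exponents $c_j\in\mathbb R\setminus\{0\}$ and positive definite (self-adjoint) $G_j:\mathbb R^{n_j}\to\mathbb R^{n_j}$ for $j=1,\dots,m$, together with a self-adjoint $\mathcal Q:\mathbb R^n\to\mathbb R^n$. Matrix inequalities refer to the usual order of self-adjoint transformations, and $\mathbf A\le\mathbf G$ means $A_j\le G_j$ for all $j$. Put $J_+=\{j: c_j>0\}$ and $\mathbf B_+x=(B_jx)_{j\in J_+}$, and let $s^+(\mathcal Q)$ be the number of positive eigenvalues of $\mathcal Q$ counted with multiplicity. The datum is \emph{non-degenerate} if $$\mathcal Q|_{\ker\mathbf B_+}>0,\qquad n\ge s^+(\mathcal Q)+\sum_{j\in J_+}n_j,\qquad \mathcal Q+\sum_{j\in J_+}c_jB_j^*G_jB_j>0 .$$ For measurable $f_j:\mathbb R^{n_j}\to[0,\infty]$ with $\int f_j\in(0,\infty)$, let $$\mathrm{BL}(\mathbf B,\mathbf c,\mathcal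 Q;\mathbf f)=\frac{\int_{\mathbb R^n}e^{-\pi\langle x,\mathcal Qx\rangle}\prod_{j=1}^m f_j(B_jx)^{c_j}\,dx}{\prod_{j=1}^m\big(\int_{\mathbb R^{n_j}}f_j\big)^{c_j}}\in[0,\infty]$$ (with $0\cdot\infty=0$). For positive definite $A$ let $g_A(x)=(\det A)^{1/2}e^{-\pi\langle x,Ax\rangle}$, and for a tuple $\mathbf A=(A_j)$ of positive definite transformations $A_j$ of $\mathbb R^{n_j}$ let $\mathrm{BL}(\mathbf B,\mathbf c,\mathcal Q;\mathbf A)$ be the value of the functional at $f_j=g_{A_j}$. Let $T(G_j)$ be the set of all functions $g_{G_j}*\mu$ with $\mu$ a positive finite Borel measure on $\mathbb R^{n_j}$ of non-zero mass, and let $$\mathrm I(\mathbf B,\mathbf c,\mathcal Q,\mathbf G)=\inf_{f_j\in T(G_j)\ \forall j}\mathrm{BL}(\mathbf B,\mathbf c,\mathcal Q;\mathbf f),\qquad \mathrm I_{\mathrm g}(\mathbf B,\mathbf c,\mathcal Q,\mathbf G)=\inf_{0<A_j\le G_j\ \forall j}\mathrm{BL}(\mathbf B,\mathbf c,\mathcal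 Q;\mathbf A).$$ Write $\widetilde M(\mathbf A)=\sum_{j=1}^m c_jB_j^*A_jB_j+\mathcal Q$, and let $\Lambda(\mathbf B,\mathbf c,\mathcal Q)$ be the set of tuples $\mathbf A$ of positive definite transformations with $\widetilde M(\mathbf A)>0$. The datum is \emph{gaussian extremizable} if $\mathrm I_{\mathrm g}(\mathbf B,\mathbf c,\mathcal Q,\mathbf G)=\mathrm{BL}(\mathbf B,\mathbf c,\mathcal Q;\mathbf A)$ for some $\mathbf A\in\Lambda(\mathbf B,\mathbf c,\mathcal Q)$ with $\mathbf A\le\mathbf G$. \textbf{Theorem.} Let $(\mathbf B,\mathbf c,\mathcal Q,\mathbf G)$ be a non-degenerate generalized Brascamp--Lieb datum. Then the following are equivalent. (1) $(\mathbf B,\mathbf c,\mathcal Q,\mathbf G)$ is gaussian extremizable. (2) There exists $\mathbf A\in\Lambda(\mathbf B,\mathbf c,\mathcal Q)$ with $\mathbf A\le\mathbf G$ such that, for all $j=1,\dots,m$, with $\widetilde M=\widetilde M(\mathbf A)$, $$c_j\big(A_j^{-1}-B_j\widetilde M^{-1}B_j^*\big)\le 0\qquad\text{and}\qquad \big(A_j^{-1}-B_j\widetilde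 M^{-1}B_j^*\big)(G_j-A_j)=0 .$$ (3) There exists $\mathbf A\in\Lambda(\mathbf B,\mathbf c,\mathcal Q)$ with $\mathbf A\le\mathbf G$ such that $$\mathrm I(\mathbf B,\mathbf c,\mathcal Q,\mathbf G)=\mathrm I_{\mathrm g}(\mathbf B,\mathbf c,\mathcal Q,\mathbf G)=\mathrm{BL}(\mathbf B,\mathbf c,\mathcal Q;\mathbf A)\in(0,\infty).$$ -/

import Mathlib

open MeasureTheory
open scoped Matrix MatrixOrder ENNReal

noncomputable section

namespace InverseBrascampLieb

/-- A Brascamp--Lieb datum `(B, c, Q)` on `ℝⁿ` with `m` inputs: linear surjections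
`B j : ℝⁿ → ℝ^(dim j)`, non-zero real exponents `c j`, and a self-adjoint `Q : ℝⁿ → ℝⁿ`.
Linear transformations are given by their matrices in the standard bases. -/
structure Datum (m n : ℕ) where
  /-- the dimensions of the target spaces -/
  dim : Fin m → ℕ
  /-- the linear transformations -/
  B : (j : Fin m) → Matrix (Fin (dim j)) (Fin n) ℝ
  /-- the exponents, of either sign -/
  c : Fin m → ℝ
  /-- the transformation in the gaussian kernel -/
  Q : Matrix (Fin n) (Fin n) ℝ
  surjective_B : ∀ j, Function.Surjective fun x : Fin n → ℝ => B j *ᵥ x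
  c_ne_zero : ∀ j, c j ≠ 0
  isHermitian_Q : Q.IsHermitian

/-- A generalized Brascamp--Lieb datum `(B, c, Q, G)`: a datum `(B, c, Q)` with positive definite
`G j` on `ℝ^(dim j)`. -/
structure GenDatum (m n : ℕ) extends Datum m n where
  /-- the transformations fixing the types of the inputs -/
  G : (j : Fin m) → Matrix (Fin (dim j)) (Fin (dim j)) ℝ
  posDef_G : ∀ j, (G j).PosDef

/-- The normalized centred gaussian `g_A(x) = (det A)^(1/2) exp(-π ⟨x, A x⟩)`. -/
def gaussian {k : ℕ} (A : Matrix (Fin k) (Fin k) ℝ) (x : Fin k → ℝ) : ℝ :=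
  Real.sqrt A.det * Real.exp (-Real.pi * (x ⬝ᵥ A *ᵥ x))

/-- The functions of type `G`: all `g_G ∗ μ`, with `μ` a finite Borel measure of non-zero mass. -/
def typeClass {k : ℕ} (G : Matrix (Fin k) (Fin k) ℝ) : Set ((Fin k → ℝ) → ℝ≥0∞) :=
  {f | ∃ μ : Measure (Fin k → ℝ), IsFiniteMeasure μ ∧ μ ≠ 0 ∧
    f = fun x => ∫⁻ y, ENNReal.ofReal (gaussian G (x - y)) ∂μ}

namespace Datum

variable {m n : ℕ} (D : Datum m n)

/-- Tuples of functions `f j : ℝ^(dim j) → [0, ∞]`. -/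
abbrev Input : Type := (j : Fin m) → (Fin (D.dim j) → ℝ) → ℝ≥0∞

/-- Tuples of transformations `A j : ℝ^(dim j) → ℝ^(dim j)`. -/
abbrev MatrixTuple : Type := (j : Fin m) → Matrix (Fin (D.dim j)) (Fin (D.dim j)) ℝ

/-- The Brascamp--Lieb functional
`BL(f) = ∫ exp(-π ⟨x, Q x⟩) ∏ j, f j (B j x) ^ c j dx / ∏ j, (∫ f j) ^ c j`. -/
def BL (f : D.Input) : ℝ≥0∞ :=
  (∫⁻ x : Fin n → ℝ, ENNReal.ofReal (Real.exp (-Real.pi * (x ⬝ᵥ D.Q *ᵥ x))) *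
      ∏ j, f j (D.B j *ᵥ x) ^ D.c j) /
    ∏ j, (∫⁻ y, f j y) ^ D.c j

/-- The value `BL(A)` of the functional at the gaussian input `(g_{A j})_j`. -/
def BLGaussian (A : D.MatrixTuple) : ℝ≥0∞ :=
  D.BL fun j y => ENNReal.ofReal (gaussian (A j) y)

/-- `M̃(A) = ∑ j, c j (B j)ᵀ (A j) (B j) + Q`. -/
def Mtilde (A : D.MatrixTuple) : Matrix (Fin n) (Fin n) ℝ :=
  ∑ j, D.c j • ((D.B j)ᵀ * A j * D.B j) + D.Q

/-- The class `Λ(B, c, Q)` of positive definite tuples `A` with `M̃(A) > 0`. -/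
def Lambda : Set D.MatrixTuple :=
  {A | (∀ j, (A j).PosDef) ∧ (D.Mtilde A).PosDef}

/-- The map `B₊ x = (B j x)_{j : c j > 0}`. -/
def Bplus : (Fin n → ℝ) →ₗ[ℝ] ((j : {j : Fin m // 0 < D.c j}) → Fin (D.dim j) → ℝ) :=
  LinearMap.pi fun j => (D.B j).mulVecLin

/-- The number `s⁺(Q)` of positive eigenvalues of `Q`, counted with multiplicity. -/
def sPlus : ℕ := (Finset.univ.filter fun i => 0 < D.isHermitian_Q.eigenvalues i).card

/-- Non-degeneracy of `(B, c, Q)`: `Q > 0` on `ker B₊`, and `n ≥ s⁺(Q) + ∑_{c j > 0} dim j`. -/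
def Nondegenerate : Prop :=
  (∀ x ∈ LinearMap.ker D.Bplus, x ≠ 0 → 0 < x ⬝ᵥ D.Q *ᵥ x) ∧
    D.sPlus + ∑ j with 0 < D.c j, D.dim j ≤ n

end Datum

namespace GenDatum

variable {m n : ℕ} (D : GenDatum m n)

/-- Non-degeneracy of `(B, c, Q, G)`: that of `(B, c, Q)`, and
`Q + ∑_{c j > 0} c j (B j)ᵀ (G j) (B j) > 0`. -/
def Nondegenerate : Prop :=
  D.toDatum.Nondegenerate ∧
    (D.Q + ∑ j with 0 < D.c j, D.c j • ((D.B j)ᵀ * D.G j * D.B j)).PosDef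

/-- `I(B, c, Q, G)`: the infimum of `BL(f)` over inputs with `f j` of type `G j`. -/
def I : ℝ≥0∞ := ⨅ f ∈ {f : D.Input | ∀ j, f j ∈ typeClass (D.G j)}, D.BL f

/-- `I_g(B, c, Q, G)`: the infimum of `BL(A)` over positive definite `A ≤ G`. -/
def Ig : ℝ≥0∞ := ⨅ A ∈ {A : D.MatrixTuple | ∀ j, (A j).PosDef ∧ A j ≤ D.G j}, D.BLGaussian A

/-- The datum is gaussian extremizable if `I_g = BL(A)` for some `A ∈ Λ(B, c, Q)`, `A ≤ G`. -/
def GaussianExtremizable : Prop :=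
  ∃ A ∈ D.Lambda, (∀ j, A j ≤ D.G j) ∧ D.Ig = D.BLGaussian A

end GenDatum

end InverseBrascampLieb

end

/-! (1) → (2) is first-order calculus. On `Lambda`, 2 log BL(A) = ∑ c_j log det A_j − log det M̃(A)
(`BLGaussian_eq`), and adding t v vᵀ to A_j multiplies each of det A_j and det M̃ by an explicit
affine function of t. Decreasing A_j is always admissible and yields the sign condition; increasing
A_j along the rows of S, where G_j − A_j = SᵀS, is admissible for small t and yields complementary
slackness (`stationary_of_gaussianExtremizer`).

(2) → (3) is a monotone flow. Each input is joined to a multiple of g_{A_j} by a time-reversed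
Ornstein–Uhlenbeck evolution with equilibrium g_{A_j}: a component g_G(· − z) becomes, at time s,
the gaussian with centre s z and inverse precision (1 − s²)A⁻¹ + s²G⁻¹. At s = 0 the functional has
the value BL(A), at s = 1 it has the value at the given input, and masses are constant. So it
suffices that the integral of the integrand F_s is nondecreasing in s.

Adding the integral of div(F_s V), which vanishes, for the field V = (2π)⁻¹ M̃⁻¹ ∑ c_j B_jᵀ q_j with
q_j = ∇ log(f_j / g_{A_j}) at B_j x, reduces this to a pointwise inequality (`flow_rate_nonneg`). It
has two sources. The matrix K_j = c_j (B_j M̃⁻¹ B_jᵀ − A_j⁻¹) is positive semidefinite and kills G_j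
− A_j by (2), so the second-order terms of each input contribute a nonnegative K_j-variance
(`rate_add_trace_hess_ge`). Non-degeneracy gives ∑ c_j ⟨q_j, A_j⁻¹ q_j⟩ ≤ ⟨p, M̃⁻¹ p⟩ for p = ∑ c_j
B_jᵀ q_j (`Nondegenerate.sum_le_quadratic_inv`), which controls the first-order terms.

The flow is run on finite mixtures of gaussians, where everything is explicit and dominated by a
gaussian. General inputs follow by approximating measures by simple images, truncating when c_j > 0,
and adding ε g_{A_j} when c_j < 0. Gaussians g_A with A ≤ G are themselves of type G, so I ≤ I_g and
the two infima coincide. (3) → (1) is immediate. -/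

noncomputable section

namespace InverseBrascampLieb

/-! ### Quadratic forms and positive definite matrices. -/

section LinearAlgebra

variable {k l : ℕ}

theorem exists_transpose_mul_self {M : Matrix (Fin k) (Fin k) ℝ} (hM : M.PosSemidef) :
    ∃ S : Matrix (Fin k) (Fin k) ℝ, M = Sᵀ * S := by
  obtain ⟨S, hS⟩ := CStarAlgebra.nonneg_iff_eq_star_mul_self.1
    (Matrix.nonneg_iff_posSemidef.2 hM)
  exact ⟨S, by simpa [Matrix.star_eq_conjTranspose] using hS⟩

theorem dotProduct_transpose_mul_mulVec (S : Matrix (Fin l) (Fin k) ℝ) (x y : Fin k → ℝ) :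
    x ⬝ᵥ (Sᵀ * S) *ᵥ y = (S *ᵥ x) ⬝ᵥ (S *ᵥ y) := by
  rw [← Matrix.mulVec_mulVec, Matrix.dotProduct_mulVec, Matrix.vecMul_transpose]

theorem transpose_eq_of_isHermitian {M : Matrix (Fin k) (Fin k) ℝ} (hM : M.IsHermitian) :
    Mᵀ = M := by
  rw [← Matrix.conjTranspose_eq_transpose_of_trivial, hM.eq]

theorem dotProduct_mulVec_comm {M : Matrix (Fin k) (Fin k) ℝ} (hM : M.IsHermitian)
    (x y : Fin k → ℝ) : x ⬝ᵥ M *ᵥ y = y ⬝ᵥ M *ᵥ x := by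
  have h := transpose_eq_of_isHermitian hM
  rw [Matrix.dotProduct_mulVec, ← Matrix.mulVec_transpose, h, dotProduct_comm]

theorem dotProduct_mulVec_transpose (B : Matrix (Fin l) (Fin k) ℝ) (x : Fin k → ℝ)
    (y : Fin l → ℝ) : x ⬝ᵥ Bᵀ *ᵥ y = (B *ᵥ x) ⬝ᵥ y := by
  rw [Matrix.dotProduct_mulVec, Matrix.vecMul_transpose]

theorem _root_.Matrix.PosSemidef.quadratic_nonneg {M : Matrix (Fin k) (Fin k) ℝ}
    (hM : M.PosSemidef) (x : Fin k → ℝ) : 0 ≤ x ⬝ᵥ M *ᵥ x := by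
  simpa using hM.dotProduct_mulVec_nonneg x

theorem _root_.Matrix.PosDef.quadratic_pos {M : Matrix (Fin k) (Fin k) ℝ}
    (hM : M.PosDef) {x : Fin k → ℝ} (hx : x ≠ 0) : 0 < x ⬝ᵥ M *ᵥ x := by
  simpa using hM.dotProduct_mulVec_pos hx

theorem posSemidef_of_forall {M : Matrix (Fin k) (Fin k) ℝ} (h1 : M.IsHermitian)
    (h2 : ∀ x, 0 ≤ x ⬝ᵥ M *ᵥ x) : M.PosSemidef :=
  Matrix.PosSemidef.of_dotProduct_mulVec_nonneg h1 (by simpa using h2)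

theorem posDef_of_forall {M : Matrix (Fin k) (Fin k) ℝ} (h1 : M.IsHermitian)
    (h2 : ∀ x, x ≠ 0 → 0 < x ⬝ᵥ M *ᵥ x) : M.PosDef :=
  Matrix.PosDef.of_dotProduct_mulVec_pos h1 (by simpa using h2)

theorem _root_.Matrix.PosDef.exists_coercive {M : Matrix (Fin k) (Fin k) ℝ} (hM : M.PosDef) :
    ∃ δ : ℝ, 0 < δ ∧ ∀ x : Fin k → ℝ, δ * ‖x‖ ^ 2 ≤ x ⬝ᵥ M *ᵥ x := by
  rcases Nat.eq_zero_or_pos k with rfl | hk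
  · exact ⟨1, one_pos, fun x => by simp [Subsingleton.elim x 0]⟩
  have : Nonempty (Fin k) := ⟨⟨0, hk⟩⟩
  have hcont : Continuous fun x : Fin k → ℝ => x ⬝ᵥ M *ᵥ x := by fun_prop
  obtain ⟨x₀, hx₀, hmin⟩ := (isCompact_sphere (0 : Fin k → ℝ) 1).exists_isMinOn
    (NormedSpace.sphere_nonempty.2 zero_le_one) hcont.continuousOn
  have hx₀' : x₀ ≠ 0 := by
    rintro rfl
    simp at hx₀
  refine ⟨x₀ ⬝ᵥ M *ᵥ x₀, hM.quadratic_pos hx₀', fun x => ?_⟩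
  rcases eq_or_ne x 0 with rfl | hx
  · simp
  have hnx : ‖x‖ ≠ 0 := norm_ne_zero_iff.2 hx
  have := hmin (show ‖x‖⁻¹ • x ∈ Metric.sphere (0 : Fin k → ℝ) 1 by
    simp [norm_smul, hnx])
  simp only [Set.mem_ofPred_eq, Matrix.mulVec_smul, dotProduct_smul, smul_dotProduct, smul_eq_mul] at this
  calc (x₀ ⬝ᵥ M *ᵥ x₀) * ‖x‖ ^ 2 ≤ (‖x‖⁻¹ * (‖x‖⁻¹ * (x ⬝ᵥ M *ᵥ x))) * ‖x‖ ^ 2 := by gcongr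
    _ = x ⬝ᵥ M *ᵥ x := by field_simp

theorem mulVec_inv_cancel {M : Matrix (Fin k) (Fin k) ℝ} (hM : M.PosDef) (x : Fin k → ℝ) :
    M *ᵥ (M⁻¹ *ᵥ x) = x := by
  rw [Matrix.mulVec_mulVec, Matrix.mul_nonsing_inv _ hM.det_pos.ne'.isUnit, Matrix.one_mulVec]

theorem inv_mulVec_cancel {M : Matrix (Fin k) (Fin k) ℝ} (hM : M.PosDef) (x : Fin k → ℝ) :
    M⁻¹ *ᵥ (M *ᵥ x) = x := by
  rw [Matrix.mulVec_mulVec, Matrix.nonsing_inv_mul _ hM.det_pos.ne'.isUnit, Matrix.one_mulVec]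

/-- With H = G − A, one has A⁻¹ − G⁻¹ = G⁻¹HG⁻¹ + G⁻¹H A⁻¹ HG⁻¹, a sum of congruences of positive
semidefinite matrices. -/
theorem posSemidef_inv_sub_inv {A G : Matrix (Fin k) (Fin k) ℝ} (hA : A.PosDef) (hG : G.PosDef)
    (h : (G - A).PosSemidef) : (A⁻¹ - G⁻¹).PosSemidef := by
  have hA' := hA.det_pos.ne'.isUnit
  have hG' := hG.det_pos.ne'.isUnit
  have e1 : A⁻¹ - G⁻¹ = G⁻¹ * (G - A) * A⁻¹ := by
    rw [Matrix.mul_sub, Matrix.sub_mul, Matrix.nonsing_inv_mul _ hG', Matrix.one_mul,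
      Matrix.mul_assoc, Matrix.mul_nonsing_inv _ hA', Matrix.mul_one]
  have e2 : A⁻¹ = G⁻¹ + A⁻¹ * (G - A) * G⁻¹ := by
    rw [Matrix.mul_sub, Matrix.sub_mul, Matrix.nonsing_inv_mul _ hA', Matrix.one_mul,
      Matrix.mul_assoc, Matrix.mul_nonsing_inv _ hG', Matrix.mul_one]
    abel
  have e3 : A⁻¹ - G⁻¹ = G⁻¹ * (G - A) * (G⁻¹)ᴴ +
      (G⁻¹ * (G - A)) * A⁻¹ * (G⁻¹ * (G - A))ᴴ := by
    rw [Matrix.conjTranspose_mul, h.isHermitian.eq, hG.inv.isHermitian.eq, e1]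
    nth_rw 1 [e2]
    noncomm_ring
  rw [e3]
  exact (h.mul_mul_conjTranspose_same _).add (hA.inv.posSemidef.mul_mul_conjTranspose_same _)

end LinearAlgebra

/-! ### Gaussian integrals and gaussian convolution. -/

section GaussianIntegral

variable {k : ℕ}

theorem integrable_exp_neg_dotProduct_self :
    Integrable fun x : Fin k → ℝ => Real.exp (-Real.pi * (x ⬝ᵥ x)) := by
  have h : (fun x : Fin k → ℝ => Real.exp (-Real.pi * (x ⬝ᵥ x))) =
      fun x => ∏ i, Real.exp (-Real.pi * x i ^ 2) := by
    funext x
    rw [← Real.exp_sum, dotProduct, Finset.mul_sum]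
    simp only [sq]
  rw [h]
  exact Integrable.fintype_prod (f := fun _ : Fin k => fun t : ℝ => Real.exp (-Real.pi * t ^ 2))
    fun _ => integrable_exp_neg_mul_sq Real.pi_pos

theorem integral_exp_neg_dotProduct_self :
    ∫ x : Fin k → ℝ, Real.exp (-Real.pi * (x ⬝ᵥ x)) = 1 := by
  have h : (fun x : Fin k → ℝ => Real.exp (-Real.pi * (x ⬝ᵥ x))) =
      fun x => ∏ i, Real.exp (-Real.pi * x i ^ 2) := by
    funext x
    rw [← Real.exp_sum, dotProduct, Finset.mul_sum]
    simp only [sq]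
  rw [h, integral_fintype_prod_volume_eq_prod (fun _ : Fin k => fun t : ℝ =>
    Real.exp (-Real.pi * t ^ 2)), integral_gaussian]
  simp [Real.pi_ne_zero]

theorem lintegral_exp_neg_quadratic {M : Matrix (Fin k) (Fin k) ℝ} (hM : M.PosDef) :
    ∫⁻ x : Fin k → ℝ, ENNReal.ofReal (Real.exp (-Real.pi * (x ⬝ᵥ M *ᵥ x))) =
      ENNReal.ofReal (Real.sqrt M.det)⁻¹ := by
  obtain ⟨S, hS⟩ := exists_transpose_mul_self hM.posSemidef
  have hdet : M.det = S.det ^ 2 := by rw [hS, Matrix.det_mul, Matrix.det_transpose, sq]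
  have hS0 : S.det ≠ 0 := by
    intro h
    have := hM.det_pos
    simp [hdet, h] at this
  have hmap := Real.map_matrix_volume_pi_eq_smul_volume_pi hS0
  have hmeas : Measurable fun x : Fin k → ℝ =>
      ENNReal.ofReal (Real.exp (-Real.pi * (x ⬝ᵥ x))) := by
    apply Continuous.measurable
    apply ENNReal.continuous_ofReal.comp
    fun_prop
  have hlin : Measurable (Matrix.toLin' S) :=
    (LinearMap.continuous_of_finiteDimensional (Matrix.toLin' S)).measurable
  calc ∫⁻ x : Fin k → ℝ, ENNReal.ofReal (Real.exp (-Real.pi * (x ⬝ᵥ M *ᵥ x)))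
      = ∫⁻ x, ENNReal.ofReal (Real.exp (-Real.pi * (Matrix.toLin' S x ⬝ᵥ Matrix.toLin' S x))) := by
        simp [hS, dotProduct_transpose_mul_mulVec]
    _ = ∫⁻ y, ENNReal.ofReal (Real.exp (-Real.pi * (y ⬝ᵥ y)))
          ∂(Measure.map (Matrix.toLin' S) volume) := (lintegral_map hmeas hlin).symm
    _ = ENNReal.ofReal (Real.sqrt M.det)⁻¹ := by
        rw [hmap, lintegral_smul_measure, ← ofReal_integral_eq_lintegral_ofReal
          integrable_exp_neg_dotProduct_self (Filter.Eventually.of_forall fun _ => (Real.exp_pos _).le),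
          integral_exp_neg_dotProduct_self, hdet, Real.sqrt_sq_eq_abs, abs_inv]
        simp

theorem integrable_exp_neg_quadratic {M : Matrix (Fin k) (Fin k) ℝ} (hM : M.PosDef) :
    Integrable fun x : Fin k → ℝ => Real.exp (-Real.pi * (x ⬝ᵥ M *ᵥ x)) := by
  refine ⟨(by fun_prop : Continuous fun x : Fin k → ℝ =>
    Real.exp (-Real.pi * (x ⬝ᵥ M *ᵥ x))).aestronglyMeasurable, ?_⟩
  rw [hasFiniteIntegral_iff_ofReal (Filter.Eventually.of_forall fun _ => (Real.exp_pos _).le),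
    lintegral_exp_neg_quadratic hM]
  exact ENNReal.ofReal_lt_top

theorem gaussian_pos {A : Matrix (Fin k) (Fin k) ℝ} (hA : A.PosDef) (x : Fin k → ℝ) :
    0 < gaussian A x :=
  mul_pos (Real.sqrt_pos.2 hA.det_pos) (Real.exp_pos _)

theorem continuous_gaussian (A : Matrix (Fin k) (Fin k) ℝ) : Continuous (gaussian A) := by
  unfold gaussian
  fun_prop

theorem lintegral_gaussian {A : Matrix (Fin k) (Fin k) ℝ} (hA : A.PosDef) :
    ∫⁻ x, ENNReal.ofReal (gaussian A x) = 1 := by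
  simp only [gaussian, ENNReal.ofReal_mul (Real.sqrt_nonneg _)]
  rw [lintegral_const_mul' _ _ ENNReal.ofReal_ne_top, lintegral_exp_neg_quadratic hA,
    ← ENNReal.ofReal_mul (Real.sqrt_nonneg _), mul_inv_cancel₀ (Real.sqrt_pos.2 hA.det_pos).ne',
    ENNReal.ofReal_one]

theorem lintegral_gaussian_sub {A : Matrix (Fin k) (Fin k) ℝ} (hA : A.PosDef) (y : Fin k → ℝ) :
    ∫⁻ x, ENNReal.ofReal (gaussian A (x - y)) = 1 := by
  rw [lintegral_sub_right_eq_self (fun x => ENNReal.ofReal (gaussian A x)), lintegral_gaussian hA]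

/-- Covariances add under convolution: g_A is g_G convolved with the image under Sᵀ of the standard
gaussian. Using an image measure allows A⁻¹ − G⁻¹ to be singular. -/
theorem gaussian_sub_conv_eq {A G : Matrix (Fin k) (Fin k) ℝ} (hA : A.PosDef) (hG : G.PosDef)
    (S : Matrix (Fin k) (Fin k) ℝ) (hS : A⁻¹ - G⁻¹ = Sᵀ * S) (x : Fin k → ℝ) :
    ∫⁻ z : Fin k → ℝ, ENNReal.ofReal (gaussian G (x - Sᵀ *ᵥ z)) *
      ENNReal.ofReal (Real.exp (-Real.pi * (z ⬝ᵥ z))) = ENNReal.ofReal (gaussian A x) := by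
  have hG' := hG.det_pos.ne'.isUnit
  have hA' := hA.det_pos.ne'.isUnit
  have hGt := transpose_eq_of_isHermitian hG.isHermitian
  set R : Matrix (Fin k) (Fin k) ℝ := 1 + S * G * Sᵀ with hR
  have hRpos : R.PosDef := by
    refine Matrix.PosDef.one.add_posSemidef ?_
    simpa using hG.posSemidef.mul_mul_conjTranspose_same S
  have hR' := hRpos.det_pos.ne'.isUnit
  have hSS : G⁻¹ + Sᵀ * S = A⁻¹ := by rw [← hS]; abel
  have hdet : R.det = G.det / A.det := by
    have h1 : R.det = (1 + G * Sᵀ * S).det := by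
      rw [hR, Matrix.mul_assoc, Matrix.det_one_add_mul_comm]
    have h2 : 1 + G * Sᵀ * S = G * A⁻¹ := by
      rw [← hSS, Matrix.mul_add, Matrix.mul_nonsing_inv _ hG', Matrix.mul_assoc]
    rw [h1, h2, Matrix.det_mul, Matrix.det_nonsing_inv, Ring.inverse_eq_inv', div_eq_mul_inv]
  -- Woodbury's identity: the quadratic form left in x after completing the square in z, whose own
  -- quadratic part is R.
  have hwood : G - G * Sᵀ * R⁻¹ * S * G = A := by
    have h : (G - G * Sᵀ * R⁻¹ * S * G) * A⁻¹ = 1 := by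
      have e1 : G * A⁻¹ = 1 + G * Sᵀ * S := by
        rw [← hSS, Matrix.mul_add, Matrix.mul_nonsing_inv _ hG', Matrix.mul_assoc]
      have e2 : S * (1 + G * Sᵀ * S) = R * S := by rw [hR]; noncomm_ring
      calc (G - G * Sᵀ * R⁻¹ * S * G) * A⁻¹ = G * A⁻¹ - G * Sᵀ * R⁻¹ * (S * (G * A⁻¹)) := by
            noncomm_ring
        _ = 1 + G * Sᵀ * S - G * Sᵀ * (R⁻¹ * R) * S := by rw [e1, e2]; noncomm_ring
        _ = 1 := by rw [Matrix.nonsing_inv_mul _ hR']; noncomm_ring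
    calc _ = (G - G * Sᵀ * R⁻¹ * S * G) * A⁻¹ * A := by
          rw [Matrix.mul_assoc _ A⁻¹ A, Matrix.nonsing_inv_mul _ hA', Matrix.mul_one]
      _ = A := by rw [h, Matrix.one_mul]
  set z₀ : Fin k → ℝ := R⁻¹ *ᵥ (S *ᵥ (G *ᵥ x)) with hz₀
  have hquad : ∀ z, (x - Sᵀ *ᵥ z) ⬝ᵥ G *ᵥ (x - Sᵀ *ᵥ z) + z ⬝ᵥ z =
      x ⬝ᵥ A *ᵥ x + (z - z₀) ⬝ᵥ R *ᵥ (z - z₀) := by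
    intro z
    have a1 : (Sᵀ *ᵥ z) ⬝ᵥ G *ᵥ x = z ⬝ᵥ R *ᵥ z₀ := by
      rw [hz₀, mulVec_inv_cancel hRpos, dotProduct_comm, dotProduct_mulVec_transpose,
        dotProduct_comm]
    have a2 : x ⬝ᵥ G *ᵥ (Sᵀ *ᵥ z) = z ⬝ᵥ R *ᵥ z₀ := by
      rw [dotProduct_mulVec_comm hG.isHermitian, a1]
    have a3 : z ⬝ᵥ R *ᵥ z = z ⬝ᵥ z + (Sᵀ *ᵥ z) ⬝ᵥ G *ᵥ (Sᵀ *ᵥ z) := by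
      rw [hR, Matrix.add_mulVec, Matrix.one_mulVec, dotProduct_add, ← Matrix.mulVec_mulVec,
        ← Matrix.mulVec_mulVec, ← dotProduct_mulVec_transpose, Matrix.transpose_transpose]
    have a4 : x ⬝ᵥ A *ᵥ x = x ⬝ᵥ G *ᵥ x - z₀ ⬝ᵥ R *ᵥ z₀ := by
      have : z₀ ⬝ᵥ R *ᵥ z₀ = x ⬝ᵥ (G * Sᵀ * R⁻¹ * S * G) *ᵥ x := by
        rw [hz₀, mulVec_inv_cancel hRpos]
        have : (G * Sᵀ * R⁻¹ * S * G) *ᵥ x = G *ᵥ (Sᵀ *ᵥ z₀) := by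
          simp [hz₀, Matrix.mulVec_mulVec, Matrix.mul_assoc]
        rw [this, dotProduct_mulVec_comm hG.isHermitian, dotProduct_comm (Sᵀ *ᵥ z₀),
          dotProduct_mulVec_transpose, dotProduct_comm]
      rw [this, ← dotProduct_sub, ← Matrix.sub_mulVec, hwood]
    have a5 := dotProduct_mulVec_comm hRpos.isHermitian z₀ z
    simp only [Matrix.mulVec_sub, dotProduct_sub, sub_dotProduct]
    linarith
  have hint : ∀ z, ENNReal.ofReal (gaussian G (x - Sᵀ *ᵥ z)) *
      ENNReal.ofReal (Real.exp (-Real.pi * (z ⬝ᵥ z))) =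
      ENNReal.ofReal (Real.sqrt G.det * Real.exp (-Real.pi * (x ⬝ᵥ A *ᵥ x))) *
        ENNReal.ofReal (Real.exp (-Real.pi * ((z - z₀) ⬝ᵥ R *ᵥ (z - z₀)))) := by
    intro z
    rw [← ENNReal.ofReal_mul (gaussian_pos hG _).le, ← ENNReal.ofReal_mul (by positivity), gaussian,
      mul_assoc, mul_assoc, ← Real.exp_add, ← Real.exp_add, ← mul_add, ← mul_add, hquad]
  simp only [hint]
  rw [lintegral_const_mul' _ _ ENNReal.ofReal_ne_top, lintegral_sub_right_eq_self
    (fun z => ENNReal.ofReal (Real.exp (-Real.pi * (z ⬝ᵥ R *ᵥ z)))), lintegral_exp_neg_quadratic hRpos,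
    ← ENNReal.ofReal_mul (by positivity), gaussian, hdet, Real.sqrt_div hG.det_pos.le]
  congr 1
  have := (Real.sqrt_pos.2 hG.det_pos).ne'
  have := (Real.sqrt_pos.2 hA.det_pos).ne'
  field_simp

/-- Makes gaussian competitors admissible for the general infimum, whence I ≤ I_g. -/
theorem gaussian_mem_typeClass {A G : Matrix (Fin k) (Fin k) ℝ} (hA : A.PosDef) (hG : G.PosDef)
    (h : A ≤ G) : (fun y => ENNReal.ofReal (gaussian A y)) ∈ typeClass G := by
  obtain ⟨S, hS⟩ := exists_transpose_mul_self (posSemidef_inv_sub_inv hA hG (Matrix.le_iff.1 h))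
  set w : (Fin k → ℝ) → ℝ≥0∞ := fun z => ENNReal.ofReal (Real.exp (-Real.pi * (z ⬝ᵥ z))) with hw
  have hwm : Measurable w :=
    (ENNReal.continuous_ofReal.comp (by fun_prop : Continuous fun z : Fin k → ℝ =>
      Real.exp (-Real.pi * (z ⬝ᵥ z)))).measurable
  have hTm : Measurable fun z : Fin k → ℝ => Sᵀ *ᵥ z :=
    (by fun_prop : Continuous fun z : Fin k → ℝ => Sᵀ *ᵥ z).measurable
  have hone : ∫⁻ z, w z = 1 := by
    rw [hw, ← ofReal_integral_eq_lintegral_ofReal integrable_exp_neg_dotProduct_self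
      (Filter.Eventually.of_forall fun _ => (Real.exp_pos _).le), integral_exp_neg_dotProduct_self,
      ENNReal.ofReal_one]
  have hmass : (Measure.map (fun z => Sᵀ *ᵥ z) (volume.withDensity w)) Set.univ = 1 := by
    rw [Measure.map_apply hTm MeasurableSet.univ, Set.preimage_univ,
      withDensity_apply _ MeasurableSet.univ, Measure.restrict_univ, hone]
  refine ⟨Measure.map (fun z => Sᵀ *ᵥ z) (volume.withDensity w), ⟨by simp [hmass]⟩, ?_, ?_⟩
  · intro h0
    simp [h0] at hmass
  · funext x
    have hgm : Measurable fun y => ENNReal.ofReal (gaussian G (x - y)) :=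
      (ENNReal.continuous_ofReal.comp ((continuous_gaussian G).comp (by fun_prop))).measurable
    have hgm' : Measurable fun z => ENNReal.ofReal (gaussian G (x - Sᵀ *ᵥ z)) := hgm.comp hTm
    rw [lintegral_map hgm hTm, lintegral_withDensity_eq_lintegral_mul _ hwm hgm',
      ← gaussian_sub_conv_eq hA hG S hS x]
    refine lintegral_congr fun z => ?_
    simp [hw, mul_comm]

end GaussianIntegral

/-! ### The functional at gaussian inputs. -/

namespace Datum

variable {m n : ℕ} (D : Datum m n)

theorem quadratic_Mtilde (A : D.MatrixTuple) (x y : Fin n → ℝ) :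
    x ⬝ᵥ D.Mtilde A *ᵥ y = x ⬝ᵥ D.Q *ᵥ y +
      ∑ j, D.c j * ((D.B j *ᵥ x) ⬝ᵥ A j *ᵥ (D.B j *ᵥ y)) := by
  simp only [Mtilde, Matrix.add_mulVec, dotProduct_add, Matrix.sum_mulVec, dotProduct_sum,
    Matrix.smul_mulVec, dotProduct_smul, smul_eq_mul]
  rw [add_comm]
  congr 1
  refine Finset.sum_congr rfl fun j _ => ?_
  rw [Matrix.mul_assoc, ← Matrix.mulVec_mulVec, dotProduct_mulVec_transpose,
    ← Matrix.mulVec_mulVec]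

theorem ofReal_prod_rpow (φ : (j : Fin m) → ℝ) (hφ : ∀ j, 0 < φ j) :
    ∏ j, ENNReal.ofReal (φ j) ^ D.c j = ENNReal.ofReal (∏ j, φ j ^ D.c j) := by
  rw [ENNReal.ofReal_prod_of_nonneg fun j _ => Real.rpow_nonneg (hφ j).le _]
  exact Finset.prod_congr rfl fun j _ => ENNReal.ofReal_rpow_of_pos (hφ j)

theorem prod_gaussian_rpow {A : D.MatrixTuple} (hA : ∀ j, (A j).PosDef) (x : Fin n → ℝ) :
    Real.exp (-Real.pi * (x ⬝ᵥ D.Q *ᵥ x)) * ∏ j, gaussian (A j) (D.B j *ᵥ x) ^ D.c j =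
      Real.exp ((∑ j, D.c j * Real.log (A j).det) / 2) *
        Real.exp (-Real.pi * (x ⬝ᵥ D.Mtilde A *ᵥ x)) := by
  have h : ∀ j, gaussian (A j) (D.B j *ᵥ x) ^ D.c j =
      Real.exp (D.c j * Real.log (A j).det / 2 -
        Real.pi * (D.c j * ((D.B j *ᵥ x) ⬝ᵥ A j *ᵥ (D.B j *ᵥ x)))) := by
    intro j
    rw [Real.rpow_def_of_pos (gaussian_pos (hA j) _), gaussian,
      Real.log_mul (Real.sqrt_pos.2 (hA j).det_pos).ne' (Real.exp_pos _).ne', Real.log_exp,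
      Real.log_sqrt (hA j).det_pos.le]
    congr 1
    ring
  simp only [h]
  rw [← Real.exp_sum, ← Real.exp_add, ← Real.exp_add, quadratic_Mtilde, Finset.sum_sub_distrib,
    ← Finset.mul_sum, Finset.sum_div]
  congr 1
  ring

theorem BLGaussian_eq {A : D.MatrixTuple} (hA : A ∈ D.Lambda) :
    D.BLGaussian A = ENNReal.ofReal
      (Real.exp ((∑ j, D.c j * Real.log (A j).det - Real.log (D.Mtilde A).det) / 2)) := by
  obtain ⟨hA, hM⟩ := hA
  have hden : ∏ j, (∫⁻ y, ENNReal.ofReal (gaussian (A j) y)) ^ D.c j = 1 := by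
    simp [lintegral_gaussian (hA _)]
  have hnum : ∀ x : Fin n → ℝ, ENNReal.ofReal (Real.exp (-Real.pi * (x ⬝ᵥ D.Q *ᵥ x))) *
      ∏ j, ENNReal.ofReal (gaussian (A j) (D.B j *ᵥ x)) ^ D.c j =
      ENNReal.ofReal (Real.exp ((∑ j, D.c j * Real.log (A j).det) / 2)) *
        ENNReal.ofReal (Real.exp (-Real.pi * (x ⬝ᵥ D.Mtilde A *ᵥ x))) := by
    intro x
    rw [D.ofReal_prod_rpow (fun j => gaussian (A j) (D.B j *ᵥ x)) fun j => gaussian_pos (hA j) _,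
      ← ENNReal.ofReal_mul (Real.exp_pos _).le, ← ENNReal.ofReal_mul (Real.exp_pos _).le,
      D.prod_gaussian_rpow hA]
  rw [BLGaussian, BL, hden, div_one]
  simp only [hnum]
  rw [lintegral_const_mul' _ _ ENNReal.ofReal_ne_top, lintegral_exp_neg_quadratic hM,
    ← ENNReal.ofReal_mul (Real.exp_pos _).le, sub_div, Real.exp_sub]
  congr 2
  rw [← Real.log_sqrt hM.det_pos.le, Real.exp_log (Real.sqrt_pos.2 hM.det_pos)]

end Datum

/-! ### Rank-one perturbations. -/

section FirstOrder

variable {k l : ℕ}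

/-- The matrix determinant lemma. Rank-one directions suffice for the stationarity conditions and
avoid differentiating determinants in general. -/
theorem det_add_smul_vecMulVec {A : Matrix (Fin k) (Fin k) ℝ} (hA : A.PosDef) (t : ℝ)
    (v : Fin k → ℝ) :
    (A + t • Matrix.vecMulVec v v).det = A.det * (1 + t * (v ⬝ᵥ A⁻¹ *ᵥ v)) := by
  have h := hA.det_pos.ne'.isUnit
  have h1 : A + t • Matrix.vecMulVec v v = A * (1 + (t • Matrix.replicateCol Unit (A⁻¹ *ᵥ v)) *
      Matrix.replicateRow Unit v) := by
    rw [Matrix.mul_add, Matrix.mul_one, Matrix.smul_mul, Matrix.mul_smul]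
    congr 2
    rw [← Matrix.vecMulVec_eq, Matrix.mul_vecMulVec, mulVec_inv_cancel hA]
  rw [h1, Matrix.det_mul, Matrix.det_one_add_mul_comm]
  congr 1
  rw [Matrix.det_unique]
  simp [Matrix.mul_apply, dotProduct, Finset.mul_sum]

theorem abs_dotProduct_le (x v : Fin k → ℝ) : |x ⬝ᵥ v| ≤ (∑ i, |v i|) * ‖x‖ := by
  rw [dotProduct, Finset.sum_mul]
  refine (Finset.abs_sum_le_sum_abs _ _).trans (Finset.sum_le_sum fun i _ => ?_)
  rw [abs_mul, mul_comm]
  gcongr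
  exact norm_le_pi_norm x i

theorem posDef_add_smul_vecMulVec {A : Matrix (Fin k) (Fin k) ℝ} (hA : A.PosDef) (v : Fin k → ℝ) :
    ∀ᶠ t in nhds (0 : ℝ), (A + t • Matrix.vecMulVec v v).PosDef := by
  obtain ⟨δ, hδ, hco⟩ := hA.exists_coercive
  set K := ∑ i, |v i|
  have hK : ∀ x : Fin k → ℝ, |x ⬝ᵥ v| ≤ K * ‖x‖ := fun x => abs_dotProduct_le x v
  have hlim : Filter.Tendsto (fun t : ℝ => |t| * K ^ 2) (nhds 0) (nhds 0) := by
    have : Continuous fun t : ℝ => |t| * K ^ 2 := by fun_prop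
    simpa using this.tendsto 0
  filter_upwards [hlim.eventually (gt_mem_nhds hδ)] with t ht
  refine posDef_of_forall (hA.isHermitian.add ?_) fun x hx => ?_
  · rw [Matrix.IsHermitian, Matrix.conjTranspose_eq_transpose_of_trivial, Matrix.transpose_smul,
      Matrix.transpose_vecMulVec]
  · have h1 : x ⬝ᵥ (A + t • Matrix.vecMulVec v v) *ᵥ x = x ⬝ᵥ A *ᵥ x + t * (x ⬝ᵥ v) ^ 2 := by
      rw [Matrix.add_mulVec, dotProduct_add, Matrix.smul_mulVec, dotProduct_smul,
        Matrix.vecMulVec_mulVec]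
      simp [dotProduct_comm v x, sq]
    have h2 : (x ⬝ᵥ v) ^ 2 ≤ K ^ 2 * ‖x‖ ^ 2 := by
      rw [← sq_abs, ← mul_pow]
      exact pow_le_pow_left₀ (abs_nonneg _) (hK x) 2
    have h3 : -(|t| * (K ^ 2 * ‖x‖ ^ 2)) ≤ t * (x ⬝ᵥ v) ^ 2 := by
      calc -(|t| * (K ^ 2 * ‖x‖ ^ 2)) ≤ -(|t| * (x ⬝ᵥ v) ^ 2) := by gcongr
        _ ≤ t * (x ⬝ᵥ v) ^ 2 := by nlinarith [neg_abs_le t, sq_nonneg (x ⬝ᵥ v)]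
    have h4 : 0 < ‖x‖ ^ 2 := by positivity
    rw [h1]
    nlinarith [hco x]

theorem nonneg_of_hasDerivAt_of_eventually {φ : ℝ → ℝ} {d : ℝ} (hφ : HasDerivAt φ d 0)
    (h0 : φ 0 = 0) (h : ∀ᶠ t in nhdsWithin (0 : ℝ) (Set.Ioi 0), 0 ≤ φ t) : 0 ≤ d := by
  have hs := (hasDerivAt_iff_tendsto_slope.1 hφ).mono_left
    (nhdsWithin_mono (0 : ℝ) fun t (ht : t ∈ Set.Ioi (0 : ℝ)) => (ne_of_gt ht : t ≠ 0))
  refine ge_of_tendsto hs ?_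
  filter_upwards [h, self_mem_nhdsWithin] with t ht ht0
  rw [slope_def_field, h0, sub_zero, sub_zero]
  exact div_nonneg ht (le_of_lt ht0)

end FirstOrder

namespace GenDatum

variable {m n : ℕ} (D : GenDatum m n)

theorem Mtilde_update (A : D.MatrixTuple) (j : Fin m) (t : ℝ) (v : Fin (D.dim j) → ℝ) :
    D.Mtilde (Function.update A j (A j + t • Matrix.vecMulVec v v)) =
      D.Mtilde A + (t * D.c j) • Matrix.vecMulVec ((D.B j)ᵀ *ᵥ v) ((D.B j)ᵀ *ᵥ v) := by
  have h : ∀ i, D.c i • ((D.B i)ᵀ * Function.update A j (A j + t • Matrix.vecMulVec v v) i * D.B i)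
      = D.c i • ((D.B i)ᵀ * A i * D.B i) + if i = j then
        (t * D.c j) • Matrix.vecMulVec ((D.B j)ᵀ *ᵥ v) ((D.B j)ᵀ *ᵥ v) else 0 := by
    intro i
    rcases eq_or_ne i j with rfl | hij
    · simp only [Function.update_self, if_true]
      rw [Matrix.mul_add, Matrix.add_mul, smul_add, Matrix.mul_smul, Matrix.smul_mul, smul_smul,
        Matrix.mul_vecMulVec, Matrix.vecMulVec_mul, Matrix.mulVec_transpose, mul_comm]
    · simp [hij]
  simp only [Datum.Mtilde, h, Finset.sum_add_distrib, Finset.sum_ite_eq', Finset.mem_univ, if_true]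
  abel

/-- Changing A_j by σ t v vᵀ changes M̃ by the rank-one term σ t c_j (B_jᵀv)(B_jᵀv)ᵀ, so the gain in
log BL is explicit; minimality makes it nonnegative for small t > 0. The sign σ covers both
decreasing and increasing directions. -/
theorem directional_derivative_nonneg {A : D.MatrixTuple} (hA : A ∈ D.Lambda)
    (hAG : ∀ j, A j ≤ D.G j) (hI : D.Ig = D.BLGaussian A) (j : Fin m) (σ : ℝ)
    (v : Fin (D.dim j) → ℝ)
    (h : ∀ᶠ t in nhdsWithin (0 : ℝ) (Set.Ioi 0),
      A j + (σ * t) • Matrix.vecMulVec v v ≤ D.G j) :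
    0 ≤ σ * (D.c j * (v ⬝ᵥ ((A j)⁻¹ - D.B j * (D.Mtilde A)⁻¹ * (D.B j)ᵀ) *ᵥ v)) := by
  set a := v ⬝ᵥ (A j)⁻¹ *ᵥ v with ha
  set b := ((D.B j)ᵀ *ᵥ v) ⬝ᵥ (D.Mtilde A)⁻¹ *ᵥ ((D.B j)ᵀ *ᵥ v) with hb
  have hab : v ⬝ᵥ ((A j)⁻¹ - D.B j * (D.Mtilde A)⁻¹ * (D.B j)ᵀ) *ᵥ v = a - b := by
    rw [Matrix.sub_mulVec, dotProduct_sub, Matrix.mul_assoc, ← Matrix.mulVec_mulVec,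
      ← Matrix.mulVec_mulVec, hb, dotProduct_comm ((D.B j)ᵀ *ᵥ v), dotProduct_mulVec_transpose,
      dotProduct_comm (D.B j *ᵥ _)]
  rw [hab]
  have hlim : Filter.Tendsto (fun t : ℝ => σ * t) (nhds 0) (nhds 0) := by
    have : Continuous fun t : ℝ => σ * t := by fun_prop
    simpa using this.tendsto 0
  have hlim' : Filter.Tendsto (fun t : ℝ => σ * t * D.c j) (nhds 0) (nhds 0) := by
    have : Continuous fun t : ℝ => σ * t * D.c j := by fun_prop
    simpa using this.tendsto 0
  -- This function of t is twice the logarithm of BL(A') / BL(A).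
  refine nonneg_of_hasDerivAt_of_eventually
    (φ := fun t => D.c j * Real.log (1 + σ * t * a) - Real.log (1 + σ * t * D.c j * b)) ?_ (by simp) ?_
  · have h1 : HasDerivAt (fun t : ℝ => 1 + σ * t * a) (σ * 1 * a) 0 :=
      ((((hasDerivAt_id (0 : ℝ)).const_mul σ).mul_const a).const_add 1)
    have h2 : HasDerivAt (fun t : ℝ => 1 + σ * t * D.c j * b) (σ * 1 * D.c j * b) 0 :=
      ((((hasDerivAt_id (0 : ℝ)).const_mul σ).mul_const (D.c j)).mul_const b).const_add 1
    have h3 := ((h1.log (by simp)).const_mul (D.c j)).sub (h2.log (by simp))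
    refine h3.congr_deriv ?_
    simp only [mul_zero, zero_mul, add_zero, div_one]
    ring
  · filter_upwards [h, nhdsWithin_le_nhds (hlim.eventually (posDef_add_smul_vecMulVec (hA.1 j) v)),
      nhdsWithin_le_nhds (hlim'.eventually (posDef_add_smul_vecMulVec hA.2 ((D.B j)ᵀ *ᵥ v)))]
      with t ht hpos hposM
    set A' := Function.update A j (A j + (σ * t) • Matrix.vecMulVec v v) with hA'
    have hM' := D.Mtilde_update A j (σ * t) v
    have hA'pos : ∀ i, (A' i).PosDef := by
      intro i
      rcases eq_or_ne i j with rfl | hij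
      · simpa [hA'] using hpos
      · simpa [hA', hij] using hA.1 i
    have hA'G : ∀ i, A' i ≤ D.G i := by
      intro i
      rcases eq_or_ne i j with rfl | hij
      · simpa [hA'] using ht
      · simpa [hA', hij] using hAG i
    have hA'L : A' ∈ D.Lambda := ⟨hA'pos, by rw [hA', hM']; exact hposM⟩
    have hle : D.BLGaussian A ≤ D.BLGaussian A' := by
      rw [← hI]
      exact iInf₂_le A' fun i => ⟨hA'pos i, hA'G i⟩
    rw [D.BLGaussian_eq hA, D.BLGaussian_eq hA'L, ENNReal.ofReal_le_ofReal_iff (Real.exp_pos _).le,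
      Real.exp_le_exp] at hle
    have hdetj := det_add_smul_vecMulVec (hA.1 j) (σ * t) v
    have hdetM := det_add_smul_vecMulVec hA.2 (σ * t * D.c j) ((D.B j)ᵀ *ᵥ v)
    rw [← ha] at hdetj
    rw [← hb] at hdetM
    have pj : 0 < 1 + σ * t * a := by
      have := hpos.det_pos
      rw [hdetj] at this
      exact pos_of_mul_pos_right this (hA.1 j).det_pos.le
    have pM : 0 < 1 + σ * t * D.c j * b := by
      have := hposM.det_pos
      rw [hdetM] at this
      exact pos_of_mul_pos_right this hA.2.det_pos.le
    have hsum : ∑ i, D.c i * Real.log (A' i).det =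
        ∑ i, D.c i * Real.log (A i).det + D.c j * Real.log (1 + σ * t * a) := by
      have : ∀ i, D.c i * Real.log (A' i).det = D.c i * Real.log (A i).det +
          if i = j then D.c j * Real.log (1 + σ * t * a) else 0 := by
        intro i
        rcases eq_or_ne i j with rfl | hij
        · simp only [hA', Function.update_self, if_true]
          rw [hdetj, Real.log_mul (hA.1 i).det_pos.ne' pj.ne', mul_add]
        · simp [hA', hij]
      simp only [this, Finset.sum_add_distrib, Finset.sum_ite_eq', Finset.mem_univ, if_true]
    rw [hsum, hA', hM', hdetM, Real.log_mul hA.2.det_pos.ne' pM.ne'] at hle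
    linarith

theorem _root_.Matrix.PosSemidef.sub_smul_vecMulVec_row {k : ℕ} (S : Matrix (Fin k) (Fin k) ℝ)
    (i : Fin k) {t : ℝ} (ht : t ≤ 1) :
    (Sᵀ * S - t • Matrix.vecMulVec (S i) (S i)).PosSemidef := by
  refine posSemidef_of_forall ?_ fun x => ?_
  · rw [Matrix.IsHermitian, Matrix.conjTranspose_eq_transpose_of_trivial, Matrix.transpose_sub,
      Matrix.transpose_mul, Matrix.transpose_transpose, Matrix.transpose_smul,
      Matrix.transpose_vecMulVec]
  · have h1 : x ⬝ᵥ (t • Matrix.vecMulVec (S i) (S i)) *ᵥ x = t * (S *ᵥ x) i ^ 2 := by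
      rw [Matrix.smul_mulVec, dotProduct_smul, Matrix.vecMulVec_mulVec]
      simp [Matrix.mulVec, dotProduct_comm x, sq]
    rw [Matrix.sub_mulVec, dotProduct_sub, dotProduct_transpose_mul_mulVec, h1]
    have h2 : (S *ᵥ x) i ^ 2 ≤ (S *ᵥ x) ⬝ᵥ (S *ᵥ x) := by
      rw [dotProduct, sq]
      exact Finset.single_le_sum (f := fun i => (S *ᵥ x) i * (S *ᵥ x) i)
        (fun i _ => mul_self_nonneg _) (Finset.mem_univ i)
    nlinarith [sq_nonneg ((S *ᵥ x) i)]

/-- These are the Karush–Kuhn–Tucker conditions for the constraint A_j ≤ G_j. -/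
theorem stationary_of_gaussianExtremizer {A : D.MatrixTuple} (hA : A ∈ D.Lambda)
    (hAG : ∀ j, A j ≤ D.G j) (hI : D.Ig = D.BLGaussian A) (j : Fin m) :
    D.c j • ((A j)⁻¹ - D.B j * (D.Mtilde A)⁻¹ * (D.B j)ᵀ) ≤ 0 ∧
      ((A j)⁻¹ - D.B j * (D.Mtilde A)⁻¹ * (D.B j)ᵀ) * (D.G j - A j) = 0 := by
  set N := (A j)⁻¹ - D.B j * (D.Mtilde A)⁻¹ * (D.B j)ᵀ with hN
  have hherm : N.IsHermitian := by
    refine (hA.1 j).inv.isHermitian.sub ?_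
    simpa using Matrix.isHermitian_mul_mul_conjTranspose (D.B j) hA.2.inv.isHermitian
  have hneg : (-(D.c j • N)).PosSemidef := by
    refine posSemidef_of_forall ?_ fun v => ?_
    · rw [Matrix.IsHermitian, Matrix.conjTranspose_neg, Matrix.conjTranspose_smul, hherm.eq,
        star_trivial]
    -- Lowering A_j never leaves the constraint set, so every v is an admissible direction.
    · have := D.directional_derivative_nonneg hA hAG hI j (-1) v ?_
      · rw [← hN] at this
        simpa [Matrix.neg_mulVec, Matrix.smul_mulVec] using this
      · filter_upwards [self_mem_nhdsWithin] with t ht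
        have ht' : 0 ≤ t := le_of_lt ht
        rw [Matrix.le_iff]
        have e : D.G j - (A j + (-1 * t) • Matrix.vecMulVec v v) =
            (D.G j - A j) + t • Matrix.vecMulVec v v := by
          rw [neg_one_mul, neg_smul]; abel
        rw [e]
        refine (Matrix.le_iff.1 (hAG j)).add (Matrix.PosSemidef.smul ?_ ht')
        simpa using Matrix.posSemidef_vecMulVec_self_star v
  refine ⟨by rw [Matrix.le_iff, zero_sub]; exact hneg, ?_⟩
  obtain ⟨S, hS⟩ := exists_transpose_mul_self (Matrix.le_iff.1 (hAG j))
  have hrow : ∀ i, N *ᵥ S i = 0 := by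
    intro i
    -- A_j + t S_i S_iᵀ ≤ G_j for t ≤ 1, so the form of N vanishes at S_i; as −c_j N is
    -- semidefinite, S_i lies in the kernel of N.
    have h1 := D.directional_derivative_nonneg hA hAG hI j 1 (S i) ?_
    · rw [← hN, one_mul] at h1
      have h2 : (S i) ⬝ᵥ (-(D.c j • N)) *ᵥ S i = 0 := by
        refine le_antisymm ?_ (hneg.quadratic_nonneg _)
        simpa [Matrix.neg_mulVec, Matrix.smul_mulVec] using h1
      have h3 := (hneg.dotProduct_mulVec_zero_iff (S i)).1 (by simpa using h2)
      rw [Matrix.neg_mulVec, neg_eq_zero, Matrix.smul_mulVec] at h3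
      exact (smul_eq_zero.1 h3).resolve_left (D.c_ne_zero j)
    · filter_upwards [Ioc_mem_nhdsGT (zero_lt_one' ℝ)] with t ht
      rw [Matrix.le_iff, one_mul, ← sub_sub, hS]
      exact Matrix.PosSemidef.sub_smul_vecMulVec_row S i ht.2
  have hNS : N * Sᵀ = 0 := by
    ext a i
    simpa [Matrix.mul_apply, Matrix.mulVec, dotProduct] using congrFun (hrow i) a
  rw [hS, ← Matrix.mul_assoc, hNS, Matrix.zero_mul]

end GenDatum

/-! ### The quadratic inequality behind non-degeneracy. -/

namespace Datum

variable {m n : ℕ} (D : Datum m n)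

/-- The subspace is cut out by the s⁺ coordinates along eigenvectors with positive eigenvalue, in an
orthonormal eigenbasis of Q. -/
theorem exists_submodule_Q_nonpos : ∃ K : Submodule ℝ (Fin n → ℝ),
    n ≤ D.sPlus + Module.finrank ℝ K ∧ ∀ x ∈ K, x ⬝ᵥ D.Q *ᵥ x ≤ 0 := by
  set U : Matrix (Fin n) (Fin n) ℝ := ↑D.isHermitian_Q.eigenvectorUnitary with hU
  set ev := D.isHermitian_Q.eigenvalues with hev
  let L : (Fin n → ℝ) →ₗ[ℝ] ({i : Fin n // 0 < ev i} → ℝ) :=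
    (LinearMap.funLeft ℝ ℝ Subtype.val).comp Uᵀ.mulVecLin
  have hL : ∀ x i, L x i = (Uᵀ *ᵥ x) i.1 := fun x i => rfl
  refine ⟨LinearMap.ker L, ?_, fun x hx => ?_⟩
  · have h1 := LinearMap.finrank_range_add_finrank_ker L
    have h2 := Submodule.finrank_le (LinearMap.range L)
    rw [Module.finrank_fin_fun] at h1
    rw [Module.finrank_fintype_fun_eq_card, Fintype.card_subtype] at h2
    change _ ≤ D.sPlus at h2
    omega
  · have hQ : D.Q = U * Matrix.diagonal ev * Uᵀ := by
      have := D.isHermitian_Q.spectral_theorem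
      rw [Unitary.conjStarAlgAut_apply] at this
      simpa [Matrix.star_eq_conjTranspose, Function.comp_def] using this
    have h1 : x ⬝ᵥ D.Q *ᵥ x = ∑ i, ev i * (Uᵀ *ᵥ x) i ^ 2 := by
      rw [hQ, Matrix.mul_assoc, ← Matrix.mulVec_mulVec, ← Matrix.mulVec_mulVec]
      have := dotProduct_mulVec_transpose Uᵀ x (Matrix.diagonal ev *ᵥ (Uᵀ *ᵥ x))
      rw [Matrix.transpose_transpose] at this
      rw [this, dotProduct]
      refine Finset.sum_congr rfl fun i _ => ?_
      rw [Matrix.mulVec_diagonal]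
      ring
    rw [h1]
    refine Finset.sum_nonpos fun i _ => ?_
    by_cases hi : 0 < ev i
    · have : (Uᵀ *ᵥ x) i = 0 := by
        rw [← hL x ⟨i, hi⟩, LinearMap.mem_ker.1 hx]
        rfl
      simp [this]
    · exact mul_nonpos_of_nonpos_of_nonneg (not_lt.1 hi) (sq_nonneg _)

/-- Since Q > 0 on ker B₊, the map B₊ is injective on a subspace of dimension at least n − s⁺ where
Q ≤ 0. The dimension condition then forces it to be bijective from there onto its target. -/
theorem Nondegenerate.exists_preimage (hD : D.Nondegenerate)
    (w : (j : Fin m) → Fin (D.dim j) → ℝ) :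
    ∃ x : Fin n → ℝ, (∀ j, 0 < D.c j → D.B j *ᵥ x = w j) ∧ x ⬝ᵥ D.Q *ᵥ x ≤ 0 := by
  obtain ⟨K, hK, hQ⟩ := D.exists_submodule_Q_nonpos
  have hinj : Function.Injective (D.Bplus.domRestrict K) := by
    rw [← LinearMap.ker_eq_bot, LinearMap.ker_eq_bot']
    intro x hx
    by_contra hne
    have hne' : (x : Fin n → ℝ) ≠ 0 := by simpa using hne
    exact (hD.1 x hx hne').not_ge (hQ x x.2)
  have hle := LinearMap.finrank_le_finrank_of_injective hinj
  have htarget : Module.finrank ℝ ((j : {j : Fin m // 0 < D.c j}) → Fin (D.dim j) → ℝ) =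
      ∑ j with 0 < D.c j, D.dim j := by
    rw [Module.finrank_pi_fintype]
    simp only [Module.finrank_fin_fun]
    exact (Finset.sum_subtype _ (by simp) fun j => D.dim j).symm
  have heq : Module.finrank ℝ K =
      Module.finrank ℝ ((j : {j : Fin m // 0 < D.c j}) → Fin (D.dim j) → ℝ) := by
    have := hD.2
    omega
  obtain ⟨x, hx⟩ := (LinearMap.injective_iff_surjective_of_finrank_eq_finrank heq).1 hinj
    fun j => w j
  exact ⟨x, fun j hj => congrFun hx ⟨j, hj⟩, hQ x x.2⟩

/-- By duality ⟨p, M̃⁻¹p⟩ ≥ 2⟨x, p⟩ − ⟨x, M̃x⟩ for every x. The x chosen has Q-form at most 0 and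
B_j x = A_j⁻¹q_j whenever c_j > 0; completing squares in each j then gives equality for c_j > 0 and
the favourable sign for c_j < 0. -/
theorem Nondegenerate.sum_le_quadratic_inv (hD : D.Nondegenerate) {A : D.MatrixTuple}
    (hA : A ∈ D.Lambda) (q : (j : Fin m) → Fin (D.dim j) → ℝ) :
    ∑ j, D.c j * (q j ⬝ᵥ (A j)⁻¹ *ᵥ q j) ≤
      (∑ j, D.c j • (D.B j)ᵀ *ᵥ q j) ⬝ᵥ (D.Mtilde A)⁻¹ *ᵥ (∑ j, D.c j • (D.B j)ᵀ *ᵥ q j) := by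
  obtain ⟨x, hx, hxQ⟩ := hD.exists_preimage D fun j => (A j)⁻¹ *ᵥ q j
  set M := D.Mtilde A with hM
  set p := ∑ j, D.c j • (D.B j)ᵀ *ᵥ q j with hp
  have h1 : 0 ≤ (M⁻¹ *ᵥ p - x) ⬝ᵥ M *ᵥ (M⁻¹ *ᵥ p - x) := hA.2.posSemidef.quadratic_nonneg _
  have h2 : (M⁻¹ *ᵥ p - x) ⬝ᵥ M *ᵥ (M⁻¹ *ᵥ p - x) =
      p ⬝ᵥ M⁻¹ *ᵥ p - 2 * (x ⬝ᵥ p) + x ⬝ᵥ M *ᵥ x := by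
    have e1 : (M⁻¹ *ᵥ p) ⬝ᵥ M *ᵥ x = x ⬝ᵥ p := by
      rw [dotProduct_mulVec_comm hA.2.isHermitian, mulVec_inv_cancel hA.2]
    rw [Matrix.mulVec_sub, mulVec_inv_cancel hA.2, sub_dotProduct, dotProduct_sub, dotProduct_sub,
      e1, dotProduct_comm _ p]
    ring
  have h3 : x ⬝ᵥ p = ∑ j, D.c j * ((D.B j *ᵥ x) ⬝ᵥ q j) := by
    simp only [hp, dotProduct_sum, dotProduct_smul, dotProduct_mulVec_transpose, smul_eq_mul]
  have h4 : x ⬝ᵥ M *ᵥ x = x ⬝ᵥ D.Q *ᵥ x +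
      ∑ j, D.c j * ((D.B j *ᵥ x) ⬝ᵥ A j *ᵥ (D.B j *ᵥ x)) := D.quadratic_Mtilde A x x
  have h5 : ∀ j, D.c j * (q j ⬝ᵥ (A j)⁻¹ *ᵥ q j) ≤ 2 * (D.c j * ((D.B j *ᵥ x) ⬝ᵥ q j)) -
      D.c j * ((D.B j *ᵥ x) ⬝ᵥ A j *ᵥ (D.B j *ᵥ x)) := by
    intro j
    set y := D.B j *ᵥ x with hy
    have e : (y - (A j)⁻¹ *ᵥ q j) ⬝ᵥ A j *ᵥ (y - (A j)⁻¹ *ᵥ q j) =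
        y ⬝ᵥ A j *ᵥ y - 2 * (y ⬝ᵥ q j) + q j ⬝ᵥ (A j)⁻¹ *ᵥ q j := by
      have e1 : ((A j)⁻¹ *ᵥ q j) ⬝ᵥ A j *ᵥ y = y ⬝ᵥ q j := by
        rw [dotProduct_mulVec_comm (hA.1 j).isHermitian, mulVec_inv_cancel (hA.1 j)]
      rw [Matrix.mulVec_sub, mulVec_inv_cancel (hA.1 j), sub_dotProduct, dotProduct_sub,
        dotProduct_sub, e1, dotProduct_comm ((A j)⁻¹ *ᵥ q j) (q j)]
      ring
    rcases (D.c_ne_zero j).lt_or_gt with hc | hc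
    · have := (hA.1 j).posSemidef.quadratic_nonneg (y - (A j)⁻¹ *ᵥ q j)
      rw [e] at this
      nlinarith
    · have h0 : y - (A j)⁻¹ *ᵥ q j = 0 := sub_eq_zero.2 (hx j hc)
      rw [h0] at e
      simp only [Matrix.mulVec_zero, dotProduct_zero] at e
      have : D.c j * (y ⬝ᵥ A j *ᵥ y - 2 * (y ⬝ᵥ q j) + q j ⬝ᵥ (A j)⁻¹ *ᵥ q j) = 0 := by
        rw [← e, mul_zero]
      linarith
  have h6 := Finset.sum_le_sum fun j (_ : j ∈ Finset.univ) => h5 j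
  rw [Finset.sum_sub_distrib, ← Finset.mul_sum, ← h3] at h6
  linarith

end Datum

/-! ### Derivatives of vector-valued paths and of gaussians along lines. -/

section Calculus

variable {k l : ℕ}

theorem _root_.HasDerivAt.dotProduct {u v : ℝ → Fin k → ℝ} {u' v' : Fin k → ℝ} {t : ℝ}
    (hu : HasDerivAt u u' t) (hv : HasDerivAt v v' t) :
    HasDerivAt (fun t => u t ⬝ᵥ v t) (u' ⬝ᵥ v t + u t ⬝ᵥ v') t := by
  have h := HasDerivAt.fun_sum (u := Finset.univ) fun i _ =>
    (hasDerivAt_pi.1 hu i).mul (hasDerivAt_pi.1 hv i)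
  refine h.congr_deriv ?_
  rw [Finset.sum_add_distrib]
  rfl

theorem _root_.HasDerivAt.mulVec {P : ℝ → Matrix (Fin l) (Fin k) ℝ}
    {P' : Matrix (Fin l) (Fin k) ℝ} {v : ℝ → Fin k → ℝ} {v' : Fin k → ℝ} {t : ℝ}
    (hP : ∀ a b, HasDerivAt (fun t => P t a b) (P' a b) t) (hv : HasDerivAt v v' t) :
    HasDerivAt (fun t => P t *ᵥ v t) (P' *ᵥ v t + P t *ᵥ v') t :=
  hasDerivAt_pi.2 fun a => (hasDerivAt_pi.2 (hP a)).dotProduct hv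

theorem _root_.HasDerivAt.const_mulVec (P : Matrix (Fin l) (Fin k) ℝ) {v : ℝ → Fin k → ℝ}
    {v' : Fin k → ℝ} {t : ℝ} (hv : HasDerivAt v v' t) :
    HasDerivAt (fun t => P *ᵥ v t) (P *ᵥ v') t := by
  simpa using HasDerivAt.mulVec (P := fun _ => P) (P' := 0) (fun a b => hasDerivAt_const t _) hv

theorem hasDerivAt_line (y η c : Fin k → ℝ) (t : ℝ) :
    HasDerivAt (fun t : ℝ => y + t • η - c) η t := by
  simpa using (((hasDerivAt_id t).smul_const η).const_add y).sub_const c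

theorem hasDerivAt_gaussian_line {P : Matrix (Fin k) (Fin k) ℝ} (hP : P.IsHermitian)
    (y η c : Fin k → ℝ) :
    HasDerivAt (fun t : ℝ => gaussian P (y + t • η - c))
      (gaussian P (y - c) * (((-2 * Real.pi) • P *ᵥ (y - c)) ⬝ᵥ η)) 0 := by
  have h1 := hasDerivAt_line y η c 0
  have h2 := ((h1.dotProduct (h1.const_mulVec P)).const_mul (-Real.pi)).exp.const_mul
    (Real.sqrt P.det)
  refine h2.congr_deriv ?_
  simp only [zero_smul, add_zero]
  rw [dotProduct_mulVec_comm hP η, gaussian, smul_dotProduct, dotProduct_comm (P *ᵥ (y - c)),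
    dotProduct_mulVec_comm hP η, smul_eq_mul]
  ring

end Calculus

/-! ### The flow of a single translated gaussian. -/

section Flow

variable {k : ℕ}

/-- The covariance at time `s` of the path from `A⁻¹` (at `s = 0`) to `G⁻¹` (at `s = 1`). -/
def flowCov (A G : Matrix (Fin k) (Fin k) ℝ) (s : ℝ) : Matrix (Fin k) (Fin k) ℝ :=
  A⁻¹ - s ^ 2 • (A⁻¹ - G⁻¹)

/-- The inverse of the covariance at time `s` of the path from `A⁻¹` to `G⁻¹`. -/
def flowPrec (A G : Matrix (Fin k) (Fin k) ℝ) (s : ℝ) : Matrix (Fin k) (Fin k) ℝ :=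
  (flowCov A G s)⁻¹

variable {A G : Matrix (Fin k) (Fin k) ℝ} {s : ℝ}

theorem sq_mem_Icc (hs : s ∈ Set.Icc (0 : ℝ) 1) : 0 ≤ s ^ 2 ∧ s ^ 2 ≤ 1 :=
  ⟨sq_nonneg s, pow_le_one₀ hs.1 hs.2⟩

theorem flowCov_posDef (hA : A.PosDef) (hG : G.PosDef) (hs : s ∈ Set.Icc (0 : ℝ) 1) :
    (flowCov A G s).PosDef := by
  have h : flowCov A G s = (1 - s ^ 2) • A⁻¹ + s ^ 2 • G⁻¹ := by
    rw [flowCov, sub_smul, smul_sub, one_smul]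
    abel
  rw [h]
  obtain ⟨h0, h1⟩ := sq_mem_Icc hs
  rcases h1.lt_or_eq with h1 | h1
  · exact (hA.inv.smul (sub_pos.2 h1)).add_posSemidef (hG.inv.posSemidef.smul h0)
  · rw [h1]
    simpa using hG.inv

theorem flowPrec_posDef (hA : A.PosDef) (hG : G.PosDef) (hs : s ∈ Set.Icc (0 : ℝ) 1) :
    (flowPrec A G s).PosDef :=
  (flowCov_posDef hA hG hs).inv

theorem flowPrec_zero (hA : A.PosDef) : flowPrec A G 0 = A := by
  simp [flowPrec, flowCov, Matrix.nonsing_inv_nonsing_inv _ hA.det_pos.ne'.isUnit]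

theorem flowPrec_one (hG : G.PosDef) : flowPrec A G 1 = G := by
  simp [flowPrec, flowCov, Matrix.nonsing_inv_nonsing_inv _ hG.det_pos.ne'.isUnit]

theorem flowPrec_self (hA : A.PosDef) : flowPrec A A s = A := by
  simp [flowPrec, flowCov, Matrix.nonsing_inv_nonsing_inv _ hA.det_pos.ne'.isUnit]

/-- Inverse precisions only decrease from A⁻¹ along the path; this provides gaussian decay uniform
in s. -/
theorem le_flowPrec (hA : A.PosDef) (hG : G.PosDef) (h : A ≤ G) (hs : s ∈ Set.Icc (0 : ℝ) 1) :
    A ≤ flowPrec A G s := by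
  have h1 : (A⁻¹ - flowCov A G s).PosSemidef := by
    rw [flowCov, sub_sub_cancel]
    exact (posSemidef_inv_sub_inv hA hG (Matrix.le_iff.1 h)).smul (sq_nonneg s)
  have h2 := posSemidef_inv_sub_inv (flowCov_posDef hA hG hs) hA.inv h1
  rwa [Matrix.nonsing_inv_nonsing_inv _ hA.det_pos.ne'.isUnit] at h2

/-- The difference P_s − A equals s²(G − A)G⁻¹P_s, so complementary slackness at the endpoint G
persists along the whole path. -/
theorem mul_flowPrec_eq (hA : A.PosDef) (hG : G.PosDef) (hs : s ∈ Set.Icc (0 : ℝ) 1)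
    {N : Matrix (Fin k) (Fin k) ℝ} (hN : N * (G - A) = 0) : N * flowPrec A G s = N * A := by
  have hA' := hA.det_pos.ne'.isUnit
  have hG' := hG.det_pos.ne'.isUnit
  have hC := (flowCov_posDef hA hG hs).det_pos.ne'.isUnit
  have h1 : A * (A⁻¹ - G⁻¹) = (G - A) * G⁻¹ := by
    rw [Matrix.mul_sub, Matrix.sub_mul, Matrix.mul_nonsing_inv _ hA', Matrix.mul_nonsing_inv _ hG']
  have h2 : flowPrec A G s - A = s ^ 2 • (A * (A⁻¹ - G⁻¹) * flowPrec A G s) := by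
    have : A * flowCov A G s * flowPrec A G s = A := by
      rw [Matrix.mul_assoc, flowPrec, Matrix.mul_nonsing_inv _ hC, Matrix.mul_one]
    calc flowPrec A G s - A = A * A⁻¹ * flowPrec A G s - A * flowCov A G s * flowPrec A G s := by
          rw [this, Matrix.mul_nonsing_inv _ hA', Matrix.one_mul]
      _ = A * (A⁻¹ - flowCov A G s) * flowPrec A G s := by noncomm_ring
      _ = _ := by
          rw [flowCov, sub_sub_cancel, Matrix.mul_smul, Matrix.smul_mul]
  rw [← sub_eq_zero, ← Matrix.mul_sub, h2, h1, Matrix.mul_smul, Matrix.mul_assoc,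
    ← Matrix.mul_assoc, hN, Matrix.zero_mul, smul_zero]

theorem continuous_flowCov (A G : Matrix (Fin k) (Fin k) ℝ) : Continuous (flowCov A G) := by
  unfold flowCov
  fun_prop

theorem continuousAt_flowPrec (hC : (flowCov A G s).det ≠ 0) : ContinuousAt (flowPrec A G) s := by
  have h : flowPrec A G = fun s => (flowCov A G s).det⁻¹ • (flowCov A G s).adjugate := by
    funext s
    rw [flowPrec, Matrix.inv_def, Ring.inverse_eq_inv']
  rw [h]
  have hc := continuous_flowCov A G
  exact (hc.matrix_det.continuousAt.inv₀ hC).smul hc.matrix_adjugate.continuousAt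

theorem flowCov_det_eventually_ne_zero (hC : (flowCov A G s).det ≠ 0) :
    ∀ᶠ t in nhds s, (flowCov A G t).det ≠ 0 :=
  (continuous_flowCov A G).matrix_det.continuousAt.eventually_ne hC

/-- The resolvent identity turns the difference quotient into (t + s) P_t (A⁻¹ − G⁻¹) P_s, so
continuity of the inverse is enough. -/
theorem hasDerivAt_flowPrec (hC : (flowCov A G s).det ≠ 0) (a b : Fin k) :
    HasDerivAt (fun s => flowPrec A G s a b)
      (((2 * s) • (flowPrec A G s * (A⁻¹ - G⁻¹) * flowPrec A G s)) a b) s := by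
  rw [hasDerivAt_iff_tendsto_slope]
  have hcont : ContinuousAt (fun t => ((t + s) • (flowPrec A G t * (A⁻¹ - G⁻¹) *
      flowPrec A G s)) a b) s := by
    have h1 := continuousAt_flowPrec hC
    have h2 : ContinuousAt (fun t => (t + s) • (flowPrec A G t * (A⁻¹ - G⁻¹) *
      flowPrec A G s)) s :=
      (continuousAt_id.add continuousAt_const).smul
        ((h1.mul continuousAt_const).mul continuousAt_const)
    exact ((continuous_apply_apply a b).continuousAt).comp h2
  have hlim := (hcont.tendsto).mono_left (nhdsWithin_le_nhds (s := {s}ᶜ))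
  rw [← two_mul] at hlim
  refine hlim.congr' ?_
  filter_upwards [nhdsWithin_le_nhds (flowCov_det_eventually_ne_zero hC), self_mem_nhdsWithin]
    with t ht hts
  have hts' : t - s ≠ 0 := sub_ne_zero.2 hts
  have h3 : flowPrec A G t - flowPrec A G s = (t - s) • ((t + s) • (flowPrec A G t * (A⁻¹ - G⁻¹) *
      flowPrec A G s)) := by
    have e1 : flowPrec A G t * flowCov A G t = 1 := Matrix.nonsing_inv_mul _ ht.isUnit
    have e2 : flowCov A G s * flowPrec A G s = 1 := Matrix.mul_nonsing_inv _ hC.isUnit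
    have e3 : flowCov A G s - flowCov A G t = ((t - s) * (t + s)) • (A⁻¹ - G⁻¹) := by
      have : (t - s) * (t + s) = t ^ 2 - s ^ 2 := by ring
      rw [this, flowCov, flowCov, sub_smul]
      abel
    calc flowPrec A G t - flowPrec A G s
        = flowPrec A G t * (flowCov A G s * flowPrec A G s) -
            flowPrec A G t * flowCov A G t * flowPrec A G s := by
          rw [e1, e2, Matrix.mul_one, Matrix.one_mul]
      _ = flowPrec A G t * (flowCov A G s - flowCov A G t) * flowPrec A G s := by noncomm_ring
      _ = _ := by
          rw [e3, smul_smul, Matrix.mul_smul, Matrix.smul_mul]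
  have h4 := congrFun (congrFun h3 a) b
  rw [Matrix.sub_apply, Matrix.smul_apply, smul_eq_mul] at h4
  rw [slope_def_field, h4]
  field_simp

/-- With C_s the inverse precision, det C_t = det C_s · det(1 + (s² − t²)X), and the last
determinant has the polynomial expansion 1 + r tr X + O(r²). -/
theorem hasDerivAt_det_flowCov (hC : (flowCov A G s).det ≠ 0) :
    HasDerivAt (fun s => (flowCov A G s).det)
      (-(2 * s) * (flowCov A G s).det * (flowPrec A G s * (A⁻¹ - G⁻¹)).trace) s := by
  set C := A⁻¹ - G⁻¹ with hCdef
  set X := flowPrec A G s * C with hX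
  obtain ⟨p, hp⟩ : ∃ p : Polynomial ℝ, ∀ r : ℝ,
      (1 + r • X).det = 1 + X.trace * r + p.eval r * r ^ 2 :=
    ⟨_, fun r => Matrix.det_one_add_smul r X⟩
  have h1 : (fun t => (flowCov A G t).det) = fun t => (flowCov A G s).det *
      (1 + X.trace * (s ^ 2 - t ^ 2) + p.eval (s ^ 2 - t ^ 2) * (s ^ 2 - t ^ 2) ^ 2) := by
    funext t
    rw [← hp, ← Matrix.det_mul, Matrix.mul_add, Matrix.mul_one, Matrix.mul_smul, hX,
      ← Matrix.mul_assoc, flowPrec, Matrix.mul_nonsing_inv _ hC.isUnit, Matrix.one_mul, sub_smul,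
      flowCov, flowCov]
    congr 1
    abel
  rw [h1]
  have h2 : HasDerivAt (fun t : ℝ => s ^ 2 - t ^ 2) (-(2 * s)) s := by
    simpa using (hasDerivAt_pow 2 s).const_sub (s ^ 2)
  have h3 : HasDerivAt (fun t : ℝ => p.eval (s ^ 2 - t ^ 2))
      (p.derivative.eval (s ^ 2 - s ^ 2) * (-(2 * s))) s :=
    HasDerivAt.comp s (h := fun t => s ^ 2 - t ^ 2) (h₂ := fun x => p.eval x)
      (p.hasDerivAt (s ^ 2 - s ^ 2)) h2
  have h4 := (((h2.const_mul X.trace).const_add 1).add (h3.mul (h2.pow 2))).const_mul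
    (flowCov A G s).det
  refine h4.congr_deriv ?_
  simp
  ring

/-- The logarithmic time derivative of the flow of a translated gaussian. -/
def flowRate (A G : Matrix (Fin k) (Fin k) ℝ) (z : Fin k → ℝ) (s : ℝ) (y : Fin k → ℝ) : ℝ :=
  s * (flowPrec A G s * (A⁻¹ - G⁻¹)).trace +
    2 * Real.pi * (z ⬝ᵥ flowPrec A G s *ᵥ (y - s • z)) -
    2 * Real.pi * s * ((flowPrec A G s *ᵥ (y - s • z)) ⬝ᵥ
      (A⁻¹ - G⁻¹) *ᵥ (flowPrec A G s *ᵥ (y - s • z)))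

/-- The logarithmic gradient of the flow of a translated gaussian. -/
def flowGrad (A G : Matrix (Fin k) (Fin k) ℝ) (z : Fin k → ℝ) (s : ℝ) (y : Fin k → ℝ) :
    Fin k → ℝ :=
  (-2 * Real.pi) • flowPrec A G s *ᵥ (y - s • z)

theorem hasDerivAt_gaussian_flow (hA : A.PosDef) (hG : G.PosDef) (z y : Fin k → ℝ)
    (hs : s ∈ Set.Icc (0 : ℝ) 1) :
    HasDerivAt (fun s => gaussian (flowPrec A G s) (y - s • z))
      (gaussian (flowPrec A G s) (y - s • z) * flowRate A G z s y) s := by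
  have hCpos := (flowCov_posDef hA hG hs).det_pos
  have hC := hCpos.ne'
  have hP := flowPrec_posDef hA hG hs
  have hr : HasDerivAt (fun s : ℝ => y - s • z) (-z) s := by
    simpa using ((hasDerivAt_id s).smul_const z).const_sub y
  have hq := hr.dotProduct (HasDerivAt.mulVec (hasDerivAt_flowPrec hC) hr)
  have hd : HasDerivAt (fun s => Real.sqrt (flowPrec A G s).det)
      (Real.sqrt (flowPrec A G s).det * (s * (flowPrec A G s * (A⁻¹ - G⁻¹)).trace)) s := by
    have e : (fun s => Real.sqrt (flowPrec A G s).det) =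
        fun s => Real.sqrt ((flowCov A G s).det)⁻¹ := by
      funext s
      rw [flowPrec, Matrix.det_nonsing_inv, Ring.inverse_eq_inv']
    have e' : (flowPrec A G s).det = ((flowCov A G s).det)⁻¹ := by
      rw [flowPrec, Matrix.det_nonsing_inv, Ring.inverse_eq_inv']
    rw [e, e']
    refine (((hasDerivAt_det_flowCov hC).inv hC).sqrt (inv_ne_zero hC)).congr_deriv ?_
    have hs2 : Real.sqrt ((flowCov A G s).det)⁻¹ * Real.sqrt ((flowCov A G s).det)⁻¹ =
        ((flowCov A G s).det)⁻¹ := Real.mul_self_sqrt (inv_nonneg.2 hCpos.le)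
    have hs0 := (Real.sqrt_pos.2 (inv_pos.2 hCpos)).ne'
    change _ / (2 * Real.sqrt ((flowCov A G s).det)⁻¹) = _
    rw [div_eq_iff (mul_ne_zero two_ne_zero hs0)]
    calc _ = (2 * s) * ((flowCov A G s).det)⁻¹ * (flowPrec A G s * (A⁻¹ - G⁻¹)).trace := by
          field_simp
      _ = _ := by
          linear_combination (-(2 * s) * (flowPrec A G s * (A⁻¹ - G⁻¹)).trace) * hs2
  refine (hd.mul (hq.const_mul (-Real.pi)).exp).congr_deriv ?_
  set P := flowPrec A G s with hPdef
  set r := y - s • z with hrdef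
  set C := A⁻¹ - G⁻¹ with hCdef
  have a1 : r ⬝ᵥ ((2 * s) • (P * C * P)) *ᵥ r = 2 * s * ((P *ᵥ r) ⬝ᵥ C *ᵥ (P *ᵥ r)) := by
    rw [Matrix.smul_mulVec, dotProduct_smul, smul_eq_mul, Matrix.mul_assoc, ← Matrix.mulVec_mulVec,
      dotProduct_mulVec_comm hP.isHermitian, dotProduct_comm, ← Matrix.mulVec_mulVec]
  have a2 : r ⬝ᵥ P *ᵥ (-z) = -(z ⬝ᵥ P *ᵥ r) := by
    rw [dotProduct_mulVec_comm hP.isHermitian, neg_dotProduct]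
  rw [dotProduct_add, a1, a2, neg_dotProduct, flowRate, gaussian]
  ring

/-- The time-reversed Ornstein–Uhlenbeck equation s ∂_s f = −div(y f + (2π)⁻¹A⁻¹∇f), divided by f,
for a gaussian whose logarithmic Hessian is −2πP_s. In this form G and z enter only through P_s and
the gradient. -/
theorem mul_flowRate (hA : A.PosDef) (hG : G.PosDef) (z y : Fin k → ℝ)
    (hs : s ∈ Set.Icc (0 : ℝ) 1) :
    s * flowRate A G z s y = (flowPrec A G s * A⁻¹).trace - k - y ⬝ᵥ flowGrad A G z s y -
      (2 * Real.pi)⁻¹ * (flowGrad A G z s y ⬝ᵥ A⁻¹ *ᵥ flowGrad A G z s y) := by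
  have hC := (flowCov_posDef hA hG hs).det_pos.ne'
  have e1 : s ^ 2 • (A⁻¹ - G⁻¹) = A⁻¹ - flowCov A G s := by rw [flowCov, sub_sub_cancel]
  have hPC : flowPrec A G s * flowCov A G s = 1 := Matrix.nonsing_inv_mul _ hC.isUnit
  have hCP : flowCov A G s * flowPrec A G s = 1 := Matrix.mul_nonsing_inv _ hC.isUnit
  rw [flowRate, flowGrad]
  set P := flowPrec A G s with hPdef
  set u := P *ᵥ (y - s • z) with hu
  have b1 : s ^ 2 * (P * (A⁻¹ - G⁻¹)).trace = (P * A⁻¹).trace - k := by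
    rw [← smul_eq_mul, ← Matrix.trace_smul, ← Matrix.mul_smul, e1, Matrix.mul_sub, hPC,
      Matrix.trace_sub, Matrix.trace_one, Fintype.card_fin]
  have b2 : s ^ 2 * (u ⬝ᵥ (A⁻¹ - G⁻¹) *ᵥ u) = u ⬝ᵥ A⁻¹ *ᵥ u - u ⬝ᵥ (y - s • z) := by
    rw [← smul_eq_mul, ← dotProduct_smul, ← Matrix.smul_mulVec, e1, Matrix.sub_mulVec,
      dotProduct_sub, hu, Matrix.mulVec_mulVec (M := flowCov A G s), hCP, Matrix.one_mulVec]
  have b3 : u ⬝ᵥ (y - s • z) = y ⬝ᵥ u - s * (z ⬝ᵥ u) := by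
    rw [dotProduct_comm, sub_dotProduct, smul_dotProduct, smul_eq_mul]
  have hpi := Real.pi_ne_zero
  simp only [Matrix.mulVec_smul, dotProduct_smul, smul_dotProduct, smul_eq_mul]
  have e2 : (2 * Real.pi)⁻¹ * (-2 * Real.pi * (-2 * Real.pi * (u ⬝ᵥ A⁻¹ *ᵥ u))) =
      2 * Real.pi * (u ⬝ᵥ A⁻¹ *ᵥ u) := by
    field_simp
  rw [e2]
  linear_combination b1 - 2 * Real.pi * b2 + 2 * Real.pi * b3

end Flow

/-! ### Finite mixtures and their differential inequality. -/

/-- A finite mixture of translated gaussians `g_{G i}(· - z i)` with `A ≤ G i`. -/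
structure Mixture {k : ℕ} (A : Matrix (Fin k) (Fin k) ℝ) where
  /-- the index set of the components -/
  ι : Type
  [fintype : Fintype ι]
  /-- the weights -/
  w : ι → ℝ
  /-- the precision matrices -/
  G : ι → Matrix (Fin k) (Fin k) ℝ
  /-- the centres -/
  z : ι → Fin k → ℝ
  w_nonneg : ∀ i, 0 ≤ w i
  exists_w_pos : ∃ i, 0 < w i
  posDef : ∀ i, (G i).PosDef
  le : ∀ i, A ≤ G i

attribute [instance] Mixture.fintype

namespace Mixture

variable {k : ℕ} {A : Matrix (Fin k) (Fin k) ℝ} (X : Mixture A) {s : ℝ}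

/-- The `i`-th component at time `s`. -/
def term (i : X.ι) (s : ℝ) (y : Fin k → ℝ) : ℝ :=
  gaussian (flowPrec A (X.G i) s) (y - s • X.z i)

/-- The value of the flow of the mixture at time `s`. -/
def val (s : ℝ) (y : Fin k → ℝ) : ℝ := ∑ i, X.w i * X.term i s y

/-- The relative contribution of the `i`-th component. -/
def θ (i : X.ι) (s : ℝ) (y : Fin k → ℝ) : ℝ := X.w i * X.term i s y / X.val s y

/-- The logarithmic gradient of the `i`-th component. -/
def p (i : X.ι) (s : ℝ) (y : Fin k → ℝ) : Fin k → ℝ := flowGrad A (X.G i) (X.z i) s y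

/-- The logarithmic gradient of the mixture. -/
def grad (s : ℝ) (y : Fin k → ℝ) : Fin k → ℝ := ∑ i, X.θ i s y • X.p i s y

/-- The logarithmic time derivative of the mixture. -/
def rate (s : ℝ) (y : Fin k → ℝ) : ℝ :=
  ∑ i, X.θ i s y * flowRate A (X.G i) (X.z i) s y

/-- The logarithmic Hessian of the mixture. -/
def hess (s : ℝ) (y : Fin k → ℝ) : Matrix (Fin k) (Fin k) ℝ :=
  ∑ i, X.θ i s y • (Matrix.vecMulVec (X.p i s y) (X.p i s y - X.grad s y) -
    (2 * Real.pi) • flowPrec A (X.G i) s)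

/-- The total mass of the mixture. -/
def mass : ℝ := ∑ i, X.w i

theorem mass_pos : 0 < X.mass := by
  obtain ⟨i, hi⟩ := X.exists_w_pos
  exact Finset.sum_pos' (fun i _ => X.w_nonneg i) ⟨i, Finset.mem_univ i, hi⟩

section

variable (hA : A.PosDef)
include hA

theorem term_pos (i : X.ι) (hs : s ∈ Set.Icc (0 : ℝ) 1) (y : Fin k → ℝ) : 0 < X.term i s y :=
  gaussian_pos (flowPrec_posDef hA (X.posDef i) hs) _

theorem val_pos (hs : s ∈ Set.Icc (0 : ℝ) 1) (y : Fin k → ℝ) : 0 < X.val s y := by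
  obtain ⟨i, hi⟩ := X.exists_w_pos
  exact Finset.sum_pos' (fun i _ => mul_nonneg (X.w_nonneg i) (X.term_pos hA i hs y).le)
    ⟨i, Finset.mem_univ i, mul_pos hi (X.term_pos hA i hs y)⟩

theorem θ_nonneg (i : X.ι) (hs : s ∈ Set.Icc (0 : ℝ) 1) (y : Fin k → ℝ) : 0 ≤ X.θ i s y :=
  div_nonneg (mul_nonneg (X.w_nonneg i) (X.term_pos hA i hs y).le) (X.val_pos hA hs y).le

theorem sum_θ (hs : s ∈ Set.Icc (0 : ℝ) 1) (y : Fin k → ℝ) : ∑ i, X.θ i s y = 1 := by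
  simp only [θ, ← Finset.sum_div]
  exact div_self (X.val_pos hA hs y).ne'

theorem θ_le_one (i : X.ι) (hs : s ∈ Set.Icc (0 : ℝ) 1) (y : Fin k → ℝ) : X.θ i s y ≤ 1 := by
  rw [← X.sum_θ hA hs y]
  exact Finset.single_le_sum (fun i _ => X.θ_nonneg hA i hs y) (Finset.mem_univ i)

theorem val_mul_θ (i : X.ι) (hs : s ∈ Set.Icc (0 : ℝ) 1) (y : Fin k → ℝ) :
    X.val s y * X.θ i s y = X.w i * X.term i s y :=
  mul_div_cancel₀ _ (X.val_pos hA hs y).ne'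

/-- At time 0 all centres collapse to the origin and all precisions to A, so only the mass is
remembered. -/
theorem val_zero (y : Fin k → ℝ) : X.val 0 y = X.mass * gaussian A y := by
  simp [val, term, flowPrec_zero hA, mass, Finset.sum_mul]

theorem hasDerivAt_val (hs : s ∈ Set.Icc (0 : ℝ) 1) (y : Fin k → ℝ) :
    HasDerivAt (fun s => X.val s y) (X.val s y * X.rate s y) s := by
  have h := HasDerivAt.fun_sum (u := Finset.univ) fun i _ =>
    (hasDerivAt_gaussian_flow hA (X.posDef i) (X.z i) y hs).const_mul (X.w i)
  refine h.congr_deriv ?_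
  rw [rate, Finset.mul_sum]
  refine Finset.sum_congr rfl fun i _ => ?_
  rw [← mul_assoc, ← mul_assoc, X.val_mul_θ hA i hs]
  rfl

theorem hasDerivAt_term_line (i : X.ι) (hs : s ∈ Set.Icc (0 : ℝ) 1) (y η : Fin k → ℝ) :
    HasDerivAt (fun t : ℝ => X.term i s (y + t • η)) (X.term i s y * (X.p i s y ⬝ᵥ η)) 0 :=
  hasDerivAt_gaussian_line (flowPrec_posDef hA (X.posDef i) hs).isHermitian y η (s • X.z i)

theorem hasDerivAt_val_line (hs : s ∈ Set.Icc (0 : ℝ) 1) (y η : Fin k → ℝ) :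
    HasDerivAt (fun t : ℝ => X.val s (y + t • η)) (X.val s y * (X.grad s y ⬝ᵥ η)) 0 := by
  have h := HasDerivAt.fun_sum (u := Finset.univ) fun i _ =>
    (X.hasDerivAt_term_line hA i hs y η).const_mul (X.w i)
  refine h.congr_deriv ?_
  rw [grad, sum_dotProduct, Finset.mul_sum]
  refine Finset.sum_congr rfl fun i _ => ?_
  rw [smul_dotProduct, smul_eq_mul, ← mul_assoc, ← mul_assoc, X.val_mul_θ hA i hs]

theorem hasDerivAt_θ_line (i : X.ι) (hs : s ∈ Set.Icc (0 : ℝ) 1) (y η : Fin k → ℝ) :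
    HasDerivAt (fun t : ℝ => X.θ i s (y + t • η))
      (X.θ i s y * ((X.p i s y - X.grad s y) ⬝ᵥ η)) 0 := by
  have hv : X.val s (y + (0 : ℝ) • η) ≠ 0 := (X.val_pos hA hs _).ne'
  have h := ((X.hasDerivAt_term_line hA i hs y η).const_mul (X.w i)).div
    (X.hasDerivAt_val_line hA hs y η) hv
  refine h.congr_deriv ?_
  have hv' := (X.val_pos hA hs y).ne'
  simp only [zero_smul, add_zero]
  rw [θ, sub_dotProduct]
  field_simp

omit hA in
theorem hasDerivAt_p_line (i : X.ι) (y η : Fin k → ℝ) :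
    HasDerivAt (fun t : ℝ => X.p i s (y + t • η))
      (-((2 * Real.pi) • flowPrec A (X.G i) s *ᵥ η)) 0 := by
  have h := ((hasDerivAt_line y η (s • X.z i) 0).const_mulVec (flowPrec A (X.G i) s)).const_smul
    (-2 * Real.pi)
  refine h.congr_deriv ?_
  rw [neg_mul, neg_smul]

/-- Differentiating the θ-average of the p_i produces the θ-covariance of the p_i from the weights
and −2π times the averaged precision from the p_i themselves. -/
theorem hasDerivAt_grad_line (hs : s ∈ Set.Icc (0 : ℝ) 1) (y η : Fin k → ℝ) :
    HasDerivAt (fun t : ℝ => X.grad s (y + t • η)) (X.hess s y *ᵥ η) 0 := by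
  have h := HasDerivAt.fun_sum (u := Finset.univ) fun i _ =>
    (X.hasDerivAt_θ_line hA i hs y η).smul (X.hasDerivAt_p_line i y η (s := s))
  refine h.congr_deriv ?_
  rw [hess, Matrix.sum_mulVec]
  refine Finset.sum_congr rfl fun i _ => ?_
  simp only [zero_smul, add_zero]
  rw [Matrix.smul_mulVec, Matrix.sub_mulVec, Matrix.vecMulVec_mulVec, Matrix.smul_mulVec,
    smul_sub, op_smul_eq_smul, smul_smul, smul_neg]
  abel

/-- The differential inequality for one input: the covariance comparison `K` absorbs the second
order terms. -/
theorem rate_add_trace_hess_ge (hs : s ∈ Set.Icc (0 : ℝ) 1) (y : Fin k → ℝ) (c : ℝ)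
    (S : Matrix (Fin k) (Fin k) ℝ) (hK : (c • (S - A⁻¹)).PosSemidef)
    (hKG : ∀ i, (c • (S - A⁻¹)) * (X.G i - A) = 0) (q : Fin k → ℝ)
    (hq : q = X.grad s y + (2 * Real.pi) • A *ᵥ y) :
    -(c * (2 * Real.pi)⁻¹ * (q ⬝ᵥ A⁻¹ *ᵥ q)) ≤
      c * (s * X.rate s y + (2 * Real.pi)⁻¹ * (S * (X.hess s y + (2 * Real.pi) • A)).trace -
        y ⬝ᵥ q) := by
  set K := c • (S - A⁻¹) with hKdef
  set g := X.grad s y with hg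
  have hpi := Real.pi_pos
  have hA' := hA.det_pos.ne'.isUnit
  have hθ := X.sum_θ hA hs y
  have hgsum : ∑ i, X.θ i s y • X.p i s y = g := rfl
  have hKv : ∀ v, K *ᵥ v = c • (S *ᵥ v - A⁻¹ *ᵥ v) := fun v => by
    rw [hKdef, Matrix.smul_mulVec, Matrix.sub_mulVec]
  -- the trace term, split over the components
  have htr : (S * (X.hess s y + (2 * Real.pi) • A)).trace =
      ∑ i, X.θ i s y * ((X.p i s y - g) ⬝ᵥ S *ᵥ X.p i s y -
        2 * Real.pi * (S * flowPrec A (X.G i) s).trace + 2 * Real.pi * (S * A).trace) := by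
    have h1 : (S * X.hess s y).trace = ∑ i, X.θ i s y * ((X.p i s y - g) ⬝ᵥ S *ᵥ X.p i s y -
        2 * Real.pi * (S * flowPrec A (X.G i) s).trace) := by
      rw [hess, Finset.mul_sum, Matrix.trace_sum]
      refine Finset.sum_congr rfl fun i _ => ?_
      rw [Matrix.mul_smul, Matrix.trace_smul, Matrix.mul_sub, Matrix.trace_sub, Matrix.mul_smul,
        Matrix.trace_smul, Matrix.mul_vecMulVec, Matrix.trace_vecMulVec, smul_eq_mul, smul_eq_mul,
        dotProduct_comm]
    rw [Matrix.mul_add, Matrix.trace_add, h1, Matrix.mul_smul, Matrix.trace_smul, smul_eq_mul]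
    simp only [mul_add, Finset.sum_add_distrib, ← Finset.sum_mul, hθ, one_mul]
  have hrate : s * X.rate s y = ∑ i, X.θ i s y * ((flowPrec A (X.G i) s * A⁻¹).trace - k -
      y ⬝ᵥ X.p i s y - (2 * Real.pi)⁻¹ * (X.p i s y ⬝ᵥ A⁻¹ *ᵥ X.p i s y)) := by
    rw [rate, Finset.mul_sum]
    refine Finset.sum_congr rfl fun i _ => ?_
    rw [mul_left_comm, mul_flowRate hA (X.posDef i) _ _ hs]
    rfl
  -- This is tr(K P_i) = tr(K A): the component precisions drop out of the trace terms.
  have hKP : ∀ i, c * ((S * flowPrec A (X.G i) s).trace - (flowPrec A (X.G i) s * A⁻¹).trace) =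
      c * ((S * A).trace - k) := by
    intro i
    have h1 := congrArg Matrix.trace (mul_flowPrec_eq hA (X.posDef i) hs (hKG i))
    rw [hKdef, Matrix.smul_mul, Matrix.smul_mul, Matrix.trace_smul, Matrix.trace_smul,
      Matrix.sub_mul, Matrix.sub_mul, Matrix.trace_sub, Matrix.trace_sub,
      Matrix.nonsing_inv_mul _ hA', Matrix.trace_one, Fintype.card_fin,
      Matrix.trace_mul_comm A⁻¹] at h1
    exact h1
  -- Writing cS = K + cA⁻¹, the A⁻¹-quadratic terms in p_i cancel; what remains is a K-square of p_i
  -- − g and terms affine in p_i, which average exactly against θ.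
  have hterm : ∀ i, c * ((flowPrec A (X.G i) s * A⁻¹).trace - k -
      y ⬝ᵥ X.p i s y - (2 * Real.pi)⁻¹ * (X.p i s y ⬝ᵥ A⁻¹ *ᵥ X.p i s y) +
      (2 * Real.pi)⁻¹ * ((X.p i s y - g) ⬝ᵥ S *ᵥ X.p i s y -
        2 * Real.pi * (S * flowPrec A (X.G i) s).trace + 2 * Real.pi * (S * A).trace)) =
      (2 * Real.pi)⁻¹ * ((X.p i s y - g) ⬝ᵥ K *ᵥ (X.p i s y - g)) +
        (2 * Real.pi)⁻¹ * (X.p i s y ⬝ᵥ K *ᵥ g - g ⬝ᵥ K *ᵥ g) -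
        c * (y ⬝ᵥ X.p i s y) - c * (2 * Real.pi)⁻¹ * (X.p i s y ⬝ᵥ A⁻¹ *ᵥ g) := by
    intro i
    have h1 := hKP i
    have h2 : (2 * Real.pi)⁻¹ * (2 * Real.pi) = 1 := inv_mul_cancel₀ (by positivity)
    have h3 : g ⬝ᵥ A⁻¹ *ᵥ X.p i s y = X.p i s y ⬝ᵥ A⁻¹ *ᵥ g :=
      dotProduct_mulVec_comm hA.inv.isHermitian _ _
    simp only [hKv, Matrix.mulVec_sub, dotProduct_sub, sub_dotProduct, dotProduct_smul, smul_eq_mul]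
    rw [h3]
    linear_combination (-1 : ℝ) * h1 + (c * ((S * A).trace -
      (S * flowPrec A (X.G i) s).trace)) * h2
  have hsum : c * (s * X.rate s y +
      (2 * Real.pi)⁻¹ * (S * (X.hess s y + (2 * Real.pi) • A)).trace) =
      (2 * Real.pi)⁻¹ * ∑ i, X.θ i s y * ((X.p i s y - g) ⬝ᵥ K *ᵥ (X.p i s y - g)) -
        c * (y ⬝ᵥ g) - c * (2 * Real.pi)⁻¹ * (g ⬝ᵥ A⁻¹ *ᵥ g) := by
    have e1 : ∀ v, ∑ i, X.θ i s y * (X.p i s y ⬝ᵥ v) = g ⬝ᵥ v := by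
      intro v
      rw [← hgsum, sum_dotProduct]
      simp [smul_dotProduct]
    have e2 : ∑ i, X.θ i s y * (y ⬝ᵥ X.p i s y) = y ⬝ᵥ g := by
      simp only [dotProduct_comm y]
      exact e1 y
    calc _ = ∑ i, X.θ i s y * (c * ((flowPrec A (X.G i) s * A⁻¹).trace - k -
      y ⬝ᵥ X.p i s y - (2 * Real.pi)⁻¹ * (X.p i s y ⬝ᵥ A⁻¹ *ᵥ X.p i s y) +
      (2 * Real.pi)⁻¹ * ((X.p i s y - g) ⬝ᵥ S *ᵥ X.p i s y -
        2 * Real.pi * (S * flowPrec A (X.G i) s).trace + 2 * Real.pi * (S * A).trace))) := by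
          rw [hrate, htr, Finset.mul_sum, ← Finset.sum_add_distrib, Finset.mul_sum]
          exact Finset.sum_congr rfl fun i _ => by ring
      _ = ∑ i, ((2 * Real.pi)⁻¹ * (X.θ i s y * ((X.p i s y - g) ⬝ᵥ K *ᵥ (X.p i s y - g))) +
          (2 * Real.pi)⁻¹ * (X.θ i s y * (X.p i s y ⬝ᵥ K *ᵥ g)) -
          (2 * Real.pi)⁻¹ * (g ⬝ᵥ K *ᵥ g) * X.θ i s y - c * (X.θ i s y * (y ⬝ᵥ X.p i s y)) -
          c * (2 * Real.pi)⁻¹ * (X.θ i s y * (X.p i s y ⬝ᵥ A⁻¹ *ᵥ g))) := by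
          refine Finset.sum_congr rfl fun i _ => ?_
          rw [hterm i]
          ring
      _ = _ := by
          simp only [Finset.sum_sub_distrib, Finset.sum_add_distrib, ← Finset.mul_sum, e1, e2, hθ]
          ring
  -- This K-variance is the only quantity discarded. The sign of c is absorbed in K, so both signs
  -- are treated at once.
  have hpos : 0 ≤ ∑ i, X.θ i s y * ((X.p i s y - g) ⬝ᵥ K *ᵥ (X.p i s y - g)) :=
    Finset.sum_nonneg fun i _ => mul_nonneg (X.θ_nonneg hA i hs y) (hK.quadratic_nonneg _)
  have hgq : g = q - (2 * Real.pi) • A *ᵥ y := by rw [hq]; abel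
  have hquad : y ⬝ᵥ g + (2 * Real.pi)⁻¹ * (g ⬝ᵥ A⁻¹ *ᵥ g) + y ⬝ᵥ q =
      (2 * Real.pi)⁻¹ * (q ⬝ᵥ A⁻¹ *ᵥ q) := by
    have f1 : (A *ᵥ y) ⬝ᵥ A⁻¹ *ᵥ q = y ⬝ᵥ q := by
      rw [dotProduct_mulVec_comm hA.inv.isHermitian, inv_mulVec_cancel hA, dotProduct_comm]
    rw [hgq]
    simp only [Matrix.mulVec_sub, Matrix.mulVec_smul, dotProduct_sub, sub_dotProduct,
      dotProduct_smul, smul_dotProduct, smul_eq_mul, inv_mulVec_cancel hA, f1]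
    rw [dotProduct_comm q y, dotProduct_comm (A *ᵥ y) y]
    field_simp
    ring
  have hpos' : 0 ≤ (2 * Real.pi)⁻¹ *
      ∑ i, X.θ i s y * ((X.p i s y - g) ⬝ᵥ K *ᵥ (X.p i s y - g)) := by positivity
  linear_combination hpos' - hsum + c * hquad

end

end Mixture

/-! ### Polynomial growth uniform in time. -/

section Tame

variable {k l : ℕ}

/-- Functions on `[0, 1] × ℝᵏ`, continuous in space, of polynomial growth uniformly in time. -/
def Tame (ψ : ℝ → (Fin k → ℝ) → ℝ) : Prop :=
  (∀ s ∈ Set.Icc (0 : ℝ) 1, Continuous (ψ s)) ∧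
    ∃ C : ℝ, ∃ d : ℕ, 0 ≤ C ∧ ∀ s ∈ Set.Icc (0 : ℝ) 1, ∀ x, |ψ s x| ≤ C * (1 + ‖x‖) ^ d

namespace Tame

variable {ψ φ : ℝ → (Fin k → ℝ) → ℝ}

theorem of_time {f : ℝ → ℝ} (hf : ContinuousOn f (Set.Icc 0 1)) :
    Tame fun s (_ : Fin k → ℝ) => f s := by
  refine ⟨fun s _ => continuous_const, ?_⟩
  obtain ⟨C, hC⟩ := isCompact_Icc.exists_bound_of_continuousOn hf
  refine ⟨C, 0, (norm_nonneg _).trans (hC 0 (by simp)), fun s hs x => ?_⟩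
  simpa using hC s hs

theorem const (c : ℝ) : Tame fun _ (_ : Fin k → ℝ) => c := of_time continuousOn_const

theorem time : Tame fun s (_ : Fin k → ℝ) => s := of_time continuousOn_id

theorem coord (i : Fin k) : Tame fun _ (x : Fin k → ℝ) => x i := by
  refine ⟨fun s _ => continuous_apply i, 1, 1, zero_le_one, fun s _ x => ?_⟩
  have := norm_le_pi_norm x i
  rw [Real.norm_eq_abs] at this
  linarith

theorem add (hψ : Tame ψ) (hφ : Tame φ) : Tame fun s x => ψ s x + φ s x := by
  obtain ⟨hψc, C, d, hC, hψb⟩ := hψ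
  obtain ⟨hφc, C', d', hC', hφb⟩ := hφ
  refine ⟨fun s hs => (hψc s hs).add (hφc s hs), C + C', max d d', by positivity,
    fun s hs x => ?_⟩
  have h1 : 1 ≤ 1 + ‖x‖ := by linarith [norm_nonneg x]
  calc |ψ s x + φ s x| ≤ |ψ s x| + |φ s x| := abs_add_le _ _
    _ ≤ C * (1 + ‖x‖) ^ d + C' * (1 + ‖x‖) ^ d' := add_le_add (hψb s hs x) (hφb s hs x)
    _ ≤ C * (1 + ‖x‖) ^ max d d' + C' * (1 + ‖x‖) ^ max d d' := by
        gcongr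
        · exact le_max_left _ _
        · exact le_max_right _ _
    _ = _ := by ring

theorem mul (hψ : Tame ψ) (hφ : Tame φ) : Tame fun s x => ψ s x * φ s x := by
  obtain ⟨hψc, C, d, hC, hψb⟩ := hψ
  obtain ⟨hφc, C', d', hC', hφb⟩ := hφ
  refine ⟨fun s hs => (hψc s hs).mul (hφc s hs), C * C', d + d', by positivity,
    fun s hs x => ?_⟩
  calc |ψ s x * φ s x| = |ψ s x| * |φ s x| := abs_mul _ _
    _ ≤ (C * (1 + ‖x‖) ^ d) * (C' * (1 + ‖x‖) ^ d') := by
        gcongr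
        · exact hψb s hs x
        · exact hφb s hs x
    _ = _ := by ring

theorem neg (hψ : Tame ψ) : Tame fun s x => -ψ s x := by
  simpa using (const (-1)).mul hψ

theorem sub (hψ : Tame ψ) (hφ : Tame φ) : Tame fun s x => ψ s x - φ s x := by
  simpa [sub_eq_add_neg] using hψ.add hφ.neg

theorem sum {ι : Type*} (t : Finset ι) {ψ : ι → ℝ → (Fin k → ℝ) → ℝ} (h : ∀ i, Tame (ψ i)) :
    Tame fun s x => ∑ i ∈ t, ψ i s x := by
  classical
  induction t using Finset.induction_on with
  | empty => simpa using const 0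
  | insert i t hi ih => simpa [Finset.sum_insert hi] using (h i).add ih

theorem dotProduct {u v : ℝ → (Fin k → ℝ) → Fin l → ℝ} (hu : ∀ i, Tame fun s x => u s x i)
    (hv : ∀ i, Tame fun s x => v s x i) : Tame fun s x => u s x ⬝ᵥ v s x :=
  sum Finset.univ fun i => (hu i).mul (hv i)

theorem mulVec {k' : ℕ} {P : ℝ → (Fin k → ℝ) → Matrix (Fin k') (Fin l) ℝ}
    {v : ℝ → (Fin k → ℝ) → Fin l → ℝ}
    (hP : ∀ a b, Tame fun s x => P s x a b) (hv : ∀ i, Tame fun s x => v s x i) (a : Fin k') :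
    Tame fun s x => (P s x *ᵥ v s x) a :=
  dotProduct (fun b => hP a b) hv

theorem matrix_mul {k₁ k₂ k₃ : ℕ} {P : ℝ → (Fin k → ℝ) → Matrix (Fin k₁) (Fin k₂) ℝ}
    {R : ℝ → (Fin k → ℝ) → Matrix (Fin k₂) (Fin k₃) ℝ}
    (hP : ∀ a b, Tame fun s x => P s x a b) (hR : ∀ a b, Tame fun s x => R s x a b)
    (a : Fin k₁) (b : Fin k₃) : Tame fun s x => (P s x * R s x) a b := by
  simp only [Matrix.mul_apply]
  exact sum Finset.univ fun i => (hP a i).mul (hR i b)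

theorem const_mulVec {k' : ℕ} (B : Matrix (Fin k') (Fin l) ℝ) {v : ℝ → (Fin k → ℝ) → Fin l → ℝ}
    (hv : ∀ i, Tame fun s x => v s x i) (a : Fin k') : Tame fun s x => (B *ᵥ v s x) a :=
  mulVec (P := fun _ _ => B) (fun _ _ => const _) hv a

theorem trace {P : ℝ → (Fin k → ℝ) → Matrix (Fin l) (Fin l) ℝ}
    (hP : ∀ a b, Tame fun s x => P s x a b) : Tame fun s x => (P s x).trace :=
  sum Finset.univ fun i => hP i i

theorem exists_norm_mulVec_le (B : Matrix (Fin l) (Fin k) ℝ) :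
    ∃ b : ℝ, 0 ≤ b ∧ ∀ x : Fin k → ℝ, ‖B *ᵥ x‖ ≤ b * ‖x‖ := by
  refine ⟨‖B.mulVecLin.toContinuousLinearMap‖, norm_nonneg _, fun x => ?_⟩
  exact B.mulVecLin.toContinuousLinearMap.le_opNorm x

theorem comp_mulVec {ψ : ℝ → (Fin l → ℝ) → ℝ} (hψ : Tame ψ) (B : Matrix (Fin l) (Fin k) ℝ) :
    Tame fun s x => ψ s (B *ᵥ x) := by
  obtain ⟨hψc, C, d, hC, hψb⟩ := hψ
  obtain ⟨b, hb, hB⟩ := exists_norm_mulVec_le B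
  refine ⟨fun s hs => (hψc s hs).comp (by fun_prop), C * (1 + b) ^ d, d, by positivity,
    fun s hs x => (hψb s hs _).trans ?_⟩
  rw [mul_assoc, ← mul_pow]
  gcongr
  nlinarith [hB x, norm_nonneg x]

end Tame

end Tame

/-! ### Gaussian domination. -/

section Integrability

variable {n : ℕ}

theorem integrable_exp_neg_norm_sq {δ : ℝ} (hδ : 0 < δ) :
    Integrable fun x : Fin n → ℝ => Real.exp (-δ * ‖x‖ ^ 2) := by
  have hpos : 0 < δ / (Real.pi * (n + 1)) := by positivity
  have hM : ((δ / (Real.pi * (n + 1))) • (1 : Matrix (Fin n) (Fin n) ℝ)).PosDef :=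
    Matrix.PosDef.one.smul hpos
  refine (integrable_exp_neg_quadratic hM).mono'
    (by fun_prop : Continuous fun x : Fin n → ℝ => Real.exp (-δ * ‖x‖ ^ 2)).aestronglyMeasurable
    (Filter.Eventually.of_forall fun x => ?_)
  rw [Real.norm_eq_abs, Real.abs_exp, Real.exp_le_exp, Matrix.smul_mulVec, Matrix.one_mulVec,
    dotProduct_smul, smul_eq_mul]
  have h1 : x ⬝ᵥ x ≤ (n + 1) * ‖x‖ ^ 2 := by
    calc x ⬝ᵥ x ≤ ∑ _i : Fin n, ‖x‖ ^ 2 := by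
          refine Finset.sum_le_sum fun i _ => ?_
          rw [← sq, ← sq_abs]
          exact pow_le_pow_left₀ (abs_nonneg _) (norm_le_pi_norm x i) 2
      _ = n * ‖x‖ ^ 2 := by simp
      _ ≤ (n + 1) * ‖x‖ ^ 2 := by nlinarith [sq_nonneg ‖x‖]
  have h2 : Real.pi * (δ / (Real.pi * (n + 1)) * (x ⬝ᵥ x)) = δ * ((x ⬝ᵥ x) / (n + 1)) := by
    have := Real.pi_ne_zero
    field_simp
  have h3 : (x ⬝ᵥ x) / (n + 1) ≤ ‖x‖ ^ 2 := by
    rw [div_le_iff₀ (by positivity)]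
    linarith
  rw [neg_mul, neg_mul, neg_le_neg_iff, h2]
  gcongr

theorem exists_poly_mul_exp_le {δ : ℝ} (hδ : 0 < δ) (d : ℕ) :
    ∃ C : ℝ, 0 ≤ C ∧ ∀ t : ℝ, 0 ≤ t →
      (1 + t) ^ d * Real.exp (-δ * t ^ 2) ≤ C * Real.exp (-(δ / 2) * t ^ 2) := by
  refine ⟨d.factorial * Real.exp (1 + 1 / (2 * δ)), by positivity, fun t ht => ?_⟩
  have h1 : (1 + t) ^ d ≤ d.factorial * Real.exp (1 + t) := by
    have := Real.pow_div_factorial_le_exp (1 + t) (by positivity) d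
    rwa [div_le_iff₀ (by positivity), mul_comm] at this
  have h2 : t ≤ 1 / (2 * δ) + δ / 2 * t ^ 2 := by
    have : 0 ≤ (1 / (2 * δ)) * (δ * t - 1) ^ 2 := by positivity
    have e : (1 / (2 * δ)) * (δ * t - 1) ^ 2 = δ / 2 * t ^ 2 - t + 1 / (2 * δ) := by
      field_simp
      ring
    linarith
  calc (1 + t) ^ d * Real.exp (-δ * t ^ 2)
      ≤ (d.factorial * Real.exp (1 + t)) * Real.exp (-δ * t ^ 2) := by gcongr
    _ = d.factorial * Real.exp (1 + t + -δ * t ^ 2) := by rw [mul_assoc, ← Real.exp_add]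
    _ ≤ d.factorial * Real.exp (1 + 1 / (2 * δ) + -(δ / 2) * t ^ 2) := by
        gcongr ?_ * Real.exp ?_
        linarith
    _ = _ := by rw [Real.exp_add, mul_assoc]

theorem Tame.exists_dominating {ψ Φ : ℝ → (Fin n → ℝ) → ℝ} (hψ : Tame ψ) {C δ : ℝ}
    (hδ : 0 < δ) (hC : 0 ≤ C)
    (hΦ : ∀ s ∈ Set.Icc (0 : ℝ) 1, ∀ x, |Φ s x| ≤ C * Real.exp (-δ * ‖x‖ ^ 2)) :
    ∃ C' : ℝ, ∀ s ∈ Set.Icc (0 : ℝ) 1, ∀ x,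
      |Φ s x * ψ s x| ≤ C' * Real.exp (-(δ / 2) * ‖x‖ ^ 2) := by
  obtain ⟨-, C₁, d, hC₁, hb⟩ := hψ
  obtain ⟨C₂, hC₂, h₂⟩ := exists_poly_mul_exp_le hδ d
  refine ⟨C * C₁ * C₂, fun s hs x => ?_⟩
  rw [abs_mul]
  calc |Φ s x| * |ψ s x| ≤ (C * Real.exp (-δ * ‖x‖ ^ 2)) * (C₁ * (1 + ‖x‖) ^ d) := by
        gcongr
        · exact hΦ s hs x
        · exact hb s hs x
    _ = C * C₁ * ((1 + ‖x‖) ^ d * Real.exp (-δ * ‖x‖ ^ 2)) := by ring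
    _ ≤ C * C₁ * (C₂ * Real.exp (-(δ / 2) * ‖x‖ ^ 2)) := by
        exact mul_le_mul_of_nonneg_left (h₂ _ (norm_nonneg x)) (by positivity)
    _ = _ := by ring

end Integrability

namespace Datum

variable {m n : ℕ} (D : Datum m n)

/-- The exponents −π c_j⟨y, A_j y⟩ at y = B_j x combine with Q to −π⟨x, M̃x⟩, which is coercive;
half of that decay absorbs the linear terms. The constants do not depend on φ, as dominated
convergence will require. -/
theorem exists_gaussian_dominating {A : D.MatrixTuple} (hA : A ∈ D.Lambda) {K : ℝ} (hK : 0 ≤ K) :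
    ∃ C δ : ℝ, 0 ≤ C ∧ 0 < δ ∧ ∀ φ : (j : Fin m) → (Fin (D.dim j) → ℝ) → ℝ,
      (∀ j y, 0 ≤ φ j y) →
      (∀ j y, φ j y ^ D.c j ≤
        K * Real.exp (-Real.pi * (D.c j * (y ⬝ᵥ A j *ᵥ y)) + K * ‖y‖)) →
      ∀ x, Real.exp (-Real.pi * (x ⬝ᵥ D.Q *ᵥ x)) * ∏ j, φ j (D.B j *ᵥ x) ^ D.c j ≤
        C * Real.exp (-δ * ‖x‖ ^ 2) := by
  obtain ⟨δ₀, hδ₀, hco⟩ := hA.2.exists_coercive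
  choose b hb hB using fun j => Tame.exists_norm_mulVec_le (D.B j)
  set β := K * ∑ j, b j with hβ
  set a := Real.pi * δ₀ with ha
  have hapos : 0 < a := mul_pos Real.pi_pos hδ₀
  refine ⟨K ^ m * Real.exp (β ^ 2 / (2 * a)), a / 2, by positivity, by positivity,
    fun φ hφ hle x => ?_⟩
  have h1 : ∏ j, φ j (D.B j *ᵥ x) ^ D.c j ≤ ∏ j, K * Real.exp
      (-Real.pi * (D.c j * ((D.B j *ᵥ x) ⬝ᵥ A j *ᵥ (D.B j *ᵥ x))) + K * ‖D.B j *ᵥ x‖) :=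
    Finset.prod_le_prod (fun j _ => Real.rpow_nonneg (hφ j _) _) fun j _ => hle j _
  have h2 : ∑ j, K * ‖D.B j *ᵥ x‖ ≤ β * ‖x‖ := by
    rw [hβ, mul_assoc, Finset.sum_mul, Finset.mul_sum]
    refine Finset.sum_le_sum fun j _ => ?_
    gcongr
    exact hB j x
  have h3 : β * ‖x‖ ≤ β ^ 2 / (2 * a) + a / 2 * ‖x‖ ^ 2 := by
    have h : 0 ≤ (1 / (2 * a)) * (a * ‖x‖ - β) ^ 2 := by positivity
    have e : (1 / (2 * a)) * (a * ‖x‖ - β) ^ 2 = a / 2 * ‖x‖ ^ 2 - β * ‖x‖ + β ^ 2 / (2 * a) := by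
      field_simp
      ring
    linarith
  have h4 : -Real.pi * (x ⬝ᵥ D.Mtilde A *ᵥ x) ≤ -a * ‖x‖ ^ 2 := by
    have := mul_le_mul_of_nonneg_left (hco x) Real.pi_pos.le
    rw [ha]
    linarith
  calc Real.exp (-Real.pi * (x ⬝ᵥ D.Q *ᵥ x)) * ∏ j, φ j (D.B j *ᵥ x) ^ D.c j
      ≤ Real.exp (-Real.pi * (x ⬝ᵥ D.Q *ᵥ x)) * ∏ j, K * Real.exp
        (-Real.pi * (D.c j * ((D.B j *ᵥ x) ⬝ᵥ A j *ᵥ (D.B j *ᵥ x))) + K * ‖D.B j *ᵥ x‖) := by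
        gcongr
    _ = K ^ m * Real.exp (-Real.pi * (x ⬝ᵥ D.Mtilde A *ᵥ x) + ∑ j, K * ‖D.B j *ᵥ x‖) := by
        rw [Finset.prod_mul_distrib, Finset.prod_const, Finset.card_univ, Fintype.card_fin,
          ← Real.exp_sum, mul_left_comm, ← Real.exp_add, D.quadratic_Mtilde A x x,
          Finset.sum_add_distrib, ← Finset.mul_sum]
        congr 2
        ring
    _ ≤ K ^ m * Real.exp (β ^ 2 / (2 * a) + -(a / 2) * ‖x‖ ^ 2) := by
        gcongr ?_ * Real.exp ?_
        linarith
    _ = _ := by rw [Real.exp_add, mul_assoc]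

end Datum

/-! ### Growth of mixtures and of their powers. -/

section Growth

variable {k : ℕ}

theorem gaussian_sub_le {A P : Matrix (Fin k) (Fin k) ℝ} (hA : A.PosDef) (h : A ≤ P)
    (y c : Fin k → ℝ) :
    gaussian P (y - c) ≤ Real.sqrt P.det *
      Real.exp (-Real.pi * (y ⬝ᵥ A *ᵥ y) + 2 * Real.pi * (∑ i, |(A *ᵥ c) i|) * ‖y‖) := by
  have h1 := (Matrix.le_iff.1 h).quadratic_nonneg (y - c)
  rw [Matrix.sub_mulVec, dotProduct_sub] at h1
  have h2 : (y - c) ⬝ᵥ A *ᵥ (y - c) = y ⬝ᵥ A *ᵥ y - 2 * (y ⬝ᵥ A *ᵥ c) + c ⬝ᵥ A *ᵥ c := by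
    rw [Matrix.mulVec_sub, sub_dotProduct, dotProduct_sub, dotProduct_sub,
      dotProduct_mulVec_comm hA.isHermitian c y]
    ring
  have h3 := hA.posSemidef.quadratic_nonneg c
  have h4 := (le_abs_self _).trans (abs_dotProduct_le y (A *ᵥ c))
  rw [gaussian]
  gcongr
  nlinarith [Real.pi_pos]

end Growth

namespace Mixture

variable {k : ℕ} {A : Matrix (Fin k) (Fin k) ℝ} (X : Mixture A)

section

variable (hA : A.PosDef)
include hA

theorem continuousOn_flowPrec (i : X.ι) :
    ContinuousOn (flowPrec A (X.G i)) (Set.Icc 0 1) := fun _ hs =>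
  (continuousAt_flowPrec (flowCov_posDef hA (X.posDef i) hs).det_pos.ne').continuousWithinAt

theorem tame_flowPrec (i : X.ι) (a b : Fin k) :
    Tame fun s (_ : Fin k → ℝ) => flowPrec A (X.G i) s a b :=
  Tame.of_time ((continuous_apply_apply a b).comp_continuousOn (X.continuousOn_flowPrec hA i))

omit hA in
theorem tame_sub_center (i : X.ι) (a : Fin k) : Tame fun s (y : Fin k → ℝ) => (y - s • X.z i) a := by
  simp only [Pi.sub_apply, Pi.smul_apply, smul_eq_mul]
  exact (Tame.coord a).sub (Tame.time.mul (Tame.const _))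

theorem tame_flowPrec_mulVec (i : X.ι) (a : Fin k) :
    Tame fun s y => (flowPrec A (X.G i) s *ᵥ (y - s • X.z i)) a :=
  Tame.mulVec (X.tame_flowPrec hA i) (X.tame_sub_center i) a

theorem tame_p (i : X.ι) (a : Fin k) : Tame fun s y => X.p i s y a := by
  simp only [p, flowGrad, Pi.smul_apply, smul_eq_mul]
  exact (Tame.const _).mul (X.tame_flowPrec_mulVec hA i a)

theorem tame_flowRate (i : X.ι) : Tame fun s y => flowRate A (X.G i) (X.z i) s y := by
  simp only [flowRate]
  refine ((Tame.time.mul (Tame.trace ?_)).add ((Tame.const _).mul (Tame.dotProduct ?_ ?_))).sub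
    (((Tame.const _).mul Tame.time).mul (Tame.dotProduct ?_ ?_))
  · exact Tame.matrix_mul (X.tame_flowPrec hA i) fun a b => Tame.const _
  · exact fun a => Tame.const _
  · exact X.tame_flowPrec_mulVec hA i
  · exact X.tame_flowPrec_mulVec hA i
  · exact Tame.mulVec (fun a b => Tame.const _) (X.tame_flowPrec_mulVec hA i)

omit hA in
theorem continuous_val (s : ℝ) : Continuous (X.val s) :=
  continuous_finsetSum _ fun _ _ =>
    continuous_const.mul ((continuous_gaussian _).comp (continuous_id.sub continuous_const))

theorem tame_θ (i : X.ι) : Tame (X.θ i) := by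
  refine ⟨fun s hs => ?_, 1, 0, zero_le_one, fun s hs y => ?_⟩
  · exact (continuous_const.mul ((continuous_gaussian _).comp
      (continuous_id.sub continuous_const))).div (X.continuous_val s)
      fun y => (X.val_pos hA hs y).ne'
  · rw [abs_of_nonneg (X.θ_nonneg hA i hs y)]
    simpa using X.θ_le_one hA i hs y

theorem tame_grad (a : Fin k) : Tame fun s y => X.grad s y a := by
  simp only [grad, Finset.sum_apply, Pi.smul_apply, smul_eq_mul]
  exact Tame.sum _ fun i => (X.tame_θ hA i).mul (X.tame_p hA i a)

theorem tame_rate : Tame X.rate :=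
  Tame.sum _ fun i => (X.tame_θ hA i).mul (X.tame_flowRate hA i)

theorem tame_hess (a b : Fin k) : Tame fun s y => X.hess s y a b := by
  simp only [hess, Matrix.sum_apply, Matrix.smul_apply, Matrix.sub_apply, Matrix.vecMulVec_apply,
    Pi.sub_apply, smul_eq_mul]
  exact Tame.sum _ fun i => (X.tame_θ hA i).mul (((X.tame_p hA i a).mul
    ((X.tame_p hA i b).sub (X.tame_grad hA b))).sub ((Tame.const _).mul (X.tame_flowPrec hA i a b)))

/-- Precisions stay above A and centres stay bounded, so each component is at most a multiple of g_A
up to an exponential of linear growth. -/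
theorem exists_val_le : ∃ K : ℝ, 0 ≤ K ∧ ∀ s ∈ Set.Icc (0 : ℝ) 1, ∀ y,
    X.val s y ≤ K * Real.exp (-Real.pi * (y ⬝ᵥ A *ᵥ y) + K * ‖y‖) := by
  have h : ∀ i, ∃ d : ℝ, ∀ s ∈ Set.Icc (0 : ℝ) 1, Real.sqrt (flowPrec A (X.G i) s).det ≤ d := by
    intro i
    have hc : ContinuousOn (fun s => Real.sqrt (flowPrec A (X.G i) s).det) (Set.Icc 0 1) :=
      Real.continuous_sqrt.comp_continuousOn
        ((continuous_id.matrix_det).comp_continuousOn (X.continuousOn_flowPrec hA i))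
    obtain ⟨d, hd⟩ := isCompact_Icc.exists_bound_of_continuousOn hc
    exact ⟨d, fun s hs => (le_abs_self _).trans (hd s hs)⟩
  choose d hd using h
  have hd0 : ∀ i, 0 ≤ d i := fun i => (Real.sqrt_nonneg _).trans (hd i 0 (by simp))
  set r : X.ι → ℝ := fun i => 2 * Real.pi * ∑ a, |(A *ᵥ X.z i) a| with hr
  have hr0 : ∀ i, 0 ≤ r i := fun i => by positivity
  have hw := X.w_nonneg
  have hwd : ∀ i, 0 ≤ X.w i * d i := fun i => mul_nonneg (hw i) (hd0 i)
  have hS1 : 0 ≤ ∑ i, r i := Finset.sum_nonneg fun i _ => hr0 i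
  have hS2 : 0 ≤ ∑ i, X.w i * d i := Finset.sum_nonneg fun i _ => hwd i
  refine ⟨∑ i, r i + ∑ i, X.w i * d i, by positivity, fun s hs y => ?_⟩
  set E := Real.exp (-Real.pi * (y ⬝ᵥ A *ᵥ y) + (∑ i, r i + ∑ i, X.w i * d i) * ‖y‖) with hE
  have hterm : ∀ i, X.w i * X.term i s y ≤ X.w i * d i * E := by
    intro i
    rw [mul_assoc]
    refine mul_le_mul_of_nonneg_left ?_ (hw i)
    refine (gaussian_sub_le hA (le_flowPrec hA (X.posDef i) (X.le i) hs) y (s • X.z i)).trans ?_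
    have h1 : ∑ a, |(A *ᵥ (s • X.z i)) a| ≤ ∑ a, |(A *ᵥ X.z i) a| := by
      refine Finset.sum_le_sum fun a _ => ?_
      rw [Matrix.mulVec_smul, Pi.smul_apply, smul_eq_mul, abs_mul, abs_of_nonneg hs.1]
      exact mul_le_of_le_one_left (abs_nonneg _) hs.2
    have h2 : r i ≤ ∑ i, r i := Finset.single_le_sum (fun i _ => hr0 i) (Finset.mem_univ i)
    have h3 : 2 * Real.pi * ∑ a, |(A *ᵥ (s • X.z i)) a| ≤ r i := by
      simp only [hr]
      gcongr
    refine mul_le_mul (hd i s hs) (Real.exp_le_exp.2 ?_) (Real.exp_pos _).le (hd0 i)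
    have h4 := mul_le_mul_of_nonneg_right
      ((h3.trans h2).trans (le_add_of_nonneg_right hS2)) (norm_nonneg y)
    linarith
  calc X.val s y ≤ ∑ i, X.w i * d i * E := Finset.sum_le_sum fun i _ => hterm i
    _ = (∑ i, X.w i * d i) * E := by rw [Finset.sum_mul]
    _ ≤ _ := by gcongr; linarith

/-- A component equal to g_A is stationary under the flow and so gives a lower bound at all times.
Negative exponents need such a bound. -/
theorem exists_le_val (hX : ∃ i, 0 < X.w i ∧ X.G i = A ∧ X.z i = 0) :
    ∃ κ : ℝ, 0 < κ ∧ ∀ s ∈ Set.Icc (0 : ℝ) 1, ∀ y,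
      κ * Real.exp (-Real.pi * (y ⬝ᵥ A *ᵥ y)) ≤ X.val s y := by
  obtain ⟨i, hi, hG, hz⟩ := hX
  refine ⟨X.w i * Real.sqrt A.det, mul_pos hi (Real.sqrt_pos.2 hA.det_pos), fun s hs y => ?_⟩
  have h : X.w i * Real.sqrt A.det * Real.exp (-Real.pi * (y ⬝ᵥ A *ᵥ y)) =
      X.w i * X.term i s y := by
    rw [term, hG, hz, flowPrec_self hA, smul_zero, sub_zero, gaussian, mul_assoc]
  rw [h]
  exact Finset.single_le_sum (f := fun i => X.w i * X.term i s y)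
    (fun i _ => mul_nonneg (X.w_nonneg i) (X.term_pos hA i hs y).le) (Finset.mem_univ i)

end

end Mixture

section RpowBounds

theorem rpow_le_of_le_mul_exp {v c K u t : ℝ} (hc : 0 < c) (hv : 0 ≤ v) (hK : 0 ≤ K)
    (ht : 0 ≤ t) (h : v ≤ K * Real.exp (-Real.pi * u + K * t)) :
    v ^ c ≤ (K ^ c + c * K) * Real.exp (-Real.pi * (c * u) + (K ^ c + c * K) * t) := by
  have hKc : 0 ≤ K ^ c := Real.rpow_nonneg hK _
  calc v ^ c ≤ (K * Real.exp (-Real.pi * u + K * t)) ^ c := Real.rpow_le_rpow hv h hc.le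
    _ = K ^ c * Real.exp (-Real.pi * (c * u) + c * K * t) := by
        rw [Real.mul_rpow hK (Real.exp_pos _).le, ← Real.exp_mul]
        congr 2
        ring
    _ ≤ _ := by
        gcongr
        · have : 0 ≤ c * K := by positivity
          linarith
        · linarith

theorem rpow_le_of_mul_exp_le {v c κ u t : ℝ} (hc : c < 0) (hκ : 0 < κ) (ht : 0 ≤ t)
    (h : κ * Real.exp (-Real.pi * u) ≤ v) :
    v ^ c ≤ κ ^ c * Real.exp (-Real.pi * (c * u) + κ ^ c * t) := by
  calc v ^ c ≤ (κ * Real.exp (-Real.pi * u)) ^ c :=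
        Real.rpow_le_rpow_of_nonpos (by positivity) h hc.le
    _ = κ ^ c * Real.exp (-Real.pi * (c * u)) := by
        rw [Real.mul_rpow hκ.le (Real.exp_pos _).le, ← Real.exp_mul]
        congr 2
        ring
    _ ≤ _ := by
        gcongr
        have : 0 ≤ κ ^ c * t := by positivity
        linarith

theorem mul_exp_le_mul_exp {K K' u t : ℝ} (hK : 0 ≤ K) (h : K ≤ K') (ht : 0 ≤ t) :
    K * Real.exp (u + K * t) ≤ K' * Real.exp (u + K' * t) := by
  gcongr
  exact hK.trans h

end RpowBounds

namespace Mixture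

theorem exists_val_rpow_le {k : ℕ} {A : Matrix (Fin k) (Fin k) ℝ} (X : Mixture A)
    (hA : A.PosDef) {c : ℝ} (hc : c ≠ 0)
    (hX : c < 0 → ∃ i, 0 < X.w i ∧ X.G i = A ∧ X.z i = 0) :
    ∃ K : ℝ, 0 ≤ K ∧ ∀ s ∈ Set.Icc (0 : ℝ) 1, ∀ y,
      X.val s y ^ c ≤ K * Real.exp (-Real.pi * (c * (y ⬝ᵥ A *ᵥ y)) + K * ‖y‖) := by
  rcases hc.lt_or_gt with hc | hc
  · obtain ⟨κ, hκ, h⟩ := X.exists_le_val hA (hX hc)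
    exact ⟨κ ^ c, by positivity, fun s hs y =>
      rpow_le_of_mul_exp_le hc hκ (norm_nonneg y) (h s hs y)⟩
  · obtain ⟨K, hK, h⟩ := X.exists_val_le hA
    exact ⟨K ^ c + c * K, by positivity, fun s hs y =>
      rpow_le_of_le_mul_exp hc (X.val_pos hA hs y).le hK (norm_nonneg y) (h s hs y)⟩

end Mixture

/-- Integration by parts against the constant function 1. -/
theorem integral_eq_zero_of_hasLineDerivAt {n : ℕ} {f f' : (Fin n → ℝ) → ℝ} {v : Fin n → ℝ}
    (hf : Integrable f) (hf' : Integrable f') (h : ∀ x, HasLineDerivAt ℝ f (f' x) x v) :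
    ∫ x, f' x = 0 := by
  have := integral_bilinear_hasLineDerivAt_right_eq_neg_left_of_integrable (μ := volume)
    (f := fun _ : Fin n → ℝ => (1 : ℝ)) (f' := fun _ => 0) (g := f) (g' := f') (v := v)
    (B := ContinuousLinearMap.mul ℝ ℝ) (by simp) (by simpa using hf') (by simpa using hf)
    (fun x _ => hasDerivAt_const _ _) (fun x _ => h x)
  simpa using this

/-! ### Monotonicity of the integral along the flow. -/

namespace Datum

variable {m n : ℕ} (D : Datum m n) {A : D.MatrixTuple} (X : (j : Fin m) → Mixture (A j))

/-- The integrand of the Brascamp--Lieb functional along the flow. -/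
def flowIntegrand (s : ℝ) (x : Fin n → ℝ) : ℝ :=
  Real.exp (-Real.pi * (x ⬝ᵥ D.Q *ᵥ x) + ∑ j, D.c j * Real.log ((X j).val s (D.B j *ᵥ x)))

/-- The logarithmic gradient of the `j`-th input relative to that of `g_{A j}`. -/
def relGrad (j : Fin m) (s : ℝ) (x : Fin n → ℝ) : Fin (D.dim j) → ℝ :=
  (X j).grad s (D.B j *ᵥ x) + (2 * Real.pi) • A j *ᵥ (D.B j *ᵥ x)

/-- The gradient of the logarithm of the product of the relative inputs. -/
def totalGrad (s : ℝ) (x : Fin n → ℝ) : Fin n → ℝ :=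
  ∑ j, D.c j • (D.B j)ᵀ *ᵥ D.relGrad X j s x

/-- The vector field along which the integrand is transported. -/
def field (s : ℝ) (x : Fin n → ℝ) : Fin n → ℝ :=
  (2 * Real.pi)⁻¹ • (D.Mtilde A)⁻¹ *ᵥ D.totalGrad X s x

/-- The spatial derivative of `field`. -/
def fieldDeriv (s : ℝ) (x : Fin n → ℝ) : Matrix (Fin n) (Fin n) ℝ :=
  (2 * Real.pi)⁻¹ • ((D.Mtilde A)⁻¹ * ∑ j, D.c j •
    ((D.B j)ᵀ * ((X j).hess s (D.B j *ᵥ x) + (2 * Real.pi) • A j) * D.B j))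

/-- The logarithmic time derivative of the integrand. -/
def totalRate (s : ℝ) (x : Fin n → ℝ) : ℝ := ∑ j, D.c j * (X j).rate s (D.B j *ᵥ x)

/-- The logarithmic gradient of the integrand. -/
def logGrad (s : ℝ) (x : Fin n → ℝ) : Fin n → ℝ :=
  D.totalGrad X s x - (2 * Real.pi) • D.Mtilde A *ᵥ x

variable {X} {s : ℝ}

theorem flowIntegrand_pos (x : Fin n → ℝ) : 0 < D.flowIntegrand X s x := Real.exp_pos _

theorem flowIntegrand_eq (hA : ∀ j, (A j).PosDef) (hs : s ∈ Set.Icc (0 : ℝ) 1) (x : Fin n → ℝ) :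
    D.flowIntegrand X s x = Real.exp (-Real.pi * (x ⬝ᵥ D.Q *ᵥ x)) *
      ∏ j, (X j).val s (D.B j *ᵥ x) ^ D.c j := by
  rw [flowIntegrand, Real.exp_add, Real.exp_sum]
  congr 1
  refine Finset.prod_congr rfl fun j _ => ?_
  rw [Real.rpow_def_of_pos ((X j).val_pos (hA j) hs _), mul_comm]

theorem continuous_flowIntegrand (hA : ∀ j, (A j).PosDef) (hs : s ∈ Set.Icc (0 : ℝ) 1) :
    Continuous (D.flowIntegrand X s) := by
  unfold flowIntegrand
  refine Real.continuous_exp.comp ((by fun_prop : Continuous fun x : Fin n → ℝ =>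
    -Real.pi * (x ⬝ᵥ D.Q *ᵥ x)).add (continuous_finsetSum _ fun j _ => continuous_const.mul ?_))
  exact (((X j).continuous_val s).comp (by fun_prop)).log
    fun x => ((X j).val_pos (hA j) hs _).ne'

theorem exists_flowIntegrand_le (hA : A ∈ D.Lambda)
    (hX : ∀ j, D.c j < 0 → ∃ i, 0 < (X j).w i ∧ (X j).G i = A j ∧ (X j).z i = 0) :
    ∃ C δ : ℝ, 0 ≤ C ∧ 0 < δ ∧ ∀ s ∈ Set.Icc (0 : ℝ) 1, ∀ x,
      |D.flowIntegrand X s x| ≤ C * Real.exp (-δ * ‖x‖ ^ 2) := by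
  choose K hK hle using fun j => (X j).exists_val_rpow_le (hA.1 j) (D.c_ne_zero j) (hX j)
  obtain ⟨C, δ, hC, hδ, h⟩ := D.exists_gaussian_dominating hA
    (K := ∑ j, K j) (Finset.sum_nonneg fun j _ => hK j)
  refine ⟨C, δ, hC, hδ, fun s hs x => ?_⟩
  rw [abs_of_pos (D.flowIntegrand_pos x), D.flowIntegrand_eq hA.1 hs]
  refine h (fun j => (X j).val s) (fun j y => ((X j).val_pos (hA.1 j) hs y).le) (fun j y => ?_) x
  exact (hle j s hs y).trans (mul_exp_le_mul_exp (hK j)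
    (Finset.single_le_sum (fun j _ => hK j) (Finset.mem_univ j)) (norm_nonneg y))

theorem hasDerivAt_flowIntegrand (hA : ∀ j, (A j).PosDef) (hs : s ∈ Set.Icc (0 : ℝ) 1)
    (x : Fin n → ℝ) : HasDerivAt (fun s => D.flowIntegrand X s x)
      (D.flowIntegrand X s x * D.totalRate X s x) s := by
  have h := HasDerivAt.fun_sum (u := Finset.univ) fun j _ =>
    (((X j).hasDerivAt_val (hA j) hs (D.B j *ᵥ x)).log
      ((X j).val_pos (hA j) hs _).ne').const_mul (D.c j)
  refine (h.const_add (-Real.pi * (x ⬝ᵥ D.Q *ᵥ x))).exp.congr_deriv ?_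
  rw [flowIntegrand, totalRate]
  congr 1
  refine Finset.sum_congr rfl fun j _ => ?_
  rw [mul_div_cancel_left₀ _ ((X j).val_pos (hA j) hs _).ne']

/-- The terms 2πA_jB_jx in the relative gradients cancel those in 2πM̃x, leaving the gradients of
the inputs and of the kernel. -/
theorem logGrad_dotProduct (x v : Fin n → ℝ) : D.logGrad X s x ⬝ᵥ v =
    -(2 * Real.pi) * (x ⬝ᵥ D.Q *ᵥ v) +
      ∑ j, D.c j * ((X j).grad s (D.B j *ᵥ x) ⬝ᵥ (D.B j *ᵥ v)) := by
  have hM : D.Mtilde A *ᵥ x = D.Q *ᵥ x + ∑ j, D.c j • (D.B j)ᵀ *ᵥ (A j *ᵥ (D.B j *ᵥ x)) := by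
    rw [Mtilde, Matrix.add_mulVec, Matrix.sum_mulVec, add_comm]
    congr 1
    refine Finset.sum_congr rfl fun j _ => ?_
    rw [Matrix.smul_mulVec, Matrix.mul_assoc, ← Matrix.mulVec_mulVec, ← Matrix.mulVec_mulVec]
  have h : ∀ j (u : Fin (D.dim j) → ℝ), ((D.B j)ᵀ *ᵥ u) ⬝ᵥ v = u ⬝ᵥ (D.B j *ᵥ v) := by
    intro j u
    rw [dotProduct_comm, dotProduct_mulVec_transpose, dotProduct_comm]
  have hQ : (D.Q *ᵥ x) ⬝ᵥ v = x ⬝ᵥ D.Q *ᵥ v := by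
    rw [dotProduct_comm, dotProduct_mulVec_comm D.isHermitian_Q]
  rw [logGrad, hM, totalGrad, sub_dotProduct, sum_dotProduct, smul_dotProduct, add_dotProduct,
    sum_dotProduct, hQ]
  simp only [relGrad, smul_dotProduct, h, add_dotProduct, smul_eq_mul, mul_add,
    Finset.sum_add_distrib, Finset.mul_sum]
  have : ∀ j, D.c j * (2 * Real.pi * ((A j *ᵥ (D.B j *ᵥ x)) ⬝ᵥ (D.B j *ᵥ v))) =
      2 * Real.pi * (D.c j * ((A j *ᵥ (D.B j *ᵥ x)) ⬝ᵥ (D.B j *ᵥ v))) := fun j => by ring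
  simp only [this]
  ring

theorem hasLineDerivAt_flowIntegrand (hA : ∀ j, (A j).PosDef) (hs : s ∈ Set.Icc (0 : ℝ) 1)
    (x v : Fin n → ℝ) : HasLineDerivAt ℝ (D.flowIntegrand X s)
      (D.flowIntegrand X s x * (D.logGrad X s x ⬝ᵥ v)) x v := by
  have h1 := HasDerivAt.fun_sum (u := Finset.univ) fun j _ =>
    (((X j).hasDerivAt_val_line (hA j) hs (D.B j *ᵥ x) (D.B j *ᵥ v)).log
      ((X j).val_pos (hA j) hs _).ne').const_mul (D.c j)
  have hl : HasDerivAt (fun t : ℝ => x + t • v) v 0 := by simpa using hasDerivAt_line x v 0 0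
  have h2 := (hl.dotProduct (hl.const_mulVec D.Q)).const_mul (-Real.pi)
  have h3 := (h2.add h1).exp
  have he : (fun t : ℝ => D.flowIntegrand X s (x + t • v)) = fun t : ℝ =>
      Real.exp (-Real.pi * ((x + t • v) ⬝ᵥ D.Q *ᵥ (x + t • v)) +
        ∑ j, D.c j * Real.log ((X j).val s (D.B j *ᵥ x + t • D.B j *ᵥ v))) := by
    funext t
    simp only [flowIntegrand, Matrix.mulVec_add, Matrix.mulVec_smul]
  rw [HasLineDerivAt, he]
  refine h3.congr_deriv ?_
  simp only [Pi.add_apply, zero_smul, add_zero]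
  rw [logGrad_dotProduct, flowIntegrand, dotProduct_mulVec_comm D.isHermitian_Q v x]
  congr 1
  congr 1
  · ring
  · refine Finset.sum_congr rfl fun j _ => ?_
    rw [mul_div_cancel_left₀ _ ((X j).val_pos (hA j) hs _).ne']

theorem hasDerivAt_field_line (hA : ∀ j, (A j).PosDef) (hs : s ∈ Set.Icc (0 : ℝ) 1)
    (x v : Fin n → ℝ) :
    HasDerivAt (fun t : ℝ => D.field X s (x + t • v)) (D.fieldDeriv X s x *ᵥ v) 0 := by
  have hrel : ∀ j, HasDerivAt (fun t : ℝ => D.relGrad X j s (x + t • v))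
      (((X j).hess s (D.B j *ᵥ x) + (2 * Real.pi) • A j) *ᵥ (D.B j *ᵥ v)) 0 := by
    intro j
    have h1 := (X j).hasDerivAt_grad_line (hA j) hs (D.B j *ᵥ x) (D.B j *ᵥ v)
    have h2 : HasDerivAt (fun t : ℝ => D.B j *ᵥ x + t • D.B j *ᵥ v) (D.B j *ᵥ v) 0 := by
      simpa using hasDerivAt_line (D.B j *ᵥ x) (D.B j *ᵥ v) 0 0
    have h3 := h1.add ((h2.const_mulVec (A j)).const_smul (2 * Real.pi))
    have he : (fun t : ℝ => D.relGrad X j s (x + t • v)) = fun t : ℝ =>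
        (X j).grad s (D.B j *ᵥ x + t • D.B j *ᵥ v) +
          (2 * Real.pi) • A j *ᵥ (D.B j *ᵥ x + t • D.B j *ᵥ v) := by
      funext t
      simp only [relGrad, Matrix.mulVec_add, Matrix.mulVec_smul]
    rw [he]
    refine h3.congr_deriv ?_
    rw [Matrix.add_mulVec, Matrix.smul_mulVec]
  have h := (HasDerivAt.fun_sum (u := Finset.univ) fun j _ =>
    ((hrel j).const_mulVec (D.B j)ᵀ).const_smul (D.c j))
  refine ((h.const_mulVec (D.Mtilde A)⁻¹).const_smul (2 * Real.pi)⁻¹).congr_deriv ?_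
  rw [fieldDeriv, Matrix.smul_mulVec, ← Matrix.mulVec_mulVec, Matrix.sum_mulVec]
  congr 2
  refine Finset.sum_congr rfl fun j _ => ?_
  rw [Matrix.smul_mulVec, ← Matrix.mulVec_mulVec, ← Matrix.mulVec_mulVec]

section Tame

variable (X)

theorem tame_totalRate (hA : ∀ j, (A j).PosDef) : Tame (D.totalRate X) :=
  Tame.sum _ fun j => (Tame.const _).mul (((X j).tame_rate (hA j)).comp_mulVec (D.B j))

theorem tame_relGrad (hA : ∀ j, (A j).PosDef) (j : Fin m) (a : Fin (D.dim j)) :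
    Tame fun s x => D.relGrad X j s x a := by
  simp only [relGrad, Pi.add_apply, Pi.smul_apply, smul_eq_mul]
  exact (((X j).tame_grad (hA j) a).comp_mulVec (D.B j)).add ((Tame.const _).mul
    (Tame.const_mulVec _ (Tame.const_mulVec _ Tame.coord) a))

theorem tame_totalGrad (hA : ∀ j, (A j).PosDef) (a : Fin n) :
    Tame fun s x => D.totalGrad X s x a := by
  simp only [totalGrad, Finset.sum_apply, Pi.smul_apply, smul_eq_mul]
  exact Tame.sum _ fun j => (Tame.const _).mul
    (Tame.const_mulVec _ (D.tame_relGrad X hA j) a)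

theorem tame_field (hA : ∀ j, (A j).PosDef) (a : Fin n) : Tame fun s x => D.field X s x a := by
  simp only [field, Pi.smul_apply, smul_eq_mul]
  exact (Tame.const _).mul (Tame.const_mulVec _ (D.tame_totalGrad X hA) a)

theorem tame_logGrad (hA : ∀ j, (A j).PosDef) (a : Fin n) :
    Tame fun s x => D.logGrad X s x a := by
  simp only [logGrad, Pi.sub_apply, Pi.smul_apply, smul_eq_mul]
  exact (D.tame_totalGrad X hA a).sub ((Tame.const _).mul (Tame.const_mulVec _ Tame.coord a))

theorem tame_fieldDeriv (hA : ∀ j, (A j).PosDef) (a b : Fin n) :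
    Tame fun s x => D.fieldDeriv X s x a b := by
  simp only [fieldDeriv, Matrix.smul_apply, smul_eq_mul]
  refine (Tame.const _).mul (Tame.matrix_mul (P := fun _ _ => (D.Mtilde A)⁻¹)
    (fun _ _ => Tame.const _) (fun a b => ?_) a b)
  simp only [Matrix.sum_apply, Matrix.smul_apply, smul_eq_mul]
  refine Tame.sum _ fun j => (Tame.const _).mul (Tame.matrix_mul
    (R := fun _ _ => D.B j) (Tame.matrix_mul (P := fun _ _ => (D.B j)ᵀ)
    (fun _ _ => Tame.const _) fun a b => ?_) (fun _ _ => Tame.const _) a b)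
  simp only [Matrix.add_apply]
  exact (((X j).tame_hess (hA j) a b).comp_mulVec (D.B j)).add (Tame.const _)

end Tame

/-- The pointwise inequality behind the monotonicity of the flow. -/
theorem flow_rate_nonneg (hD : D.Nondegenerate) (hA : A ∈ D.Lambda)
    (hS : ∀ j, (D.c j • (D.B j * (D.Mtilde A)⁻¹ * (D.B j)ᵀ - (A j)⁻¹)).PosSemidef)
    (hSG : ∀ j i, (D.c j • (D.B j * (D.Mtilde A)⁻¹ * (D.B j)ᵀ - (A j)⁻¹)) *
      ((X j).G i - A j) = 0)
    (hs : s ∈ Set.Icc (0 : ℝ) 1) (x : Fin n → ℝ) :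
    0 ≤ s * D.totalRate X s x + (D.fieldDeriv X s x).trace +
      D.field X s x ⬝ᵥ D.logGrad X s x := by
  set M := D.Mtilde A with hM
  set q := D.totalGrad X s x with hq
  have h1 : (D.fieldDeriv X s x).trace = ∑ j, D.c j * ((2 * Real.pi)⁻¹ *
      ((D.B j * M⁻¹ * (D.B j)ᵀ) * ((X j).hess s (D.B j *ᵥ x) + (2 * Real.pi) • A j)).trace) := by
    rw [fieldDeriv, Matrix.trace_smul, Finset.mul_sum, Matrix.trace_sum, smul_eq_mul,
      Finset.mul_sum]
    refine Finset.sum_congr rfl fun j _ => ?_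
    rw [Matrix.mul_smul, Matrix.trace_smul, smul_eq_mul, mul_left_comm, ← hM]
    congr 2
    rw [← Matrix.mul_assoc, Matrix.trace_mul_comm, ← Matrix.mul_assoc, ← Matrix.mul_assoc]
  have h2 : D.field X s x ⬝ᵥ D.logGrad X s x =
      (2 * Real.pi)⁻¹ * (q ⬝ᵥ M⁻¹ *ᵥ q) - ∑ j, D.c j * ((D.B j *ᵥ x) ⬝ᵥ D.relGrad X j s x) := by
    have e1 : (M⁻¹ *ᵥ q) ⬝ᵥ M *ᵥ x = x ⬝ᵥ q := by
      rw [dotProduct_mulVec_comm hA.2.isHermitian, mulVec_inv_cancel hA.2]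
    have e2 : x ⬝ᵥ q = ∑ j, D.c j * ((D.B j *ᵥ x) ⬝ᵥ D.relGrad X j s x) := by
      rw [hq, totalGrad, dotProduct_sum]
      refine Finset.sum_congr rfl fun j _ => ?_
      rw [dotProduct_smul, smul_eq_mul, dotProduct_mulVec_transpose]
    rw [field, logGrad, ← hq, ← hM, smul_dotProduct, dotProduct_sub, dotProduct_smul, e1, ← e2,
      smul_eq_mul, smul_eq_mul, dotProduct_comm (M⁻¹ *ᵥ q) q]
    have := Real.pi_ne_zero
    field_simp
  -- Non-degeneracy pays for the negative quadratic terms left by the one-input inequalities, which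
  -- are summed next.
  have h3 := hD.sum_le_quadratic_inv D hA fun j => D.relGrad X j s x
  have h4 := Finset.sum_le_sum fun j (_ : j ∈ Finset.univ) =>
    (X j).rate_add_trace_hess_ge (hA.1 j) hs (D.B j *ᵥ x) (D.c j) _ (hS j) (hSG j)
      (D.relGrad X j s x) rfl
  have h5 : ∑ j, -(D.c j * (2 * Real.pi)⁻¹ * (D.relGrad X j s x ⬝ᵥ (A j)⁻¹ *ᵥ D.relGrad X j s x)) =
      -((2 * Real.pi)⁻¹ * ∑ j, D.c j * (D.relGrad X j s x ⬝ᵥ (A j)⁻¹ *ᵥ D.relGrad X j s x)) := by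
    rw [Finset.mul_sum, ← Finset.sum_neg_distrib]
    exact Finset.sum_congr rfl fun j _ => by ring
  rw [h5] at h4
  have h6 : (2 * Real.pi)⁻¹ *
      ∑ j, D.c j * (D.relGrad X j s x ⬝ᵥ (A j)⁻¹ *ᵥ D.relGrad X j s x) ≤
      (2 * Real.pi)⁻¹ * (q ⬝ᵥ M⁻¹ *ᵥ q) :=
    mul_le_mul_of_nonneg_left h3 (by have := Real.pi_pos; positivity)
  rw [h1, h2, totalRate, Finset.mul_sum]
  have h7 : ∑ j, D.c j * (s * (X j).rate s (D.B j *ᵥ x) + (2 * Real.pi)⁻¹ *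
      ((D.B j * M⁻¹ * (D.B j)ᵀ) * ((X j).hess s (D.B j *ᵥ x) + (2 * Real.pi) • A j)).trace -
      (D.B j *ᵥ x) ⬝ᵥ D.relGrad X j s x) =
      ∑ j, s * (D.c j * (X j).rate s (D.B j *ᵥ x)) + ∑ j, D.c j * ((2 * Real.pi)⁻¹ *
      ((D.B j * M⁻¹ * (D.B j)ᵀ) * ((X j).hess s (D.B j *ᵥ x) + (2 * Real.pi) • A j)).trace) -
      ∑ j, D.c j * ((D.B j *ᵥ x) ⬝ᵥ D.relGrad X j s x) := by
    rw [← Finset.sum_add_distrib, ← Finset.sum_sub_distrib]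
    exact Finset.sum_congr rfl fun j _ => by ring
  rw [h7] at h4
  linarith

section Monotone

variable (X)
variable (hA : A ∈ D.Lambda)
  (hX : ∀ j, D.c j < 0 → ∃ i, 0 < (X j).w i ∧ (X j).G i = A j ∧ (X j).z i = 0)
include hA hX

theorem integrable_flowIntegrand_mul {ψ : ℝ → (Fin n → ℝ) → ℝ} (hψ : Tame ψ)
    (hs : s ∈ Set.Icc (0 : ℝ) 1) : Integrable fun x => D.flowIntegrand X s x * ψ s x := by
  obtain ⟨C, δ, hC, hδ, h⟩ := D.exists_flowIntegrand_le hA hX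
  obtain ⟨C', h'⟩ := hψ.exists_dominating hδ hC h
  exact ((integrable_exp_neg_norm_sq (half_pos hδ)).const_mul C').mono'
    ((D.continuous_flowIntegrand hA.1 hs).mul (hψ.1 s hs)).aestronglyMeasurable
    (Filter.Eventually.of_forall fun x => h' s hs x)

theorem integrable_flowIntegrand (hs : s ∈ Set.Icc (0 : ℝ) 1) :
    Integrable (D.flowIntegrand X s) := by
  simpa using D.integrable_flowIntegrand_mul X hA hX (Tame.const 1) hs

/-- The integrand is div(F_s V). Each coordinate contributes a directional derivative of an
integrable function, so no boundary term occurs. -/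
theorem integral_div_field_eq_zero (hs : s ∈ Set.Icc (0 : ℝ) 1) :
    ∫ x, D.flowIntegrand X s x *
      ((D.fieldDeriv X s x).trace + D.field X s x ⬝ᵥ D.logGrad X s x) = 0 := by
  have hcomp : ∀ a : Fin n, ∫ x, D.flowIntegrand X s x *
      (D.fieldDeriv X s x a a + D.field X s x a * D.logGrad X s x a) = 0 := by
    intro a
    have ht : Tame fun s x => D.fieldDeriv X s x a a + D.field X s x a * D.logGrad X s x a :=
      (D.tame_fieldDeriv X hA.1 a a).add ((D.tame_field X hA.1 a).mul (D.tame_logGrad X hA.1 a))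
    refine integral_eq_zero_of_hasLineDerivAt (v := Pi.single a 1)
      (D.integrable_flowIntegrand_mul X hA hX (D.tame_field X hA.1 a) hs)
      (D.integrable_flowIntegrand_mul X hA hX ht hs) fun x => ?_
    have h1 := D.hasLineDerivAt_flowIntegrand (X := X) hA.1 hs x (Pi.single a 1)
    have h2 := hasDerivAt_pi.1 (D.hasDerivAt_field_line (X := X) hA.1 hs x (Pi.single a 1)) a
    refine (HasDerivAt.mul h1 h2).congr_deriv ?_
    simp only [zero_smul, add_zero]
    rw [dotProduct_single, mul_one, Matrix.mulVec_single_one]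
    simp only [Matrix.col_apply]
    ring
  have hsum : ∀ x, D.flowIntegrand X s x *
      ((D.fieldDeriv X s x).trace + D.field X s x ⬝ᵥ D.logGrad X s x) =
      ∑ a, D.flowIntegrand X s x *
        (D.fieldDeriv X s x a a + D.field X s x a * D.logGrad X s x a) := by
    intro x
    rw [← Finset.mul_sum, Finset.sum_add_distrib]
    rfl
  simp only [hsum]
  rw [integral_finsetSum _ fun a _ => D.integrable_flowIntegrand_mul X hA hX
    ((D.tame_fieldDeriv X hA.1 a a).add
      ((D.tame_field X hA.1 a).mul (D.tame_logGrad X hA.1 a))) hs]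
  exact Finset.sum_eq_zero fun a _ => hcomp a

theorem hasDerivAt_integral_flowIntegrand (hs : s ∈ Set.Ioo (0 : ℝ) 1) :
    HasDerivAt (fun s => ∫ x, D.flowIntegrand X s x)
      (∫ x, D.flowIntegrand X s x * D.totalRate X s x) s := by
  obtain ⟨C, δ, hC, hδ, h⟩ := D.exists_flowIntegrand_le hA hX
  obtain ⟨C', h'⟩ := (D.tame_totalRate X hA.1).exists_dominating hδ hC h
  have hsub : Set.Ioo (0 : ℝ) 1 ⊆ Set.Icc 0 1 := Set.Ioo_subset_Icc_self
  refine (hasDerivAt_integral_of_dominated_loc_of_deriv_le (F := fun s => D.flowIntegrand X s)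
    (F' := fun s x => D.flowIntegrand X s x * D.totalRate X s x)
    (bound := fun x => C' * Real.exp (-(δ / 2) * ‖x‖ ^ 2)) (Ioo_mem_nhds hs.1 hs.2) ?_ ?_ ?_ ?_ ?_
    ?_).2
  · filter_upwards [Ioo_mem_nhds hs.1 hs.2] with t ht
    exact (D.continuous_flowIntegrand hA.1 (hsub ht)).aestronglyMeasurable
  · exact D.integrable_flowIntegrand X hA hX (hsub hs)
  · exact (D.integrable_flowIntegrand_mul X hA hX (D.tame_totalRate X hA.1)
      (hsub hs)).aestronglyMeasurable
  · exact Filter.Eventually.of_forall fun x t ht => h' t (hsub ht) x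
  · exact (integrable_exp_neg_norm_sq (half_pos hδ)).const_mul C'
  · exact Filter.Eventually.of_forall fun x t ht =>
      D.hasDerivAt_flowIntegrand hA.1 (hsub ht) x

theorem continuousOn_integral_flowIntegrand :
    ContinuousOn (fun s => ∫ x, D.flowIntegrand X s x) (Set.Icc 0 1) := by
  obtain ⟨C, δ, hC, hδ, h⟩ := D.exists_flowIntegrand_le hA hX
  refine continuousOn_of_dominated (bound := fun x => C * Real.exp (-δ * ‖x‖ ^ 2))
    (fun s hs => (D.continuous_flowIntegrand hA.1 hs).aestronglyMeasurable)
    (fun s hs => Filter.Eventually.of_forall fun x => h s hs x)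
    ((integrable_exp_neg_norm_sq hδ).const_mul C)
    (Filter.Eventually.of_forall fun x s hs => ?_)
  exact (D.hasDerivAt_flowIntegrand hA.1 hs x).continuousAt.continuousWithinAt

theorem integral_flowIntegrand_zero_le_one (hD : D.Nondegenerate)
    (hS : ∀ j, (D.c j • (D.B j * (D.Mtilde A)⁻¹ * (D.B j)ᵀ - (A j)⁻¹)).PosSemidef)
    (hSG : ∀ j i, (D.c j • (D.B j * (D.Mtilde A)⁻¹ * (D.B j)ᵀ - (A j)⁻¹)) *
      ((X j).G i - A j) = 0) :
    ∫ x, D.flowIntegrand X 0 x ≤ ∫ x, D.flowIntegrand X 1 x := by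
  have hmono : MonotoneOn (fun s => ∫ x, D.flowIntegrand X s x) (Set.Icc 0 1) := by
    refine monotoneOn_of_deriv_nonneg (convex_Icc 0 1)
      (D.continuousOn_integral_flowIntegrand X hA hX) ?_ ?_
    · rw [interior_Icc]
      exact fun s hs =>
        (D.hasDerivAt_integral_flowIntegrand X hA hX hs).differentiableAt.differentiableWithinAt
    · rw [interior_Icc]
      intro s hs
      have hs' : s ∈ Set.Icc (0 : ℝ) 1 := Set.Ioo_subset_Icc_self hs
      rw [(D.hasDerivAt_integral_flowIntegrand X hA hX hs).deriv]
      -- The evolution equation gives s ∂_s rather than ∂_s; on the open interval dividing by s is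
      -- harmless.
      refine nonneg_of_mul_nonneg_right ?_ hs.1
      have h1 := D.integrable_flowIntegrand_mul X hA hX (D.tame_totalRate X hA.1) hs'
      have h2 := D.integrable_flowIntegrand_mul X hA hX ((Tame.trace (D.tame_fieldDeriv X hA.1)).add
        (Tame.dotProduct (D.tame_field X hA.1) (D.tame_logGrad X hA.1))) hs'
      have h3 : s * ∫ x, D.flowIntegrand X s x * D.totalRate X s x =
          ∫ x, D.flowIntegrand X s x * (s * D.totalRate X s x + (D.fieldDeriv X s x).trace +
            D.field X s x ⬝ᵥ D.logGrad X s x) := by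
        rw [← integral_const_mul, ← add_zero (∫ x, s * _),
          ← D.integral_div_field_eq_zero X hA hX hs', ← integral_add (h1.const_mul s) h2]
        congr 1
        funext x
        ring
      rw [h3]
      exact integral_nonneg fun x => mul_nonneg (D.flowIntegrand_pos x).le
        (D.flow_rate_nonneg hD hA hS hSG hs' x)
  exact hmono (by simp) (by simp) zero_le_one

end Monotone

end Datum

/-! ### Smoothed measures and their approximation by finite mixtures. -/

section Smoothed

variable {k : ℕ}

theorem gaussian_le {G : Matrix (Fin k) (Fin k) ℝ} (hG : G.PosDef) (x : Fin k → ℝ) :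
    gaussian G x ≤ Real.sqrt G.det := by
  rw [gaussian]
  refine mul_le_of_le_one_right (Real.sqrt_nonneg _) (Real.exp_le_one_iff.2 ?_)
  nlinarith [Real.pi_pos, hG.posSemidef.quadratic_nonneg x]

theorem integrable_gaussian_sub {G : Matrix (Fin k) (Fin k) ℝ} (hG : G.PosDef)
    (ν : Measure (Fin k → ℝ)) [IsFiniteMeasure ν] {T : (Fin k → ℝ) → Fin k → ℝ}
    (hT : Measurable T) (y : Fin k → ℝ) : Integrable (fun z => gaussian G (y - T z)) ν := by
  refine (integrable_const (Real.sqrt G.det)).mono'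
    ((continuous_gaussian G).measurable.comp (measurable_const.sub hT)).aestronglyMeasurable
    (Filter.Eventually.of_forall fun z => ?_)
  rw [Real.norm_of_nonneg (gaussian_pos hG _).le]
  exact gaussian_le hG _

/-- A multiple of `g_A` plus the `g_G`-smoothing of the image of `ν` under `T`. -/
def smoothed (A G : Matrix (Fin k) (Fin k) ℝ) (ε : ℝ) (ν : Measure (Fin k → ℝ))
    (T : (Fin k → ℝ) → Fin k → ℝ) (y : Fin k → ℝ) : ℝ :=
  ε * gaussian A y + ∫ z, gaussian G (y - T z) ∂ν

variable {A G : Matrix (Fin k) (Fin k) ℝ} {ε : ℝ} {ν : Measure (Fin k → ℝ)}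
  {T : (Fin k → ℝ) → Fin k → ℝ}

theorem smoothed_nonneg (hA : A.PosDef) (hG : G.PosDef) (hε : 0 ≤ ε) (y : Fin k → ℝ) :
    0 ≤ smoothed A G ε ν T y :=
  add_nonneg (mul_nonneg hε (gaussian_pos hA y).le)
    (integral_nonneg fun _ => (gaussian_pos hG _).le)

theorem smoothed_pos (hA : A.PosDef) (hG : G.PosDef) (hε : 0 < ε) (y : Fin k → ℝ) :
    0 < smoothed A G ε ν T y :=
  add_pos_of_pos_of_nonneg (mul_pos hε (gaussian_pos hA y))
    (integral_nonneg fun _ => (gaussian_pos hG _).le)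

theorem integral_gaussian_sub_pos (hG : G.PosDef) [IsFiniteMeasure ν] (hν : ν ≠ 0)
    (hT : Measurable T) (y : Fin k → ℝ) : 0 < ∫ z, gaussian G (y - T z) ∂ν := by
  rw [integral_pos_iff_support_of_nonneg (fun z => (gaussian_pos hG _).le)
    (integrable_gaussian_sub hG ν hT y)]
  have : Function.support (fun z => gaussian G (y - T z)) = Set.univ :=
    Set.eq_univ_of_forall fun z => (gaussian_pos hG _).ne'
  rw [this]
  exact (Measure.measure_univ_pos).2 hν

theorem continuous_smoothed (hG : G.PosDef) [IsFiniteMeasure ν] (hT : Measurable T) :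
    Continuous (smoothed A G ε ν T) := by
  refine (continuous_const.mul (continuous_gaussian A)).add ?_
  refine continuous_of_dominated (bound := fun _ => Real.sqrt G.det)
    (fun y => (integrable_gaussian_sub hG ν hT y).aestronglyMeasurable) ?_ (integrable_const _) ?_
  · refine fun y => Filter.Eventually.of_forall fun z => ?_
    rw [Real.norm_of_nonneg (gaussian_pos hG _).le]
    exact gaussian_le hG _
  · exact Filter.Eventually.of_forall fun z =>
      (continuous_gaussian G).comp (continuous_id.sub continuous_const)

theorem tendsto_smoothed (hG : G.PosDef) [IsFiniteMeasure ν] {T : ℕ → (Fin k → ℝ) → Fin k → ℝ}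
    (hT : ∀ i, Measurable (T i))
    (hlim : ∀ z, Filter.Tendsto (fun i => T i z) Filter.atTop (nhds z)) (y : Fin k → ℝ) :
    Filter.Tendsto (fun i => smoothed A G ε ν (T i) y) Filter.atTop
      (nhds (smoothed A G ε ν id y)) := by
  refine tendsto_const_nhds.add (tendsto_integral_of_dominated_convergence
    (fun _ => Real.sqrt G.det) (fun i => (integrable_gaussian_sub hG ν (hT i) y).aestronglyMeasurable)
    (integrable_const _) (fun i => Filter.Eventually.of_forall fun z => ?_)
    (Filter.Eventually.of_forall fun z => ?_))
  · rw [Real.norm_of_nonneg (gaussian_pos hG _).le]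
    exact gaussian_le hG _
  · exact ((continuous_gaussian G).tendsto _).comp (tendsto_const_nhds.sub (hlim z))

/-- Bounded support keeps the centres bounded. The uniformity over maps with ‖T z‖ ≤ 2‖z‖ covers the
identity and all its simple approximations by one dominating function. -/
theorem exists_smoothed_le (hA : A.PosDef) (hG : G.PosDef) (h : A ≤ G) (hε : 0 ≤ ε)
    [IsFiniteMeasure ν] {R : ℝ} (hR : ∀ᵐ z ∂ν, ‖z‖ ≤ R) :
    ∃ K : ℝ, 0 ≤ K ∧ ∀ T : (Fin k → ℝ) → Fin k → ℝ, Measurable T → (∀ z, ‖T z‖ ≤ 2 * ‖z‖) →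
      ∀ y, smoothed A G ε ν T y ≤ K * Real.exp (-Real.pi * (y ⬝ᵥ A *ᵥ y) + K * ‖y‖) := by
  obtain ⟨b, hb, hAb⟩ := Tame.exists_norm_mulVec_le A
  set r := 2 * Real.pi * (k * (b * (2 * |R|))) with hr
  have hr0 : 0 ≤ r := by have := Real.pi_pos; positivity
  set K := ε * Real.sqrt A.det + Real.sqrt G.det * ν.real Set.univ + r with hK
  have hK0 : 0 ≤ K := by positivity
  refine ⟨K, hK0, fun T hT hTz y => ?_⟩
  set E := Real.exp (-Real.pi * (y ⬝ᵥ A *ᵥ y) + K * ‖y‖) with hE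
  have hrK : r ≤ K := by
    rw [hK]
    have : 0 ≤ ε * Real.sqrt A.det + Real.sqrt G.det * ν.real Set.univ := by positivity
    linarith
  have h1 : gaussian A y ≤ Real.sqrt A.det * E := by
    rw [gaussian, hE]
    gcongr
    have : 0 ≤ K * ‖y‖ := by positivity
    linarith
  have h2 : ∀ᵐ z ∂ν, ‖gaussian G (y - T z)‖ ≤ Real.sqrt G.det * E := by
    filter_upwards [hR] with z hz
    rw [Real.norm_of_nonneg (gaussian_pos hG _).le]
    refine (gaussian_sub_le hA h y (T z)).trans ?_
    refine mul_le_mul_of_nonneg_left (Real.exp_le_exp.2 ?_) (Real.sqrt_nonneg _)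
    have h3 : ∑ a, |(A *ᵥ T z) a| ≤ k * (b * (2 * |R|)) := by
      calc ∑ a, |(A *ᵥ T z) a| ≤ ∑ _a : Fin k, b * (2 * |R|) := by
            refine Finset.sum_le_sum fun a _ => (norm_le_pi_norm (A *ᵥ T z) a).trans
              ((hAb _).trans ?_)
            refine mul_le_mul_of_nonneg_left ((hTz z).trans ?_) hb
            linarith [le_abs_self R]
        _ = k * (b * (2 * |R|)) := by simp
    have h4 : 2 * Real.pi * ∑ a, |(A *ᵥ T z) a| ≤ K :=
      (mul_le_mul_of_nonneg_left h3 (by have := Real.pi_pos; positivity)).trans hrK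
    have := mul_le_mul_of_nonneg_right h4 (norm_nonneg y)
    linarith
  have h5 := (le_abs_self _).trans (norm_integral_le_of_norm_le_const h2)
  have hE0 : 0 ≤ E := (Real.exp_pos _).le
  calc smoothed A G ε ν T y ≤ ε * (Real.sqrt A.det * E) + Real.sqrt G.det * E * ν.real Set.univ :=
        add_le_add (mul_le_mul_of_nonneg_left h1 hε) h5
    _ = (ε * Real.sqrt A.det + Real.sqrt G.det * ν.real Set.univ) * E := by ring
    _ ≤ K * E := by
        gcongr
        rw [hK]
        linarith

theorem exists_smoothed_rpow_le (hA : A.PosDef) (hG : G.PosDef) (h : A ≤ G) (hε : 0 ≤ ε)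
    [IsFiniteMeasure ν] {c : ℝ} (hc : c ≠ 0) (hneg : c < 0 → 0 < ε)
    (hpos : 0 < c → ∃ R : ℝ, ∀ᵐ z ∂ν, ‖z‖ ≤ R) :
    ∃ K : ℝ, 0 ≤ K ∧ ∀ T : (Fin k → ℝ) → Fin k → ℝ, Measurable T → (∀ z, ‖T z‖ ≤ 2 * ‖z‖) →
      ∀ y, smoothed A G ε ν T y ^ c ≤
        K * Real.exp (-Real.pi * (c * (y ⬝ᵥ A *ᵥ y)) + K * ‖y‖) := by
  rcases hc.lt_or_gt with hc | hc
  · have hκ : 0 < ε * Real.sqrt A.det := mul_pos (hneg hc) (Real.sqrt_pos.2 hA.det_pos)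
    refine ⟨(ε * Real.sqrt A.det) ^ c, by positivity, fun T hT hTz y =>
      rpow_le_of_mul_exp_le hc hκ (norm_nonneg y) ?_⟩
    rw [smoothed, gaussian, ← mul_assoc]
    exact le_add_of_nonneg_right (integral_nonneg fun _ => (gaussian_pos hG _).le)
  · obtain ⟨R, hR⟩ := hpos hc
    obtain ⟨K, hK, hle⟩ := exists_smoothed_le hA hG h hε hR
    exact ⟨K ^ c + c * K, by positivity, fun T hT hTz y =>
      rpow_le_of_le_mul_exp hc (smoothed_nonneg hA hG hε y) hK (norm_nonneg y) (hle T hT hTz y)⟩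

theorem integral_comp_simpleFunc {E : Type*} [MeasurableSpace E] (ν : Measure E)
    [IsFiniteMeasure ν] (T : SimpleFunc E E) {h : E → ℝ} (h0 : ∀ x, 0 ≤ h x) :
    ∫ z, h (T z) ∂ν = ∑ x ∈ T.range, ν.real (T ⁻¹' {x}) * h x := by
  rw [integral_eq_lintegral_of_nonneg_ae (Filter.Eventually.of_forall fun z => h0 _)
    ((T.map h).measurable.aestronglyMeasurable)]
  have h1 : ∫⁻ z, ENNReal.ofReal (h (T z)) ∂ν =
      ∑ x ∈ T.range, ENNReal.ofReal (h x) * ν (T ⁻¹' {x}) := by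
    rw [← SimpleFunc.map_lintegral (fun x => ENNReal.ofReal (h x)), ← SimpleFunc.lintegral_eq_lintegral]
    rfl
  rw [h1, ENNReal.toReal_sum fun x _ =>
    ENNReal.mul_ne_top ENNReal.ofReal_ne_top (measure_ne_top _ _)]
  refine Finset.sum_congr rfl fun x _ => ?_
  rw [ENNReal.toReal_mul, ENNReal.toReal_ofReal (h0 x), mul_comm]
  rfl

/-- The finite mixture obtained by smoothing the image of `ν` under a simple function. -/
def simpleMixture (hA : A.PosDef) (hG : G.PosDef) (h : A ≤ G) (hε : 0 ≤ ε)
    (ν : Measure (Fin k → ℝ)) [IsFiniteMeasure ν]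
    (T : SimpleFunc (Fin k → ℝ) (Fin k → ℝ)) (hpos : 0 < ε + ν.real Set.univ) : Mixture A where
  -- The index `none` carries the stationary component ε g_A; the others are the atoms of the image
  -- measure.
  ι := Option {x // x ∈ T.range}
  w := fun i => i.elim ε fun x => ν.real (T ⁻¹' {x.1})
  G := fun i => i.elim A fun _ => G
  z := fun i => i.elim 0 fun x => x.1
  w_nonneg := by
    rintro (_ | x)
    · exact hε
    · exact measureReal_nonneg
  exists_w_pos := by
    by_contra! hcon
    have h1 : ε = 0 := le_antisymm (hcon none) hε
    have h2 : ν.real Set.univ = ∑ x ∈ T.range, ν.real (T ⁻¹' {x}) := by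
      simpa using integral_comp_simpleFunc ν T (h := fun _ => (1 : ℝ)) fun _ => zero_le_one
    have h3 : ν.real Set.univ ≤ 0 := by
      rw [h2]
      exact Finset.sum_nonpos fun x hx => hcon (some ⟨x, hx⟩)
    linarith
  posDef := by
    rintro (_ | x)
    · exact hA
    · exact hG
  le := by
    rintro (_ | x)
    · exact le_rfl
    · exact h

variable (hA : A.PosDef) (hG : G.PosDef) (h : A ≤ G) (hε : 0 ≤ ε) [IsFiniteMeasure ν]
  (T : SimpleFunc (Fin k → ℝ) (Fin k → ℝ)) (hpos : 0 < ε + ν.real Set.univ)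

theorem simpleMixture_mass : (simpleMixture hA hG h hε ν T hpos).mass = ε + ν.real Set.univ := by
  have h2 : ν.real Set.univ = ∑ x ∈ T.range, ν.real (T ⁻¹' {x}) := by
    simpa using integral_comp_simpleFunc ν T (h := fun _ => (1 : ℝ)) fun _ => zero_le_one
  rw [h2, ← Finset.sum_coe_sort]
  exact Fintype.sum_option _

theorem simpleMixture_val_one (y : Fin k → ℝ) :
    (simpleMixture hA hG h hε ν T hpos).val 1 y = smoothed A G ε ν T y := by
  rw [smoothed, integral_comp_simpleFunc ν T (h := fun z => gaussian G (y - z))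
    fun z => (gaussian_pos hG _).le, ← Finset.sum_coe_sort]
  have e : ∀ i, (simpleMixture hA hG h hε ν T hpos).term i 1 y =
      gaussian ((simpleMixture hA hG h hε ν T hpos).G i)
        (y - (simpleMixture hA hG h hε ν T hpos).z i) := by
    intro i
    rw [Mixture.term, flowPrec_one (Mixture.posDef _ i), one_smul]
  simp only [Mixture.val, e]
  refine (Fintype.sum_option _).trans ?_
  simp [simpleMixture]

end Smoothed

/-! ### From mixtures to smoothed measures. -/

namespace Datum

variable {m n : ℕ} (D : Datum m n) {A : D.MatrixTuple}

/-- The value of the Brascamp--Lieb functional at a gaussian input with `M̃(A) > 0`. -/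
def gaussianValue (A : D.MatrixTuple) : ℝ :=
  Real.exp ((∑ j, D.c j * Real.log (A j).det - Real.log (D.Mtilde A).det) / 2)

theorem integral_flowIntegrand_zero (hA : A ∈ D.Lambda) (X : (j : Fin m) → Mixture (A j)) :
    ∫ x, D.flowIntegrand X 0 x = D.gaussianValue A * ∏ j, (X j).mass ^ D.c j := by
  have h0 : (0 : ℝ) ∈ Set.Icc (0 : ℝ) 1 := by simp
  have h1 : ∀ x, D.flowIntegrand X 0 x = ((∏ j, (X j).mass ^ D.c j) *
      Real.exp ((∑ j, D.c j * Real.log (A j).det) / 2)) *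
        Real.exp (-Real.pi * (x ⬝ᵥ D.Mtilde A *ᵥ x)) := by
    intro x
    rw [D.flowIntegrand_eq hA.1 h0, mul_assoc, ← D.prod_gaussian_rpow hA.1, mul_left_comm,
      ← Finset.prod_mul_distrib]
    congr 1
    refine Finset.prod_congr rfl fun j _ => ?_
    rw [(X j).val_zero (hA.1 j), Real.mul_rpow (X j).mass_pos.le (gaussian_pos (hA.1 j) _).le]
  have h2 : ∫ x : Fin n → ℝ, Real.exp (-Real.pi * (x ⬝ᵥ D.Mtilde A *ᵥ x)) =
      (Real.sqrt (D.Mtilde A).det)⁻¹ := by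
    rw [integral_eq_lintegral_of_nonneg_ae (Filter.Eventually.of_forall fun _ => (Real.exp_pos _).le)
      (integrable_exp_neg_quadratic hA.2).aestronglyMeasurable, lintegral_exp_neg_quadratic hA.2,
      ENNReal.toReal_ofReal (by positivity)]
  simp only [h1]
  rw [integral_const_mul, h2, gaussianValue, sub_div, Real.exp_sub,
    ← Real.log_sqrt hA.2.det_pos.le, Real.exp_log (Real.sqrt_pos.2 hA.2.det_pos)]
  ring

end Datum

namespace GenDatum

variable {m n : ℕ} (D : GenDatum m n) {A : D.MatrixTuple}

theorem comparison_of_stationary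
    (h : ∀ j, D.c j • ((A j)⁻¹ - D.B j * (D.Mtilde A)⁻¹ * (D.B j)ᵀ) ≤ 0 ∧
      ((A j)⁻¹ - D.B j * (D.Mtilde A)⁻¹ * (D.B j)ᵀ) * (D.G j - A j) = 0) (j : Fin m) :
    (D.c j • (D.B j * (D.Mtilde A)⁻¹ * (D.B j)ᵀ - (A j)⁻¹)).PosSemidef ∧
      (D.c j • (D.B j * (D.Mtilde A)⁻¹ * (D.B j)ᵀ - (A j)⁻¹)) * (D.G j - A j) = 0 := by
  obtain ⟨h1, h2⟩ := h j
  have e : D.c j • (D.B j * (D.Mtilde A)⁻¹ * (D.B j)ᵀ - (A j)⁻¹) =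
      -(D.c j • ((A j)⁻¹ - D.B j * (D.Mtilde A)⁻¹ * (D.B j)ᵀ)) := by
    rw [← smul_neg, neg_sub]
  rw [e]
  refine ⟨?_, by rw [Matrix.neg_mul, Matrix.smul_mul, h2, smul_zero, neg_zero]⟩
  rw [Matrix.le_iff, zero_sub] at h1
  exact h1

variable (hD : D.Nondegenerate) (hA : A ∈ D.Lambda) (hAG : ∀ j, A j ≤ D.G j)
  (hst : ∀ j, D.c j • ((A j)⁻¹ - D.B j * (D.Mtilde A)⁻¹ * (D.B j)ᵀ) ≤ 0 ∧
      ((A j)⁻¹ - D.B j * (D.Mtilde A)⁻¹ * (D.B j)ᵀ) * (D.G j - A j) = 0)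
include hD hA hAG hst

/-- Simple images of ν give finite mixtures, to which the flow applies. Their masses do not depend
on the approximation, so only the integral has to converge. -/
theorem gaussianValue_le_integral_smoothed
    {ε : Fin m → ℝ} (hε : ∀ j, 0 ≤ ε j) (hneg : ∀ j, D.c j < 0 → 0 < ε j)
    {ν : (j : Fin m) → Measure (Fin (D.dim j) → ℝ)} [∀ j, IsFiniteMeasure (ν j)]
    (hpos : ∀ j, 0 < ε j + (ν j).real Set.univ)
    (hbdd : ∀ j, 0 < D.c j → ∃ R : ℝ, ∀ᵐ z ∂ν j, ‖z‖ ≤ R) :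
    Integrable (fun x : Fin n → ℝ => Real.exp (-Real.pi * (x ⬝ᵥ D.Q *ᵥ x)) *
      ∏ j, smoothed (A j) (D.G j) (ε j) (ν j) id (D.B j *ᵥ x) ^ D.c j) ∧
    D.gaussianValue A * ∏ j, (ε j + (ν j).real Set.univ) ^ D.c j ≤
      ∫ x : Fin n → ℝ, Real.exp (-Real.pi * (x ⬝ᵥ D.Q *ᵥ x)) *
        ∏ j, smoothed (A j) (D.G j) (ε j) (ν j) id (D.B j *ᵥ x) ^ D.c j := by
  have hG := D.posDef_G
  choose K hK hle using fun j => exists_smoothed_rpow_le (ν := ν j) (hA.1 j) (hG j) (hAG j) (hε j)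
    (D.c_ne_zero j) (hneg j) (hbdd j)
  obtain ⟨C, δ, hC, hδ, hdom⟩ := D.exists_gaussian_dominating hA
    (K := ∑ j, K j) (Finset.sum_nonneg fun j _ => hK j)
  have hbound : ∀ T : (j : Fin m) → (Fin (D.dim j) → ℝ) → Fin (D.dim j) → ℝ,
      (∀ j, Measurable (T j)) → (∀ j z, ‖T j z‖ ≤ 2 * ‖z‖) → ∀ x : Fin n → ℝ,
      ‖Real.exp (-Real.pi * (x ⬝ᵥ D.Q *ᵥ x)) *
        ∏ j, smoothed (A j) (D.G j) (ε j) (ν j) (T j) (D.B j *ᵥ x) ^ D.c j‖ ≤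
        C * Real.exp (-δ * ‖x‖ ^ 2) := by
    intro T hT hTz x
    have hnn : ∀ j y, 0 ≤ smoothed (A j) (D.G j) (ε j) (ν j) (T j) y :=
      fun j y => smoothed_nonneg (hA.1 j) (hG j) (hε j) y
    rw [Real.norm_of_nonneg (mul_nonneg (Real.exp_pos _).le
      (Finset.prod_nonneg fun j _ => Real.rpow_nonneg (hnn j _) _))]
    exact hdom (fun j => smoothed (A j) (D.G j) (ε j) (ν j) (T j)) hnn
      (fun j y => (hle j (T j) (hT j) (hTz j) y).trans (mul_exp_le_mul_exp (hK j)
        (Finset.single_le_sum (fun j _ => hK j) (Finset.mem_univ j)) (norm_nonneg y))) x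
  -- The condition for continuity of the real power; for c_j > 0 the base may vanish, since ν_j may
  -- be zero off the total-mass assumption at a fixed ε.
  have hne : ∀ j T y, smoothed (A j) (D.G j) (ε j) (ν j) T y ≠ 0 ∨ 0 ≤ D.c j := by
    intro j T y
    rcases (D.c_ne_zero j).lt_or_gt with hc | hc
    · exact Or.inl (smoothed_pos (hA.1 j) (hG j) (hneg j hc) y).ne'
    · exact Or.inr hc.le
  have hcont : ∀ T : (j : Fin m) → (Fin (D.dim j) → ℝ) → Fin (D.dim j) → ℝ,
      (∀ j, Measurable (T j)) → Continuous fun x : Fin n → ℝ =>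
        Real.exp (-Real.pi * (x ⬝ᵥ D.Q *ᵥ x)) *
        ∏ j, smoothed (A j) (D.G j) (ε j) (ν j) (T j) (D.B j *ᵥ x) ^ D.c j := by
    intro T hT
    refine (by fun_prop : Continuous fun x : Fin n → ℝ =>
      Real.exp (-Real.pi * (x ⬝ᵥ D.Q *ᵥ x))).mul (continuous_finsetProd _ fun j _ => ?_)
    exact ((continuous_smoothed (hG j) (hT j)).comp (by fun_prop)).rpow_const fun x => hne j _ _
  have hdomint := (integrable_exp_neg_norm_sq (n := n) hδ).const_mul C
  refine ⟨hdomint.mono' (hcont (fun _ => id) fun _ => measurable_id).aestronglyMeasurable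
    (Filter.Eventually.of_forall (hbound (fun _ => id) (fun _ => measurable_id)
      fun j z => by simp only [id]; linarith [norm_nonneg z])), ?_⟩
  set T : (i : ℕ) → (j : Fin m) → SimpleFunc (Fin (D.dim j) → ℝ) (Fin (D.dim j) → ℝ) :=
    fun i j => SimpleFunc.approxOn id measurable_id Set.univ 0 (Set.mem_univ 0) i with hTdef
  have hTm : ∀ i j, Measurable (T i j) := fun i j => (T i j).measurable
  have hTn : ∀ i j z, ‖T i j z‖ ≤ 2 * ‖z‖ := fun i j z => by
    have := SimpleFunc.norm_approxOn_zero_le (measurable_id (α := Fin (D.dim j) → ℝ))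
      (Set.mem_univ 0) z i
    rw [two_mul]
    exact this
  have hTlim : ∀ j z, Filter.Tendsto (fun i => T i j z) Filter.atTop (nhds z) := fun j z =>
    SimpleFunc.tendsto_approxOn measurable_id (Set.mem_univ 0) (by simp)
  have hlim := tendsto_integral_of_dominated_convergence (μ := (volume : Measure (Fin n → ℝ)))
    (F := fun i x => Real.exp (-Real.pi * (x ⬝ᵥ D.Q *ᵥ x)) *
        ∏ j, smoothed (A j) (D.G j) (ε j) (ν j) (T i j) (D.B j *ᵥ x) ^ D.c j)
    (f := fun x => Real.exp (-Real.pi * (x ⬝ᵥ D.Q *ᵥ x)) *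
        ∏ j, smoothed (A j) (D.G j) (ε j) (ν j) id (D.B j *ᵥ x) ^ D.c j)
    (fun x => C * Real.exp (-δ * ‖x‖ ^ 2))
    (fun i => (hcont (fun j => T i j) (hTm i)).aestronglyMeasurable) hdomint
    (fun i => Filter.Eventually.of_forall (hbound (fun j => T i j) (hTm i) (hTn i)))
    (Filter.Eventually.of_forall fun x => tendsto_const_nhds.mul
      (tendsto_finsetProd _ fun j _ => (tendsto_smoothed (hG j) (fun i => hTm i j) (hTlim j)
        (D.B j *ᵥ x)).rpow_const (hne j _ _)))
  refine ge_of_tendsto' hlim fun i => ?_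
  set X : (j : Fin m) → Mixture (A j) := fun j =>
    simpleMixture (hA.1 j) (hG j) (hAG j) (hε j) (ν j) (T i j) (hpos j) with hX
  -- Slackness is needed for every component's precision: it is trivial for the added g_{A_j} and is
  -- hypothesis `hst` for the others.
  have hmono := D.integral_flowIntegrand_zero_le_one X hA
    (fun j hc => ⟨none, hneg j hc, rfl, rfl⟩) hD.1
    (fun j => (D.comparison_of_stationary hst j).1)
    (fun j i => by
      rcases i with _ | x
      · change _ * (A j - A j) = 0
        rw [sub_self, Matrix.mul_zero]
      · exact (D.comparison_of_stationary hst j).2)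
  rw [D.integral_flowIntegrand_zero hA] at hmono
  have h1 : (1 : ℝ) ∈ Set.Icc (0 : ℝ) 1 := by simp
  have hval : ∀ x, D.flowIntegrand X 1 x = Real.exp (-Real.pi * (x ⬝ᵥ D.Q *ᵥ x)) *
        ∏ j, smoothed (A j) (D.G j) (ε j) (ν j) (T i j) (D.B j *ᵥ x) ^ D.c j := by
    intro x
    rw [D.flowIntegrand_eq hA.1 h1]
    simp only [hX, simpleMixture_val_one]
  simp only [hval] at hmono
  simp only [hX, simpleMixture_mass] at hmono
  exact hmono

end GenDatum

/-! ### General inputs of type G. -/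

section TypeClass

variable {k : ℕ}

theorem lintegral_smoothing {G : Matrix (Fin k) (Fin k) ℝ} (hG : G.PosDef)
    (μ : Measure (Fin k → ℝ)) [IsFiniteMeasure μ] :
    ∫⁻ x, ∫⁻ y, ENNReal.ofReal (gaussian G (x - y)) ∂μ = μ Set.univ := by
  have hm : Measurable (Function.uncurry fun x y : Fin k → ℝ =>
      ENNReal.ofReal (gaussian G (x - y))) :=
    (ENNReal.continuous_ofReal.comp ((continuous_gaussian G).comp
      (continuous_fst.sub continuous_snd))).measurable
  rw [lintegral_lintegral_swap hm.aemeasurable]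
  simp [lintegral_gaussian_sub hG]

theorem smoothing_eq_ofReal {G : Matrix (Fin k) (Fin k) ℝ} (hG : G.PosDef)
    (μ : Measure (Fin k → ℝ)) [IsFiniteMeasure μ] (x : Fin k → ℝ) :
    ∫⁻ y, ENNReal.ofReal (gaussian G (x - y)) ∂μ =
      ENNReal.ofReal (∫ y, gaussian G (x - y) ∂μ) :=
  (ofReal_integral_eq_lintegral_ofReal (integrable_gaussian_sub hG μ measurable_id x)
    (Filter.Eventually.of_forall fun _ => (gaussian_pos hG _).le)).symm

theorem tendsto_measureReal_restrict_closedBall (μ : Measure (Fin k → ℝ)) [IsFiniteMeasure μ] :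
    Filter.Tendsto (fun R : ℕ => (μ.restrict (Metric.closedBall 0 (R : ℝ))).real Set.univ)
      Filter.atTop (nhds (μ.real Set.univ)) := by
  have hmono : Monotone fun R : ℕ => Metric.closedBall (0 : Fin k → ℝ) (R : ℝ) :=
    fun a b hab => Metric.closedBall_subset_closedBall (by exact_mod_cast hab)
  have hU : ⋃ R : ℕ, Metric.closedBall (0 : Fin k → ℝ) (R : ℝ) = Set.univ := by
    refine Set.eq_univ_of_forall fun z => Set.mem_iUnion.2 ?_
    obtain ⟨R, hR⟩ := exists_nat_ge ‖z‖
    exact ⟨R, by simpa using hR⟩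
  have h := tendsto_measure_iUnion_atTop (μ := μ) hmono
  rw [hU] at h
  have h' := (ENNReal.tendsto_toReal (measure_ne_top μ Set.univ)).comp h
  refine h'.congr fun R => ?_
  simp [Measure.real]

end TypeClass

namespace GenDatum

variable {m n : ℕ} (D : GenDatum m n) {A : D.MatrixTuple}

/-- Inputs are modified so that the integrand only decreases: measures are truncated where c_j > 0,
and g_{A_j}/(R + 1) is added where c_j < 0. Hence the original integral bounds every modified one,
and only the masses have to converge as R → ∞. -/
theorem BLGaussian_le_BL_of_stationary (hD : D.Nondegenerate) (hA : A ∈ D.Lambda)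
    (hAG : ∀ j, A j ≤ D.G j)
    (hst : ∀ j, D.c j • ((A j)⁻¹ - D.B j * (D.Mtilde A)⁻¹ * (D.B j)ᵀ) ≤ 0 ∧
      ((A j)⁻¹ - D.B j * (D.Mtilde A)⁻¹ * (D.B j)ᵀ) * (D.G j - A j) = 0)
    {f : D.Input} (hf : ∀ j, f j ∈ typeClass (D.G j)) : D.BLGaussian A ≤ D.BL f := by
  have hG := D.posDef_G
  choose μ hfin hne hfμ using hf
  have hmass : ∀ j, 0 < (μ j).real Set.univ := fun j =>
    ENNReal.toReal_pos (Measure.measure_univ_pos.2 (hne j)).ne' (measure_ne_top _ _)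
  -- truncated inputs
  set ε : ℕ → Fin m → ℝ := fun R j => if 0 < D.c j then 0 else 1 / ((R : ℝ) + 1) with hεdef
  set ν : ℕ → (j : Fin m) → Measure (Fin (D.dim j) → ℝ) := fun R j =>
    if 0 < D.c j then (μ j).restrict (Metric.closedBall 0 (R : ℝ)) else μ j with hνdef
  have hνfin : ∀ R j, IsFiniteMeasure (ν R j) := by
    intro R j
    simp only [hνdef]
    split_ifs <;> infer_instance
  have hε : ∀ R j, 0 ≤ ε R j := by
    intro R j
    simp only [hεdef]
    split_ifs
    · exact le_rfl
    · positivity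
  have hneg : ∀ R j, D.c j < 0 → 0 < ε R j := by
    intro R j hc
    simp only [hεdef, if_neg hc.le.not_gt]
    positivity
  have hlim : ∀ j, Filter.Tendsto (fun R => ε R j + (ν R j).real Set.univ) Filter.atTop
      (nhds ((μ j).real Set.univ)) := by
    intro j
    by_cases hc : 0 < D.c j
    · simp only [hεdef, hνdef, if_pos hc, zero_add]
      exact tendsto_measureReal_restrict_closedBall (μ j)
    · simp only [hεdef, hνdef, if_neg hc]
      simpa using (tendsto_one_div_add_atTop_nhds_zero_nat (𝕜 := ℝ)).add_const
        ((μ j).real Set.univ)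
  set L : ℝ≥0∞ := ∫⁻ x : Fin n → ℝ, ENNReal.ofReal (Real.exp (-Real.pi * (x ⬝ᵥ D.Q *ᵥ x))) *
    ∏ j, f j (D.B j *ᵥ x) ^ D.c j with hL
  have hev : ∀ᶠ R in Filter.atTop, ENNReal.ofReal
      (D.gaussianValue A * ∏ j, (ε R j + (ν R j).real Set.univ) ^ D.c j) ≤ L := by
    have hposev : ∀ᶠ R in Filter.atTop, ∀ j, 0 < ε R j + (ν R j).real Set.univ :=
      Filter.eventually_all.2 fun j => (hlim j).eventually (lt_mem_nhds (hmass j))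
    filter_upwards [hposev] with R hR
    have hbdd : ∀ j, 0 < D.c j → ∃ r : ℝ, ∀ᵐ z ∂ν R j, ‖z‖ ≤ r := by
      intro j hc
      refine ⟨R, ?_⟩
      simp only [hνdef, if_pos hc]
      filter_upwards [ae_restrict_mem Metric.isClosed_closedBall.measurableSet] with z hz
      simpa using hz
    have := hνfin R
    obtain ⟨hint, hle⟩ := D.gaussianValue_le_integral_smoothed hD hA hAG hst (hε R) (hneg R) hR hbdd
    refine (ENNReal.ofReal_le_ofReal hle).trans ?_
    rw [ofReal_integral_eq_lintegral_ofReal hint (Filter.Eventually.of_forall fun x =>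
      mul_nonneg (Real.exp_pos _).le (Finset.prod_nonneg fun j _ =>
        Real.rpow_nonneg (smoothed_nonneg (hA.1 j) (hG j) (hε R j) _) _))]
    refine lintegral_mono fun x => ?_
    have hpos : ∀ j, 0 < ∫ z, gaussian (D.G j) (D.B j *ᵥ x - z) ∂μ j := fun j =>
      integral_gaussian_sub_pos (hG j) (hne j) measurable_id _
    have hfx : ∀ j, f j (D.B j *ᵥ x) =
        ENNReal.ofReal (∫ z, gaussian (D.G j) (D.B j *ᵥ x - z) ∂μ j) := fun j => by
      rw [hfμ j]
      exact smoothing_eq_ofReal (hG j) (μ j) _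
    simp only [hfx]
    rw [D.ofReal_prod_rpow (fun j => ∫ z, gaussian (D.G j) (D.B j *ᵥ x - z) ∂μ j) hpos,
      ← ENNReal.ofReal_mul (Real.exp_pos _).le]
    refine ENNReal.ofReal_le_ofReal (mul_le_mul_of_nonneg_left (Finset.prod_le_prod
      (fun j _ => Real.rpow_nonneg (smoothed_nonneg (hA.1 j) (hG j) (hε R j) _) _)
      fun j _ => ?_) (Real.exp_pos _).le)
    have hnn := smoothed_nonneg (ν := ν R j) (T := id) (hA.1 j) (hG j) (hε R j) (D.B j *ᵥ x)
    -- A smaller input to a positive power or a larger input to a negative power: both decrease the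
    -- factor.
    by_cases hc : 0 < D.c j
    · refine Real.rpow_le_rpow hnn ?_ hc.le
      simp only [smoothed, hεdef, hνdef, if_pos hc, zero_mul, zero_add, id]
      exact setIntegral_le_integral (integrable_gaussian_sub (hG j) (μ j) measurable_id _)
        (Filter.Eventually.of_forall fun _ => (gaussian_pos (hG j) _).le)
    · refine Real.rpow_le_rpow_of_nonpos (hpos j) ?_ (not_lt.1 hc)
      have hc' : D.c j < 0 := lt_of_le_of_ne (not_lt.1 hc) (D.c_ne_zero j)
      have h1 := mul_pos (hneg R j hc') (gaussian_pos (hA.1 j) (D.B j *ᵥ x))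
      have h2 : ν R j = μ j := by simp only [hνdef, if_neg hc]
      rw [smoothed, h2]
      exact le_add_of_nonneg_left h1.le
  have hfinal : ENNReal.ofReal (D.gaussianValue A * ∏ j, (μ j).real Set.univ ^ D.c j) ≤ L :=
    le_of_tendsto ((ENNReal.continuous_ofReal.tendsto _).comp (tendsto_const_nhds.mul
      (tendsto_finsetProd _ fun j _ => (hlim j).rpow_const (Or.inl (hmass j).ne')))) hev
  have hden : ∏ j, (∫⁻ y, f j y) ^ D.c j =
      ENNReal.ofReal (∏ j, (μ j).real Set.univ ^ D.c j) := by
    rw [← D.ofReal_prod_rpow (fun j => (μ j).real Set.univ) hmass]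
    refine Finset.prod_congr rfl fun j _ => ?_
    rw [hfμ j, lintegral_smoothing (hG j), Measure.real, ENNReal.ofReal_toReal (measure_ne_top _ _)]
  have hprod : 0 < ∏ j, (μ j).real Set.univ ^ D.c j :=
    Finset.prod_pos fun j _ => Real.rpow_pos_of_pos (hmass j) _
  rw [D.BLGaussian_eq hA, Datum.BL, hden, ENNReal.le_div_iff_mul_le
    (Or.inl (ENNReal.ofReal_pos.2 hprod).ne') (Or.inl ENNReal.ofReal_ne_top),
    ← ENNReal.ofReal_mul (Real.exp_pos _).le]
  exact hfinal

/-- The chain BL(A) ≤ I ≤ I_g ≤ BL(A) closes up. -/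
theorem I_eq_Ig_of_stationary (hD : D.Nondegenerate) (hA : A ∈ D.Lambda)
    (hAG : ∀ j, A j ≤ D.G j)
    (hst : ∀ j, D.c j • ((A j)⁻¹ - D.B j * (D.Mtilde A)⁻¹ * (D.B j)ᵀ) ≤ 0 ∧
      ((A j)⁻¹ - D.B j * (D.Mtilde A)⁻¹ * (D.B j)ᵀ) * (D.G j - A j) = 0) :
    D.I = D.Ig ∧ D.Ig = D.BLGaussian A := by
  have hmem : ∀ A' : D.MatrixTuple, (∀ j, (A' j).PosDef ∧ A' j ≤ D.G j) →
      (fun j y => ENNReal.ofReal (gaussian (A' j) y)) ∈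
        {f : D.Input | ∀ j, f j ∈ typeClass (D.G j)} :=
    fun A' hA' j => gaussian_mem_typeClass (hA' j).1 (D.posDef_G j) (hA' j).2
  have h1 : D.BLGaussian A ≤ D.I :=
    le_iInf₂ fun f hf => D.BLGaussian_le_BL_of_stationary hD hA hAG hst hf
  have h2 : D.I ≤ D.Ig := le_iInf₂ fun A' hA' => iInf₂_le _ (hmem A' hA')
  have h3 : D.Ig ≤ D.BLGaussian A := iInf₂_le A fun j => ⟨hA.1 j, hAG j⟩
  exact ⟨le_antisymm h2 (h3.trans h1), le_antisymm h3 (h1.trans h2)⟩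

end GenDatum

end InverseBrascampLieb

end

/-! ### The equivalence. -/

theorem theoremt {m n : ℕ} (D : InverseBrascampLieb.GenDatum m n) (hD : D.Nondegenerate) :
    List.TFAE [
      D.GaussianExtremizable,
      ∃ A ∈ D.Lambda, (∀ j, A j ≤ D.G j) ∧
        ∀ j, D.c j • ((A j)⁻¹ - D.B j * (D.Mtilde A)⁻¹ * (D.B j)ᵀ) ≤ 0 ∧
          ((A j)⁻¹ - D.B j * (D.Mtilde A)⁻¹ * (D.B j)ᵀ) * (D.G j - A j) = 0,
      ∃ A ∈ D.Lambda, (∀ j, A j ≤ D.G j) ∧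
        D.I = D.Ig ∧ D.Ig = D.BLGaussian A ∧ 0 < D.BLGaussian A ∧ D.BLGaussian A < ⊤] := by
  tfae_have 1 → 2 := by
    rintro ⟨A, hA, hAG, hI⟩
    exact ⟨A, hA, hAG, D.stationary_of_gaussianExtremizer hA hAG hI⟩
  tfae_have 2 → 3 := by
    rintro ⟨A, hA, hAG, hst⟩
    obtain ⟨h1, h2⟩ := D.I_eq_Ig_of_stationary hD hA hAG hst
    refine ⟨A, hA, hAG, h1, h2, ?_, ?_⟩
    · rw [D.BLGaussian_eq hA]
      exact ENNReal.ofReal_pos.2 (Real.exp_pos _)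
    · rw [D.BLGaussian_eq hA]
      exact ENNReal.ofReal_lt_top
  tfae_have 3 → 1 := by
    rintro ⟨A, hA, hAG, -, h, -⟩
    exact ⟨A, hA, hAG, h⟩
  tfae_finish
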